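/- **The problem.** An instance of $M3\mid prpt,(n-1,1)\mid C_{\max}$ ($n\ge 1$) consists of $n-1$ flow-shop jobs $\mathcal F=\{J_1,\dots,J_{n-1}\}$ with real processing times $p_j>0$ and one open-shop job $J_n$ with real processing time $q_n>0$. Every job needs its processing time on each of the machines $M_1,M_2,M_3$, without preemption; at any time a job is processed by at most one machine and a machine processes at most one job; a flow-shop job visits $M_1,M_2,M_3$ in this order, and $J_n$ may visit the machines in any order. The makespan of a schedule is the maximum job completion time; $C^*_{\max}$ is the optimal makespan. Write $P(X)=\sum_{J_j\in X}p_j$. **The algorithm $C(\epsilon)$**, $\epsilon>0$. Renumber the flow-shop jobs so that $p_1\ge\dots\ge p_{n-1}$. All job orders below take the jobs of $\mathcal F$, $\mathcal F^1$ and $\mathcal F^2$ by increasing index. 1. If $n\ge 2$ and $p_1\ge q_n$, return the following schedule: $\mathcal F$ is processed consecutively, from time $0$ on $M_1$, from $p_1$ on $M_2$ and from $2p_1$ on $M_3$; $J_n$ starts at $0$ on $M_2$, at $q_n$ on $M_3$ and at $\max\{P(\mathcal F),2q_n\}$ on $M_1$. 2. Otherwise, if $P(\mathcal F)\le q_n$,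 return the following schedule: $\mathcal F$ is processed consecutively from $0$, $q_n$, $2q_n$ on $M_1,M_2,M_3$; $J_n$ starts at $0$ on $M_3$, at $q_n$ on $M_1$ and at $2q_n$ on $M_2$. 3. Otherwise, let $\pi^{2,3,1}$ and $\pi^{3,1,2}$ be the schedules in which $\mathcal F$ is processed consecutively from $0$, $q_n$, $2q_n$ on $M_1,M_2,M_3$ and in which $J_n$ starts, respectively, at $0$ on $M_2$, $q_n$ on $M_3$, $\max\{P(\mathcal F),2q_n\}$ on $M_1$; and at $0$ on $M_3$, $P(\mathcal F)$ on $M_1$, $P(\mathcal F)+q_n$ on $M_2$. 4. For $i=2,\dots,n-1$ and $\mathcal C\subseteq R_i:=\{J_{i+1},\dots,J_{n-1}\}$, put $\mathcal F^1=\{J_i\}\cup\mathcal C$, $\mathcal F^2=\mathcal F\setminus\mathcal F^1$ and $E=\max\{p_i+P(\mathcal F^1),q_n\}+q_n$. Let $\pi^i(\mathcal C)$ be the schedule in which $J_n$ starts at $0$ on $M_3$, at $E-q_n$ on $M_2$ and at $\max\{P(\mathcal F),E\}$ on $M_1$; $\mathcal F^1$ is processed consecutively from $0$, $p_i$, $\max\{2p_i,q_n\}$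 on $M_1,M_2,M_3$; and $\mathcal F^2$ is processed consecutively from $P(\mathcal F^1)$, $E$, $E+p_1$ on $M_1,M_2,M_3$. For each $i=2,\dots,n-1$ compute a schedule $\pi^i$ as follows. - If $2p_i>q_n$, let $\pi^i=\pi^i(\mathcal C)$ for an arbitrary $\mathcal C\subseteq R_i$. - If $2p_i\le q_n$, let $c=q_n-2p_i$. Compute $\mathcal D\subseteq R_i$ with $P(\mathcal D)\le c$ and $P(\mathcal D)\ge(1-\epsilon)P(\mathcal Y)$ for all $\mathcal Y\subseteq R_i$ with $P(\mathcal Y)\le c$. If some subset of $R_i$ has total more than $c$, compute also $\mathcal C\subseteq R_i$ with $P(\mathcal C)>c$ and $P(\mathcal C)\le(1+\epsilon)P(\mathcal X)$ for all $\mathcal X\subseteq R_i$ with $P(\mathcal X)>c$. Let $\pi^i$ be one of $\pi^i(\mathcal C)$ (if $\mathcal C$ was computed) and $\pi^i(\mathcal D)$ with the smaller makespan. 5. Return a schedule of least makespan among $\pi^{2,3,1}$, $\pi^{3,1,2}$ and $\pi^i$, $i=2,\dots,n-1$. **Theorem.** (a) For every $\epsilon>0$ and every instance, every schedule that $C(\epsilon)$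 can return (whatever the choices of the subsets $\mathcal C,\mathcal D$ and however ties are broken) is feasible and has makespan at most $(1+\epsilon)\,C^*_{\max}$. (b) $C(\epsilon)$ can be implemented, by one program that receives $\epsilon$ together with the (unsorted) instance, on a real RAM on which every arithmetic operation, comparison and memory access takes one step, such that for all $\epsilon>0$ and all instances with $n$ jobs it halts with a schedule that $C(\epsilon)$ can return after $$O\Big(n^2\min\{\log n,\log(1/\epsilon)\}+\frac{n}{\epsilon^2}\log(1/\epsilon)\,\min\big\{n,\tfrac1\epsilon\log(1/\epsilon)\big\}\Big)$$ steps, with an absolute constant, where $\log x$ stands for $\max\{1,\ln x\}$. -/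

import Mathlib

namespace MixedShop

/-! ## The three-machine proportionate mixed shop -/

/-- An instance of `M3 | prpt | Cmax` with `l` flow-shop jobs and `k` open-shop jobs. The flow-shop
job `j` needs time `p j` on each of the three machines, the open-shop job `j` needs time `q j` on
each of the three machines. The jobs are not assumed to be listed in any particular order. -/
structure Inst (l k : ℕ) where
  p : Fin l → ℝ
  q : Fin k → ℝ
  p_pos : ∀ j, 0 < p j
  q_pos : ∀ j, 0 < q j

/-- The jobs: `Sum.inl j` is a flow-shop job and `Sum.inr j` an open-shop job. -/
abbrev Job (l k : ℕ) := Fin l ⊕ Fin k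

/-- A (non-preemptive) schedule, given by the start time `S j i` of every job `j` on every machine.
The machines `M₁, M₂, M₃` have the indices `0, 1, 2`. -/
abbrev Schedule (l k : ℕ) := Job l k → Fin 3 → ℝ

variable {l k : ℕ}

/-- The processing time of a job on each machine. -/
def Inst.time (I : Inst l k) : Job l k → ℝ := Sum.elim I.p I.q

/-- Feasibility: no operation starts before time `0`; a job is processed by at most one machine
at a time; a machine processes at most one job at a time; every flow-shop job visits
`M₁, M₂, M₃` in this order. -/
structure Inst.Feasible (I : Inst l k) (S : Schedule l k) : Prop where
  start_nonneg : ∀ j i, 0 ≤ S j i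
  job_disjoint : ∀ j i i', i ≠ i' →
    S j i + I.time j ≤ S j i' ∨ S j i' + I.time j ≤ S j i
  machine_disjoint : ∀ i j j', j ≠ j' →
    S j i + I.time j ≤ S j' i ∨ S j' i + I.time j' ≤ S j i
  flow_order : ∀ (j : Fin l) (i i' : Fin 3), i < i' →
    S (Sum.inl j) i + I.p j ≤ S (Sum.inl j) i'

/-- The makespan: the maximum completion time (a supremum over a finite set). -/
noncomputable def Inst.makespan (I : Inst l k) (S : Schedule l k) : ℝ :=
  ⨆ o : Job l k × Fin 3, (S o.1 o.2 + I.time o.1)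

/-- `S` is a feasible schedule whose makespan is at most `(1 + ε)` times the makespan of every
feasible schedule, that is, at most `(1 + ε)` times the optimal makespan. -/
def Inst.IsApprox (I : Inst l k) (ε : ℝ) (S : Schedule l k) : Prop :=
  I.Feasible S ∧ ∀ S', I.Feasible S' → I.makespan S ≤ (1 + ε) * I.makespan S'

/-- Renumbering of the flow-shop jobs: the new job `j` is the old job `e j`. -/
def Inst.relabel (I : Inst l k) (e : Equiv.Perm (Fin l)) : Inst l k where
  p := I.p ∘ e
  q := I.q
  p_pos := fun j => I.p_pos (e j)
  q_pos := I.q_pos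

/-- The schedule `S` read in the new numbering. -/
def Schedule.relabel (S : Schedule l k) (e : Equiv.Perm (Fin l)) : Schedule l k :=
  fun j => S (Sum.map e id j)

/-- `S` is one of the schedules in `A` whose makespan is least among them. -/
def Inst.IsBest (I : Inst l k) (A : Set (Schedule l k)) (S : Schedule l k) : Prop :=
  S ∈ A ∧ ∀ S' ∈ A, I.makespan S ≤ I.makespan S'

/-- The total processing time `P(X)` (on one machine) of a set of flow-shop jobs. -/
def Inst.P (I : Inst l k) (X : Finset (Fin l)) : ℝ := ∑ j ∈ X, I.p j

/-- The total processing time of the jobs of `X` that precede `j` in the numbering. -/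
def Inst.before (I : Inst l k) (X : Finset (Fin l)) (j : Fin l) : ℝ := I.P (X.filter (· < j))

/-! ## The algorithm C(ε) for one open-shop job

In this part the flow-shop jobs are numbered such that `p 0 ≥ p 1 ≥ ...` (LPT order). With
`n = l + 1` jobs `J_1, ..., J_n`, the flow-shop job `J_{i+1}` is `Sum.inl i`, and the open-shop job
`J_n` is `Sum.inr 0`. `F` is the set of all flow-shop jobs. -/

/-- `q_n`, the processing time of the unique open-shop job. -/
def Inst.qn (I : Inst l 1) : ℝ := I.q 0

/-- `p_1`, the largest processing time of a flow-shop job (`0` if there is none). -/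
noncomputable def Inst.p1 (I : Inst l 1) : ℝ := if h : 0 < l then I.p ⟨0, h⟩ else 0

/-- The flow-shop jobs are processed consecutively in the order of their numbers on all three
machines, starting at time `0` on `M₁`, at time `a` on `M₂` and at time `b` on `M₃`;
the open-shop job starts at time `s i` on the machine `i`. -/
def Inst.blocks (I : Inst l 1) (a b : ℝ) (s : Fin 3 → ℝ) : Schedule l 1
  | Sum.inl j => ![I.before Finset.univ j, a + I.before Finset.univ j, b + I.before Finset.univ j]
  | Sum.inr _ => s

/-- The schedule produced by `A(ε)` when `p_1 ≥ q_n` and `J_n` is the only open-shop job. Then the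
open-shop jobs have total processing time `q_n ≤ p_1`, so `A(ε)` stops in its first step
with the schedule `Proc({J_n}, ∅, F)`: the machine order of `J_n` is `M₂, M₃, M₁`, and the job
orders are `⟨F, J_n⟩` on `M₁`, `⟨J_n, F⟩` on `M₂` and `⟨J_n, F⟩` on `M₃`. -/
noncomputable def Inst.schedA (I : Inst l 1) : Schedule l 1 :=
  I.blocks I.p1 (2 * I.p1) ![max (I.P Finset.univ) (2 * I.qn), 0, I.qn]

/-- The schedule `π⁰` for the case `P(F) ≤ q_n`, with the machine order `M₃, M₁, M₂` of `J_n`. -/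
def Inst.sched0 (I : Inst l 1) : Schedule l 1 :=
  I.blocks I.qn (2 * I.qn) ![I.qn, 2 * I.qn, 0]

/-- The schedule `π^{2,3,1}`, with the machine order `M₂, M₃, M₁` of `J_n`. -/
noncomputable def Inst.sched231 (I : Inst l 1) : Schedule l 1 :=
  I.blocks I.qn (2 * I.qn) ![max (I.P Finset.univ) (2 * I.qn), 0, I.qn]

/-- The schedule `π^{3,1,2}`, with the machine order `M₃, M₁, M₂` of `J_n`. -/
def Inst.sched312 (I : Inst l 1) : Schedule l 1 :=
  I.blocks I.qn (2 * I.qn) ![I.P Finset.univ, I.P Finset.univ + I.qn, 0]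

/-- The schedule with the machine order `M₃, M₂, M₁` of `J_n` in which `F1` is the set of flow-shop
jobs before `J_n` on `M₂` and its complement `F2` is the set of flow-shop jobs after `J_n` on `M₂`.
The numbers `a` and `b` are the largest processing times in `F1` and `F2`.
The job `J_n` starts at time `0` on `M₃` and at time `max {a + P(F1), q_n}` on `M₂`, where it ends
at time `E`. On `M₁` the job order is `⟨F1, F2, J_n⟩`, on `M₂` it is `⟨F1, J_n, F2⟩`, on `M₃` it is
`⟨J_n, F1, F2⟩`; each of `F1`, `F2` is processed in the order of the job numbers,
without idle time. -/
noncomputable def Inst.sched321 (I : Inst l 1) (F1 : Finset (Fin l)) (a b : ℝ) : Schedule l 1 :=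
  let F2 := F1ᶜ
  let E := max (a + I.P F1) I.qn + I.qn
  fun
  | Sum.inl j =>
      if j ∈ F1 then
        ![I.before F1 j, a + I.before F1 j, max (2 * a) I.qn + I.before F1 j]
      else
        ![I.P F1 + I.before F2 j, E + I.before F2 j, E + b + I.before F2 j]
  | Sum.inr _ => ![max (I.P Finset.univ) E, max (a + I.P F1) I.qn, 0]

/-- The schedule `π^i(C, C̄)`, for a flow-shop job `i` other than the first one and a set `C` of jobs
with larger numbers: `F1 = {i} ∪ C`, the largest job of `F1` is `i` and the largest job of
its complement is the first one. -/
noncomputable def Inst.schedI (I : Inst l 1) (i : Fin l) (C : Finset (Fin l)) : Schedule l 1 :=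
  I.sched321 (insert i C) (I.p i) I.p1

/-- Feasible solutions of the Min-Knapsack problem with the items `X` (profit and size of the item
`j` are `p j`) and the capacity `c`: sets of items that do not fit into the knapsack. -/
def Inst.MinKnapFeasible (I : Inst l 1) (X : Finset (Fin l)) (c : ℝ) (C : Finset (Fin l)) : Prop :=
  C ⊆ X ∧ c < I.P C

/-- `C` is a `(1 + ε)`-approximate solution of the Min-Knapsack problem. -/
def Inst.MinKnapApprox (I : Inst l 1) (ε : ℝ) (X : Finset (Fin l)) (c : ℝ)
    (C : Finset (Fin l)) : Prop :=
  I.MinKnapFeasible X c C ∧ ∀ C', I.MinKnapFeasible X c C' → I.P C ≤ (1 + ε) * I.P C'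

/-- Feasible solutions of the Max-Knapsack problem with the items `X` and the capacity `c`. -/
def Inst.MaxKnapFeasible (I : Inst l 1) (X : Finset (Fin l)) (c : ℝ) (D : Finset (Fin l)) : Prop :=
  D ⊆ X ∧ I.P D ≤ c

/-- `D` is a `(1 - ε)`-approximate solution of the Max-Knapsack problem. -/
def Inst.MaxKnapApprox (I : Inst l 1) (ε : ℝ) (X : Finset (Fin l)) (c : ℝ)
    (D : Finset (Fin l)) : Prop :=
  I.MaxKnapFeasible X c D ∧ ∀ D', I.MaxKnapFeasible X c D' → (1 - ε) * I.P D' ≤ I.P D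

/-- The possible results of the algorithm `B(ε)` for the job `i`. The items are the jobs with larger
numbers than `i`, the capacity is `q_n - 2 p_i`. The result is the better one of `π^i(C, C̄)` and
`π^i(D, D̄)`, where `C` and `D` are approximate solutions of Min-Knapsack and Max-Knapsack.
If Min-Knapsack has no feasible solution, the first schedule is absent. -/
def Inst.ResultB (I : Inst l 1) (ε : ℝ) (i : Fin l) (S : Schedule l 1) : Prop :=
  ∃ D, I.MaxKnapApprox ε (Finset.Ioi i) (I.qn - 2 * I.p i) D ∧
    ((∃ C, I.MinKnapApprox ε (Finset.Ioi i) (I.qn - 2 * I.p i) C ∧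
        I.IsBest {I.schedI i C, I.schedI i D} S) ∨
      ((¬ ∃ C, I.MinKnapFeasible (Finset.Ioi i) (I.qn - 2 * I.p i) C) ∧ S = I.schedI i D))

/-- The possible schedules for the job `i` in the loop of `C(ε)`. If `2 p_i > q_n` then
`π^i(C, C̄)` may be taken for any set `C` of jobs with larger numbers than `i`; otherwise
`B(ε)` is run. -/
def Inst.ResultI (I : Inst l 1) (ε : ℝ) (i : Fin l) (S : Schedule l 1) : Prop :=
  (I.qn < 2 * I.p i ∧ ∃ C ⊆ Finset.Ioi i, S = I.schedI i C) ∨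
    (2 * I.p i ≤ I.qn ∧ I.ResultB ε i S)

open Classical in
/-- The possible results of the algorithm `C(ε)` when the flow-shop jobs are numbered in LPT order.
Different results come from different approximate solutions of the knapsack problems and from ties.
The family `f` collects the schedules computed for the jobs `i` other than the first. -/
def Inst.SortedResultC (I : Inst l 1) (ε : ℝ) (S : Schedule l 1) : Prop :=
  if I.qn ≤ I.p1 then S = I.schedA
  else if I.P Finset.univ ≤ I.qn then S = I.sched0
  else ∃ f : Fin l → Schedule l 1, (∀ i, 0 < i.val → I.ResultI ε i (f i)) ∧
    I.IsBest ({I.sched231, I.sched312} ∪ f '' {i | 0 < i.val}) S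

/-- The possible results of the algorithm `C(ε)`: the flow-shop jobs are renumbered in
LPT order first (ties are broken arbitrarily). -/
def Inst.ResultC (I : Inst l 1) (ε : ℝ) (S : Schedule l 1) : Prop :=
  ∃ e : Equiv.Perm (Fin l), Antitone (I.p ∘ e) ∧ (I.relabel e).SortedResultC ε (S.relabel e)

/-! ## The machine model: a structured real RAM

There are integer registers and arrays (holding natural numbers) and real registers and arrays.
Integers can be added, subtracted (truncated at `0`) and compared, and they serve as array
indices. Reals can be added, subtracted, multiplied, divided and compared; there is
no rounding and no conversion from reals to integers, and the only constants are natural numbers.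
Every operation, including every access to a register or an array cell, costs one step. -/

structure State where
  ireg : ℕ → ℕ
  rreg : ℕ → ℝ
  iarr : ℕ → ℕ → ℕ
  rarr : ℕ → ℕ → ℝ

/-- Integer expressions; `get a e` is the cell with index `e` of the integer array `a`. -/
inductive IExp where
  | lit (c : ℕ)
  | reg (x : ℕ)
  | get (a : ℕ) (e : IExp)
  | add (e₁ e₂ : IExp)
  | sub (e₁ e₂ : IExp)

/-- Real expressions; `get a e` is the cell with index `e` of the real array `a`. -/
inductive RExp where
  | ofInt (e : IExp)
  | reg (x : ℕ)
  | get (a : ℕ) (e : IExp)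
  | add (e₁ e₂ : RExp)
  | sub (e₁ e₂ : RExp)
  | mul (e₁ e₂ : RExp)
  | div (e₁ e₂ : RExp)

/-- Tests. -/
inductive BExp where
  | ile (e₁ e₂ : IExp)
  | rle (e₁ e₂ : RExp)
  | neg (b : BExp)
  | conj (b₁ b₂ : BExp)

/-- Programs. -/
inductive Prog where
  | skip
  | iset (x : ℕ) (e : IExp)
  | rset (x : ℕ) (e : RExp)
  | iput (a : ℕ) (i e : IExp)
  | rput (a : ℕ) (i : IExp) (e : RExp)
  | seq (c₁ c₂ : Prog)
  | ite (b : BExp) (c₁ c₂ : Prog)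
  | loop (b : BExp) (c : Prog)

def IExp.eval (s : State) : IExp → ℕ
  | lit c => c
  | reg x => s.ireg x
  | get a e => s.iarr a (e.eval s)
  | add e₁ e₂ => e₁.eval s + e₂.eval s
  | sub e₁ e₂ => e₁.eval s - e₂.eval s

/-- The number of operations in an integer expression. -/
def IExp.cost : IExp → ℕ
  | lit _ => 1
  | reg _ => 1
  | get _ e => e.cost + 1
  | add e₁ e₂ => e₁.cost + e₂.cost + 1
  | sub e₁ e₂ => e₁.cost + e₂.cost + 1

noncomputable def RExp.eval (s : State) : RExp → ℝ
  | ofInt e => (e.eval s : ℝ)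
  | reg x => s.rreg x
  | get a e => s.rarr a (e.eval s)
  | add e₁ e₂ => e₁.eval s + e₂.eval s
  | sub e₁ e₂ => e₁.eval s - e₂.eval s
  | mul e₁ e₂ => e₁.eval s * e₂.eval s
  | div e₁ e₂ => e₁.eval s / e₂.eval s

/-- The number of operations in a real expression. -/
def RExp.cost : RExp → ℕ
  | ofInt e => e.cost + 1
  | reg _ => 1
  | get _ e => e.cost + 1
  | add e₁ e₂ => e₁.cost + e₂.cost + 1
  | sub e₁ e₂ => e₁.cost + e₂.cost + 1
  | mul e₁ e₂ => e₁.cost + e₂.cost + 1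
  | div e₁ e₂ => e₁.cost + e₂.cost + 1

def BExp.Holds (s : State) : BExp → Prop
  | ile e₁ e₂ => e₁.eval s ≤ e₂.eval s
  | rle e₁ e₂ => e₁.eval s ≤ e₂.eval s
  | neg b => ¬ b.Holds s
  | conj b₁ b₂ => b₁.Holds s ∧ b₂.Holds s

/-- The number of operations in a test. -/
def BExp.cost : BExp → ℕ
  | ile e₁ e₂ => e₁.cost + e₂.cost + 1
  | rle e₁ e₂ => e₁.cost + e₂.cost + 1
  | neg b => b.cost + 1
  | conj b₁ b₂ => b₁.cost + b₂.cost + 1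

/-- `Exec c s s' t`: started in the state `s`, the program `c` halts in the state `s'` after
`t` steps. -/
inductive Exec : Prog → State → State → ℕ → Prop
  | skip (s : State) : Exec .skip s s 1
  | iset (x : ℕ) (e : IExp) (s : State) :
      Exec (.iset x e) s { s with ireg := Function.update s.ireg x (e.eval s) } (e.cost + 1)
  | rset (x : ℕ) (e : RExp) (s : State) :
      Exec (.rset x e) s { s with rreg := Function.update s.rreg x (e.eval s) } (e.cost + 1)
  | iput (a : ℕ) (i e : IExp) (s : State) :
      Exec (.iput a i e) s
        { s with iarr := Function.update s.iarr a
                  (Function.update (s.iarr a) (i.eval s) (e.eval s)) }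
        (i.cost + e.cost + 1)
  | rput (a : ℕ) (i : IExp) (e : RExp) (s : State) :
      Exec (.rput a i e) s
        { s with rarr := Function.update s.rarr a
                  (Function.update (s.rarr a) (i.eval s) (e.eval s)) }
        (i.cost + e.cost + 1)
  | seq {c₁ c₂ : Prog} {s s' s'' : State} {t t' : ℕ} :
      Exec c₁ s s' t → Exec c₂ s' s'' t' → Exec (.seq c₁ c₂) s s'' (t + t')
  | ite_true {b : BExp} {c₁ c₂ : Prog} {s s' : State} {t : ℕ} :
      b.Holds s → Exec c₁ s s' t → Exec (.ite b c₁ c₂) s s' (b.cost + t)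
  | ite_false {b : BExp} {c₁ c₂ : Prog} {s s' : State} {t : ℕ} :
      ¬ b.Holds s → Exec c₂ s s' t → Exec (.ite b c₁ c₂) s s' (b.cost + t)
  | loop_true {b : BExp} {c : Prog} {s s' s'' : State} {t t' : ℕ} :
      b.Holds s → Exec c s s' t → Exec (.loop b c) s' s'' t' →
      Exec (.loop b c) s s'' (b.cost + t + t')
  | loop_false {b : BExp} {c : Prog} {s : State} :
      ¬ b.Holds s → Exec (.loop b c) s s b.cost

/-- The initial state for the input `ε` and `I`: the integer register `0` holds the number `l + 1` of
jobs, the real register `0` holds `ε`, the real array `0` holds the processing times of the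
flow-shop jobs (in the order in which they are given) followed by that of the open-shop job;
everything else is `0`. -/
noncomputable def inputState (ε : ℝ) (I : Inst l 1) : State where
  ireg := fun x => if x = 0 then l + 1 else 0
  rreg := fun x => if x = 0 then ε else 0
  iarr := fun _ _ => 0
  rarr := fun a j => if a = 0 then
      (if h : j < l then I.p ⟨j, h⟩ else if j = l then I.qn else 0) else 0

/-- The schedule that is read off from a final state: the real arrays `1`, `2`, `3` hold the start
times on `M₁`, `M₂`, `M₃`, first of the flow-shop jobs and then of the open-shop job. -/
def outputSchedule (l : ℕ) (s : State) : Schedule l 1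
  | Sum.inl j => fun i => s.rarr (i.val + 1) j.val
  | Sum.inr _ => fun i => s.rarr (i.val + 1) l

/-- The logarithm in running time bounds, `max {1, ln x}`. -/
noncomputable def lg (x : ℝ) : ℝ := max 1 (Real.log x)

/-- `n² min{log n, log(1/ε)} + (n/ε²) log(1/ε) min{n, (1/ε) log(1/ε)}`. -/
noncomputable def timeBound (n : ℕ) (ε : ℝ) : ℝ :=
  (n : ℝ) ^ 2 * min (lg n) (lg (1 / ε)) +
    (n : ℝ) / ε ^ 2 * lg (1 / ε) * min (n : ℝ) (1 / ε * lg (1 / ε))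

end MixedShop

/-! Approximation. Every feasible schedule has makespan at least `3 q_n` (`open_bound`) and at least
`2 p_a + P(F)` for each flow-shop job `a` (`flow_bound`), so `schedA` and `sched0` are optimal where
they are returned. In the remaining case, cut a feasible schedule at the operation of `J_n` on `M₂`
(`split_bound`). Either its makespan is at least `P(F) + 2 q_n`, which is the makespan of
`π^{2,3,1}`, or `J_n` visits `M₃, M₂, M₁`, and the flow-shop jobs before and after the cut obey
two-machine flow-shop bounds on either side of it. These bounds are symmetric under reversal of
time, so the first job may be assumed to lie after the cut; with `i` the largest job before it, some
`π^i(C)` is at least as good as the given schedule, unless nothing lies before it and `π^{2,3,1}`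
already is (`exists_schedI`).

For fixed `i` the makespan of `π^i(C)` depends on `P(C)` only. It is nonincreasing up to `c = q_n -
2 p_i` and nondecreasing beyond, so the best `C` solves Max-Knapsack or Min-Knapsack with capacity
`c`. A relative error `ε` in `P(C)` costs at most `ε P(C)`, which is at most `ε` times the makespan.
If `c < 0`, no `π^i(C)` beats `π^{2,3,1}` (`ResultI.approx`).

Running time. For each `i` one dynamic program of precision `η = min ε 1 / 8` serves both knapsack
problems. Items heavier than `c` are set aside: they never fit, and only the lightest of them
matters for Min-Knapsack. Items heavier than `η c` are split into classes of ratio at most `1 + η`.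
Within a class a subset may be exchanged for equally many first or last items (`class_cover`), so
`O(1/η)` items at both ends suffice. Lighter items are glued into consecutive groups of weight at
most `2 η c`. This leaves `O(min {n, η⁻² log (1/η)})` items.

The program keeps a sorted list of attainable weights up to `3 c`. For each item the list is merged
with its translate and thinned out to length `O(1/η)`. The error does not accumulate, because the
invariant is two-sided: every weight of the family up to `3 c - η c` lies between two list values at
distance at most `η c`, and such brackets survive translation, merging and trimming (`Trim.bracket`,
`Merge.finish`). The last value not above `c` and its successor then answer both problems, up to the
comparison with one big item (`Seg.select`). Summing over the jobs and adding a quadratic sort stays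
within the bound (`steps_le_timeBound`).

The program is verified with a calculus of total correctness carrying a clock (`WP`). Sets are
stored as chains of intervals in a heap in which finished lists are never changed. -/

namespace MixedShop

/-! ### Lower bounds on the makespan of feasible schedules. -/

section Approximation

variable {l k : ℕ}

theorem Inst.time_pos (I : Inst l k) (j : Job l k) : 0 < I.time j := by
  cases j with
  | inl j => exact I.p_pos j
  | inr j => exact I.q_pos j

theorem Inst.completion_le_makespan (I : Inst l k) (S : Schedule l k) (j : Job l k) (i : Fin 3) :
    S j i + I.time j ≤ I.makespan S :=
  le_ciSup (f := fun o : Job l k × Fin 3 => S o.1 o.2 + I.time o.1)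
    (Set.finite_range _).bddAbove (j, i)

theorem Inst.makespan_le (I : Inst l 1) (S : Schedule l 1) {m : ℝ}
    (h : ∀ j i, S j i + I.time j ≤ m) : I.makespan S ≤ m := by
  have : Nonempty (Job l 1 × Fin 3) := ⟨(Sum.inr 0, 0)⟩
  exact ciSup_le fun o => h o.1 o.2

/-- Operations of distinct jobs on one machine inside a time window fit into it. -/
theorem Inst.Feasible.sum_time_le {I : Inst l k} {S : Schedule l k} (hS : I.Feasible S)
    (i : Fin 3) (a : ℝ) : ∀ (n : ℕ) (X : Finset (Job l k)), X.card = n → ∀ b, a ≤ b →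
      (∀ j ∈ X, a ≤ S j i ∧ S j i + I.time j ≤ b) → a + ∑ j ∈ X, I.time j ≤ b := by
  intro n
  induction n with
  | zero =>
    intro X hX b hab _
    rw [Finset.card_eq_zero.1 hX]; simpa using hab
  | succ n ih =>
    intro X hX b hab h
    have hne : X.Nonempty := Finset.card_pos.1 (by omega)
    -- Remove the job that starts last on the machine: the others are finished when it starts.
    obtain ⟨m, hm, hmax⟩ := Finset.exists_max_image X (fun j => S j i) hne
    have := ih (X.erase m) (by rw [Finset.card_erase_of_mem hm]; omega) (S m i) (h m hm).1
      (fun j hj => by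
        obtain ⟨hjm, hj⟩ := Finset.mem_erase.1 hj
        refine ⟨(h j hj).1, ?_⟩
        rcases hS.machine_disjoint i j m hjm with h1 | h1
        · exact h1
        · have := hmax j hj
          have := I.time_pos m
          linarith)
    rw [← Finset.add_sum_erase _ _ hm]
    have := (h m hm).2
    linarith

theorem Inst.Feasible.P_le {I : Inst l k} {S : Schedule l k} (hS : I.Feasible S)
    (i : Fin 3) (a b : ℝ) (hab : a ≤ b) (A : Finset (Fin l))
    (h : ∀ j ∈ A, a ≤ S (.inl j) i ∧ S (.inl j) i + I.p j ≤ b) : a + I.P A ≤ b := by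
  have := hS.sum_time_le i a _ (A.map .inl) rfl b hab (by
    intro j hj
    obtain ⟨j, hj', rfl⟩ := Finset.mem_map.1 hj
    exact h j hj')
  simpa [Inst.P, Inst.time] using this

theorem Inst.Feasible.P_add_qn_le {I : Inst l 1} {S : Schedule l 1} (hS : I.Feasible S)
    (i : Fin 3) (a b : ℝ) (A : Finset (Fin l))
    (h : ∀ j ∈ A, a ≤ S (.inl j) i ∧ S (.inl j) i + I.p j ≤ b)
    (hn : a ≤ S (.inr 0) i) (hn' : S (.inr 0) i + I.qn ≤ b) : a + I.P A + I.qn ≤ b := by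
  have hq := I.q_pos 0
  have := hS.sum_time_le i a _ (A.disjSum {0}) rfl b (by unfold Inst.qn at *; linarith) (by
    intro j hj
    rcases Finset.mem_disjSum.1 hj with ⟨j, hj', rfl⟩ | ⟨j, hj', rfl⟩
    · exact h j hj'
    · rw [Finset.mem_singleton] at hj'; subst hj'
      exact ⟨hn, hn'⟩)
  rw [Finset.sum_disjSum] at this
  simp only [Finset.sum_singleton] at this
  have e : I.P A = ∑ x ∈ A, I.time (.inl x) := rfl
  have e' : I.qn = I.time (.inr 0) := rfl
  rw [e, e']; linarith

theorem Inst.P_split (I : Inst l k) (A : Finset (Fin l)) (f : Fin l → Prop) [DecidablePred f] :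
    I.P (A.filter f) + I.P (A.filter fun j => ¬ f j) = I.P A :=
  Finset.sum_filter_add_sum_filter_not A f I.p

theorem Inst.P_nonneg (I : Inst l k) (A : Finset (Fin l)) : 0 ≤ I.P A :=
  Finset.sum_nonneg fun j _ => (I.p_pos j).le

theorem Inst.P_insert (I : Inst l k) {A : Finset (Fin l)} {i : Fin l} (h : i ∉ A) :
    I.P (insert i A) = I.p i + I.P A := Finset.sum_insert h

theorem Inst.P_mono (I : Inst l k) {A B : Finset (Fin l)} (h : A ⊆ B) : I.P A ≤ I.P B :=
  Finset.sum_le_sum_of_subset_of_nonneg h fun j _ _ => (I.p_pos j).le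

theorem Inst.P_compl (I : Inst l k) (A : Finset (Fin l)) :
    I.P A + I.P Aᶜ = I.P Finset.univ := Finset.sum_add_sum_compl A I.p

theorem Inst.p_le_P (I : Inst l k) {A : Finset (Fin l)} {j : Fin l} (h : j ∈ A) :
    I.p j ≤ I.P A := Finset.single_le_sum (f := I.p) (fun j _ => (I.p_pos j).le) h

theorem Inst.Feasible.flow01 {I : Inst l k} {S : Schedule l k} (hS : I.Feasible S) (j : Fin l) :
    S (.inl j) 0 + I.p j ≤ S (.inl j) 1 := hS.flow_order j 0 1 (by decide)

theorem Inst.Feasible.flow12 {I : Inst l k} {S : Schedule l k} (hS : I.Feasible S) (j : Fin l) :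
    S (.inl j) 1 + I.p j ≤ S (.inl j) 2 := hS.flow_order j 1 2 (by decide)

/-- Jobs starting on `M₂` no later than `y` are done with `M₁` by `y`. -/
theorem Inst.Feasible.P_le_of_start {I : Inst l k} {S : Schedule l k} (hS : I.Feasible S)
    (y : ℝ) (hy : 0 ≤ y) (A : Finset (Fin l)) (h : ∀ j ∈ A, S (.inl j) 1 ≤ y) : I.P A ≤ y := by
  have := hS.P_le 0 0 y hy A fun j hj => ⟨hS.start_nonneg _ _, by
    have := hS.flow01 j
    have := h j hj
    linarith⟩
  linarith

/-- Two-machine bound: flow-shop jobs completed on `M₂` by time `x`. -/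
theorem Inst.Feasible.head_bound {I : Inst l k} {S : Schedule l k} (hS : I.Feasible S)
    (x : ℝ) (A : Finset (Fin l)) (a : Fin l) (ha : a ∈ A)
    (h : ∀ j ∈ A, S (.inl j) 1 + I.p j ≤ x) : I.p a + I.P A ≤ x := by
  set y := S (.inl a) 1 with hy
  have hy0 : 0 ≤ y := hS.start_nonneg _ _
  -- A critical path through `a`: the jobs ahead of `a` on `M₂`, and `a` itself, leave `M₁` by time
  -- `y`; the other jobs of `A`, again including `a`, follow on `M₂`. So `a` counts twice.
  have h1 := hS.P_le_of_start y hy0 (insert a (A.filter fun j => S (.inl j) 1 < y)) (by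
    intro j hj
    rcases Finset.mem_insert.1 hj with rfl | hj
    · exact le_refl _
    · exact (Finset.mem_filter.1 hj).2.le)
  rw [I.P_insert (by simp [hy])] at h1
  have hpa := I.p_pos a
  have h2 := hS.P_le 1 y x (by linarith [h a ha]) (A.filter fun j => ¬ S (.inl j) 1 < y) (by
    intro j hj
    obtain ⟨hj, hj'⟩ := Finset.mem_filter.1 hj
    exact ⟨not_lt.1 hj', h j hj⟩)
  have := I.P_split A fun j => S (.inl j) 1 < y
  linarith

/-- Two-machine bound: flow-shop jobs started on `M₂` after time `x`. -/
theorem Inst.Feasible.tail_bound {I : Inst l k} {S : Schedule l k} (hS : I.Feasible S)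
    (x : ℝ) (A : Finset (Fin l)) (a : Fin l) (ha : a ∈ A)
    (h : ∀ j ∈ A, x ≤ S (.inl j) 1) : x + I.p a + I.P A ≤ I.makespan S := by
  set y := S (.inl a) 1 with hy
  have hpa := I.p_pos a
  -- The mirrored critical path: jobs ahead of `a` occupy `M₂` between `x` and `y`, and the rest,
  -- including `a`, occupies `M₃` after `y + p a`.
  have h1 := hS.P_le 1 x y (h a ha) (A.filter fun j => S (.inl j) 1 < y) (by
    intro j hj
    obtain ⟨hj, hj'⟩ := Finset.mem_filter.1 hj
    refine ⟨h j hj, ?_⟩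
    rcases hS.machine_disjoint 1 (.inl j) (.inl a) (by rintro ⟨⟩; exact lt_irrefl _ hj')
      with h1 | h1
    · exact h1
    · have : y + I.p a ≤ S (.inl j) 1 := h1
      linarith)
  have hfin := fun j => I.completion_le_makespan S (.inl j) 2
  have h2 := hS.P_le 2 (y + I.p a) (I.makespan S)
    (by
      have h3 := hfin a
      have h4 := hS.flow12 a
      have : I.time (.inl a) = I.p a := rfl
      linarith)
    (A.filter fun j => ¬ S (.inl j) 1 < y) (by
    intro j hj
    obtain ⟨hj, hj'⟩ := Finset.mem_filter.1 hj
    refine ⟨?_, hfin j⟩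
    have h3 := hS.flow12 j
    have hpj := I.p_pos j
    by_cases hja : j = a
    · subst hja; linarith
    · rcases hS.machine_disjoint 1 (.inl j) (.inl a) (by rintro ⟨⟩; exact hja rfl) with h1 | h1
      · have : S (.inl j) 1 + I.p j ≤ y := h1
        exact absurd (by linarith) hj'
      · have : y + I.p a ≤ S (.inl j) 1 := h1
        linarith)
  have := I.P_split A fun j => S (.inl j) 1 < y
  linarith

/-- The critical path meets `a` on all three machines: the jobs ahead of `a` on `M₂` are charged on
`M₁` together with `a`, and `tail_bound` charges the others together with `a` once more. -/
theorem Inst.Feasible.flow_bound {I : Inst l k} {S : Schedule l k} (hS : I.Feasible S)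
    (a : Fin l) : 2 * I.p a + I.P Finset.univ ≤ I.makespan S := by
  set y := S (.inl a) 1 with hy
  have hy0 : 0 ≤ y := hS.start_nonneg _ _
  have h1 := hS.P_le_of_start y hy0
    (insert a (Finset.univ.filter fun j => S (.inl j) 1 < y)) (by
    intro j hj
    rcases Finset.mem_insert.1 hj with rfl | hj
    · exact le_refl _
    · exact (Finset.mem_filter.1 hj).2.le)
  rw [I.P_insert (by simp [hy])] at h1
  have h2 := hS.tail_bound y (Finset.univ.filter fun j => ¬ S (.inl j) 1 < y) a (by simp [hy])
    (by simp)
  have := I.P_split Finset.univ fun j => S (.inl j) 1 < y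
  linarith

theorem Inst.Feasible.open_bound {I : Inst l 1} {S : Schedule l 1} (hS : I.Feasible S) :
    3 * I.qn ≤ I.makespan S := by
  have h0 := I.completion_le_makespan S (.inr 0) 0
  have h1 := I.completion_le_makespan S (.inr 0) 1
  have h2 := I.completion_le_makespan S (.inr 0) 2
  have n0 := hS.start_nonneg (.inr 0) 0
  have n1 := hS.start_nonneg (.inr 0) 1
  have n2 := hS.start_nonneg (.inr 0) 2
  have hq : 0 < I.time (.inr 0) := I.time_pos _
  have e : I.qn = I.time (.inr 0) := rfl
  rw [e]
  rcases hS.job_disjoint (.inr 0) 0 1 (by decide) with a | a <;>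
  rcases hS.job_disjoint (.inr 0) 1 2 (by decide) with b | b <;>
  rcases hS.job_disjoint (.inr 0) 0 2 (by decide) with c | c <;> linarith

/-- The lower bound in terms of the jobs before and after `J_n` on `M₂`. -/
theorem Inst.Feasible.split_bound {I : Inst l 1} {S : Schedule l 1} (hS : I.Feasible S) :
    I.P Finset.univ + 2 * I.qn ≤ I.makespan S ∨
    (I.P Finset.univ + I.qn ≤ I.makespan S ∧ ∃ (A : Finset (Fin l)) (x : ℝ),
      I.qn ≤ x ∧ (∀ a ∈ A, I.p a + I.P A ≤ x) ∧
      x + I.qn + I.qn ≤ I.makespan S ∧ (∀ b ∈ Aᶜ, x + I.qn + I.p b + I.P Aᶜ ≤ I.makespan S)) := by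
  set x := S (.inr 0) 1 with hx
  have x0 : 0 ≤ x := hS.start_nonneg _ _
  set A := Finset.univ.filter fun j => S (.inl j) 1 < x with hA
  have hAc : Aᶜ = Finset.univ.filter fun j => ¬ S (.inl j) 1 < x := by ext; simp [hA]
  have hdis : ∀ j : Fin l, S (.inl j) 1 + I.p j ≤ x ∨ x + I.qn ≤ S (.inl j) 1 := fun j =>
    hS.machine_disjoint 1 (.inl j) (.inr 0) (by rintro ⟨⟩)
  have hq : 0 < I.qn := I.q_pos 0
  have hbef : ∀ j ∈ A, S (.inl j) 1 + I.p j ≤ x := by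
    intro j hj
    have := (Finset.mem_filter.1 hj).2
    rcases hdis j with h | h
    · exact h
    · linarith
  have haft : ∀ j ∈ Aᶜ, x + I.qn ≤ S (.inl j) 1 := by
    intro j hj
    rw [hAc] at hj
    have := (Finset.mem_filter.1 hj).2
    have := I.p_pos j
    rcases hdis j with h | h
    · linarith
    · exact h
  have hsum := I.P_compl A
  have hPA : I.P A ≤ x := hS.P_le_of_start x x0 A fun j hj => (Finset.mem_filter.1 hj).2.le
  have hn := I.completion_le_makespan S (.inr 0)
  have hfin := fun j => I.completion_le_makespan S (.inl j) 2
  have etime : I.time (.inr 0) = I.qn := rfl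
  -- If `J_n` visits `M₂` before `M₃`, it shares `M₃` after the cut with the jobs of `Aᶜ`; if it
  -- visits `M₁` before `M₂`, it shares `M₁` before the cut with the jobs of `A`. Either costs a
  -- second `q_n`. Only the order `M₃, M₂, M₁` remains.
  rcases hS.job_disjoint (.inr 0) 1 2 (by decide) with h12 | h21
  · left
    have h12' : x + I.qn ≤ S (.inr 0) 2 := h12
    have := hS.P_add_qn_le 2 (x + I.qn) (I.makespan S) Aᶜ
      (fun j hj => ⟨by have := haft j hj; have := hS.flow12 j; have := I.p_pos j; linarith,
        hfin j⟩) h12' (hn 2)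
    linarith
  · rcases hS.job_disjoint (.inr 0) 0 1 (by decide) with h01 | h10
    · left
      have h01' : S (.inr 0) 0 + I.qn ≤ x := h01
      have h1 := hS.P_add_qn_le 0 0 x A (fun j hj => ⟨hS.start_nonneg _ _, by
        have := hbef j hj; have := hS.flow01 j; have := I.p_pos j; linarith⟩)
        (hS.start_nonneg _ _) h01'
      have h2 := hS.P_le 1 (x + I.qn) (I.makespan S)
        (hn 1) Aᶜ (fun j hj => ⟨haft j hj, I.completion_le_makespan S (.inl j) 1⟩)
      have h3 : ∀ b ∈ Aᶜ, x + I.qn + I.p b + I.P Aᶜ ≤ I.makespan S := fun b hb =>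
        hS.tail_bound _ _ b hb haft
      by_cases hA0 : (Aᶜ).Nonempty
      · obtain ⟨b, hb⟩ := hA0
        have := h3 b hb
        have := I.p_pos b
        linarith
      · rw [Finset.not_nonempty_iff_eq_empty] at hA0
        have : I.P Aᶜ = 0 := by rw [hA0]; rfl
        have := hn 1
        rw [etime] at this
        linarith
    · right
      rw [etime] at h10 h21
      refine ⟨?_, A, x, ?_, fun a ha => hS.head_bound x A a ha hbef, ?_, fun b hb =>
        hS.tail_bound _ _ b hb haft⟩
      · have := hS.P_add_qn_le 0 0 (I.makespan S) Finset.univ (fun j _ =>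
          ⟨hS.start_nonneg _ _, I.completion_le_makespan S (.inl j) 0⟩) (hS.start_nonneg _ _) (hn 0)
        linarith
      · have := hS.start_nonneg (.inr 0) 2
        linarith
      · have := hn 0
        rw [etime] at this
        linarith

end Approximation

/-! ### Feasibility and makespan of the schedules with one block of flow-shop jobs. -/

section Schedules

variable {l : ℕ}

theorem Inst.before_nonneg (I : Inst l 1) (X : Finset (Fin l)) (j : Fin l) : 0 ≤ I.before X j :=
  I.P_nonneg _

theorem Inst.before_add_le (I : Inst l 1) {X : Finset (Fin l)} {j j' : Fin l} (hj : j ∈ X)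
    (h : j < j') : I.before X j + I.p j ≤ I.before X j' := by
  have : j ∉ X.filter (· < j) := by simp
  rw [add_comm, Inst.before, ← I.P_insert this]
  refine I.P_mono ?_
  intro a ha
  rcases Finset.mem_insert.1 ha with rfl | ha
  · exact Finset.mem_filter.2 ⟨hj, h⟩
  · obtain ⟨ha, ha'⟩ := Finset.mem_filter.1 ha
    exact Finset.mem_filter.2 ⟨ha, ha'.trans h⟩

theorem Inst.before_add_le_P (I : Inst l 1) {X : Finset (Fin l)} {j : Fin l} (hj : j ∈ X) :
    I.before X j + I.p j ≤ I.P X := by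
  have : j ∉ X.filter (· < j) := by simp
  rw [add_comm, Inst.before, ← I.P_insert this]
  exact I.P_mono (Finset.insert_subset hj (Finset.filter_subset _ _))

/-- The last job of `X` is the witness. It shows that upper estimates of makespans are attained. -/
theorem Inst.P_eq_before_add (I : Inst l 1) {X : Finset (Fin l)} (hX : X.Nonempty) :
    ∃ j ∈ X, I.before X j + I.p j = I.P X := by
  refine ⟨X.max' hX, X.max'_mem hX, ?_⟩
  have : X.max' hX ∉ X.filter (· < X.max' hX) := by simp
  rw [add_comm, Inst.before, ← I.P_insert this]
  congr 1
  ext a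
  simp only [Finset.mem_insert, Finset.mem_filter]
  constructor
  · rintro (rfl | ⟨h, _⟩)
    · exact X.max'_mem hX
    · exact h
  · intro h
    rcases (X.le_max' a h).eq_or_lt with h' | h'
    · exact Or.inl h'
    · exact Or.inr ⟨h, h'⟩

/-- Feasibility of a schedule with the flow-shop jobs in one block on each machine. -/
theorem Inst.blocks_feasible (I : Inst l 1) (a b : ℝ) (s : Fin 3 → ℝ) (ha : ∀ j, I.p j ≤ a)
    (ha0 : 0 ≤ a) (hb : ∀ j, a + I.p j ≤ b) (hab : a ≤ b) (hs : ∀ i, 0 ≤ s i)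
    (hsd : ∀ i i', i ≠ i' → s i + I.qn ≤ s i' ∨ s i' + I.qn ≤ s i)
    (h0 : I.P Finset.univ ≤ s 0 ∨ s 0 + I.qn ≤ 0)
    (h1 : a + I.P Finset.univ ≤ s 1 ∨ s 1 + I.qn ≤ a)
    (h2 : b + I.P Finset.univ ≤ s 2 ∨ s 2 + I.qn ≤ b) : I.Feasible (I.blocks a b s) := by
  have hbef := fun j => I.before_nonneg Finset.univ j
  have hP : ∀ j, I.before Finset.univ j + I.p j ≤ I.P Finset.univ := fun j =>
    I.before_add_le_P (Finset.mem_univ j)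
  have hlt : ∀ j j', j < j' → I.before Finset.univ j + I.p j ≤ I.before Finset.univ j' :=
    fun j j' h => I.before_add_le (Finset.mem_univ j) h
  have hp := I.p_pos
  have key : ∀ (j : Fin l) (i : Fin 3), I.P Finset.univ +
      (![0, a, b] : Fin 3 → ℝ) i ≤ s i ∨ s i + I.qn ≤ (![0, a, b] : Fin 3 → ℝ) i := by
    intro j i
    fin_cases i
    · simpa using h0
    · simpa [add_comm] using h1
    · simpa [add_comm] using h2
  have hbl : ∀ (j : Fin l) (i : Fin 3), I.blocks a b s (.inl j) i =
      (![0, a, b] : Fin 3 → ℝ) i + I.before Finset.univ j := by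
    intro j i
    fin_cases i <;> simp [Inst.blocks]
  have hbr : ∀ (j : Fin 1) (i : Fin 3), I.blocks a b s (.inr j) i = s i := fun _ _ => rfl
  have hflow : ∀ (j : Fin l) (i i' : Fin 3), i < i' →
      I.blocks a b s (.inl j) i + I.p j ≤ I.blocks a b s (.inl j) i' := by
    intro j i i' h
    rw [hbl, hbl]
    have h3 := ha j
    have h4 := hb j
    have h5 := hp j
    fin_cases i <;> fin_cases i' <;> simp at h ⊢ <;> linarith
  refine ⟨?_, ?_, ?_, hflow⟩
  · rintro (j | j) i
    · rw [hbl]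
      have := hbef j
      fin_cases i <;> simp <;> linarith
    · exact hs i
  · rintro (j | j) i i' h
    · rcases lt_or_gt_of_ne h with h | h
      · exact Or.inl (hflow j i i' h)
      · exact Or.inr (hflow j i' i h)
    · rw [Subsingleton.elim j 0]; exact hsd i i' h
  · rintro i (j | j) (j' | j') h
    · simp only [hbl, Inst.time, Sum.elim_inl]
      rcases lt_trichotomy j j' with h' | h' | h'
      · left; linarith [hlt j j' h']
      · exact absurd (congrArg Sum.inl h') h
      · right; linarith [hlt j' j h']
    · rw [hbl, hbr, Subsingleton.elim j' 0]
      have e : I.time (.inr 0) = I.qn := rfl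
      have e' : I.time (.inl j) = I.p j := rfl
      rw [e, e']
      rcases key j i with h' | h'
      · left; linarith [hP j]
      · right; linarith [hbef j]
    · rw [hbl, hbr, Subsingleton.elim j 0]
      have e : I.time (.inr 0) = I.qn := rfl
      have e' : I.time (.inl j') = I.p j' := rfl
      rw [e, e']
      rcases key j' i with h' | h'
      · right; linarith [hP j']
      · left; linarith [hbef j']
    · exact absurd (congrArg Sum.inr (Subsingleton.elim j j')) h

theorem Inst.blocks_makespan_le (I : Inst l 1) (a b m : ℝ) (s : Fin 3 → ℝ)
    (hs : ∀ i, s i + I.qn ≤ m) (h0 : I.P Finset.univ ≤ m) (h1 : a + I.P Finset.univ ≤ m)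
    (h2 : b + I.P Finset.univ ≤ m) : I.makespan (I.blocks a b s) ≤ m := by
  refine I.makespan_le _ ?_
  rintro (j | j) i
  · have := I.before_add_le_P (Finset.mem_univ j)
    have e' : I.time (.inl j) = I.p j := rfl
    rw [e']
    fin_cases i <;> simp [Inst.blocks] <;> linarith
  · rw [Subsingleton.elim j 0]; exact hs i

theorem Inst.le_p1 (I : Inst l 1) (hI : Antitone I.p) (j : Fin l) : I.p j ≤ I.p1 := by
  have hl : 0 < l := j.pos
  rw [Inst.p1, dif_pos hl]
  exact hI (Fin.mk_le_of_le_val (Nat.zero_le _))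

theorem Inst.p1_nonneg (I : Inst l 1) : 0 ≤ I.p1 := by
  rw [Inst.p1]; split_ifs
  · exact (I.p_pos _).le
  · exact le_refl _

theorem Inst.p1_le_P (I : Inst l 1) : I.p1 ≤ I.P Finset.univ := by
  rw [Inst.p1]; split_ifs
  · exact I.p_le_P (Finset.mem_univ _)
  · exact I.P_nonneg _

theorem Inst.qn_pos (I : Inst l 1) : 0 < I.qn := I.q_pos 0

theorem Inst.schedA_feasible (I : Inst l 1) (hI : Antitone I.p) (h : I.qn ≤ I.p1) :
    I.Feasible I.schedA := by
  have h1 := I.qn_pos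
  have h3 := le_max_left (I.P Finset.univ) (2 * I.qn)
  have h4 := le_max_right (I.P Finset.univ) (2 * I.qn)
  have h5 := I.p1_nonneg
  refine I.blocks_feasible _ _ _ (I.le_p1 hI) h5 (fun j => ?_) (by linarith) ?_ ?_ ?_ ?_ ?_
  · linarith [I.le_p1 hI j]
  · intro i; fin_cases i <;> simp <;> grind
  · intro i i' hi
    fin_cases i <;> fin_cases i' <;> simp at hi ⊢ <;> grind
  · left; simp
  · right; simp; linarith
  · right; simp; linarith

theorem Inst.schedA_makespan_le (I : Inst l 1) (h : I.qn ≤ I.p1) :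
    I.makespan I.schedA ≤ 2 * I.p1 + I.P Finset.univ := by
  have h1 := I.qn_pos
  have h2 := I.p1_le_P
  refine I.blocks_makespan_le _ _ _ _ ?_ ?_ ?_ ?_
  · intro i; fin_cases i <;> simp <;> grind
  all_goals grind

theorem Inst.sched0_feasible (I : Inst l 1) (hp : ∀ j, I.p j ≤ I.qn)
    (h : I.P Finset.univ ≤ I.qn) : I.Feasible I.sched0 := by
  have h1 := I.qn_pos
  refine I.blocks_feasible _ _ _ hp h1.le (fun j => ?_) (by linarith) ?_ ?_ ?_ ?_ ?_
  · linarith [hp j]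
  · intro i; fin_cases i <;> simp <;> grind
  · intro i i' hi
    fin_cases i <;> fin_cases i' <;> simp at hi ⊢ <;> grind
  · left; simpa
  · left; simp; linarith
  · right; simp; linarith

theorem Inst.sched0_makespan_le (I : Inst l 1) (h : I.P Finset.univ ≤ I.qn) :
    I.makespan I.sched0 ≤ 3 * I.qn := by
  have h1 := I.qn_pos
  refine I.blocks_makespan_le _ _ _ _ ?_ ?_ ?_ ?_
  · intro i; fin_cases i <;> simp <;> grind
  all_goals grind

theorem Inst.sched231_feasible (I : Inst l 1) (hp : ∀ j, I.p j ≤ I.qn) :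
    I.Feasible I.sched231 := by
  have h1 := I.qn_pos
  have h3 := le_max_left (I.P Finset.univ) (2 * I.qn)
  have h4 := le_max_right (I.P Finset.univ) (2 * I.qn)
  refine I.blocks_feasible _ _ _ hp h1.le (fun j => ?_) (by linarith) ?_ ?_ ?_ ?_ ?_
  · linarith [hp j]
  · intro i; fin_cases i <;> simp <;> grind
  · intro i i' hi
    fin_cases i <;> fin_cases i' <;> simp at hi ⊢ <;> grind
  · left; simp
  · right; simp
  · right; simp; linarith

theorem Inst.sched312_feasible (I : Inst l 1) (hp : ∀ j, I.p j ≤ I.qn)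
    (h : I.qn ≤ I.P Finset.univ) : I.Feasible I.sched312 := by
  have h1 := I.qn_pos
  refine I.blocks_feasible _ _ _ hp h1.le (fun j => ?_) (by linarith) ?_ ?_ ?_ ?_ ?_
  · linarith [hp j]
  · intro i; fin_cases i <;> simp <;> grind
  · intro i i' hi
    fin_cases i <;> fin_cases i' <;> simp at hi ⊢ <;> grind
  · left; simp
  · left; simp; linarith
  · right; simp; linarith

theorem Inst.le_blocks_makespan (I : Inst l 1) (a b : ℝ) (s : Fin 3 → ℝ)
    (h : 0 < I.P Finset.univ) : b + I.P Finset.univ ≤ I.makespan (I.blocks a b s) := by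
  have hne : (Finset.univ : Finset (Fin l)).Nonempty := by
    rw [Finset.nonempty_iff_ne_empty]
    intro h0
    rw [h0] at h
    exact lt_irrefl _ h
  obtain ⟨j, -, hj⟩ := I.P_eq_before_add hne
  have := I.completion_le_makespan (I.blocks a b s) (.inl j) 2
  simp [Inst.blocks, Inst.time] at this
  linarith

/-- The exact value is needed, not just an upper bound: the program compares this number with the
exact makespans of the `π^i`. -/
theorem Inst.sched231_makespan (I : Inst l 1) (h : I.qn ≤ I.P Finset.univ) :
    I.makespan I.sched231 = 2 * I.qn + I.P Finset.univ := by
  have h1 := I.qn_pos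
  refine le_antisymm (I.blocks_makespan_le _ _ _ _ ?_ ?_ ?_ ?_)
    (I.le_blocks_makespan _ _ _ (by linarith))
  · intro i; fin_cases i <;> simp <;> grind
  all_goals grind

theorem Inst.sched312_makespan (I : Inst l 1) (h : I.qn ≤ I.P Finset.univ) :
    I.makespan I.sched312 = 2 * I.qn + I.P Finset.univ := by
  have h1 := I.qn_pos
  refine le_antisymm (I.blocks_makespan_le _ _ _ _ ?_ ?_ ?_ ?_)
    (I.le_blocks_makespan _ _ _ (by linarith))
  · intro i; fin_cases i <;> simp <;> grind
  all_goals grind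

/-- The makespan of `π^i(C, C̄)`, as a function of `x = P(F¹)`. -/
noncomputable def Inst.span321 (I : Inst l 1) (i : Fin l) (x : ℝ) : ℝ :=
  max (max (I.P Finset.univ) (max (I.p i + x) I.qn + I.qn) + I.qn)
    (max (I.p i + x) I.qn + I.qn + I.p1 + (I.P Finset.univ - x))

end Schedules

/-! ### The schedules `π^i(C)` and the approximation guarantee. -/

section Loop

variable {l : ℕ}

theorem Inst.sched321_feasible (I : Inst l 1) (F1 : Finset (Fin l)) (a b : ℝ)
    (ha : ∀ j ∈ F1, I.p j ≤ a) (hb : ∀ j ∈ F1ᶜ, I.p j ≤ b) (ha0 : 0 ≤ a) (hb0 : 0 ≤ b)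
    (haq : a ≤ I.qn) (hbq : b ≤ I.qn) : I.Feasible (I.sched321 F1 a b) := by
  have hq := I.qn_pos
  have hP1 := I.P_nonneg F1
  have hP2 := I.P_nonneg F1ᶜ
  have hsum := I.P_compl F1
  set E := max (a + I.P F1) I.qn + I.qn with hE
  have hE1 : a + I.P F1 + I.qn ≤ E := by rw [hE]; linarith [le_max_left (a + I.P F1) I.qn]
  have hE2 : 2 * I.qn ≤ E := by rw [hE]; linarith [le_max_right (a + I.P F1) I.qn]
  have hEq : max (a + I.P F1) I.qn = E - I.qn := by rw [hE]; ring
  set G := max (2 * a) I.qn with hG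
  have hG1 : 2 * a ≤ G := le_max_left _ _
  have hG2 : I.qn ≤ G := le_max_right _ _
  -- The first block leaves `M₃` by time `E`, before the second block can arrive there. The term `2
  -- a` is covered because `a ≤ q_n`.
  have hG3 : G + I.P F1 ≤ E := by
    rw [hG, ← max_add_add_right]; apply max_le <;> linarith
  set H := max (I.P Finset.univ) E with hH
  have hH1 : I.P Finset.univ ≤ H := le_max_left _ _
  have hH2 : E ≤ H := le_max_right _ _
  have h1 : ∀ j ∈ F1, ∀ i, I.sched321 F1 a b (.inl j) i =
      (![0, a, G] : Fin 3 → ℝ) i + I.before F1 j := by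
    intro j hj i
    fin_cases i <;> simp [Inst.sched321, hj, hG]
  have h2 : ∀ j, j ∉ F1 → ∀ i, I.sched321 F1 a b (.inl j) i =
      (![I.P F1, E, E + b] : Fin 3 → ℝ) i + I.before F1ᶜ j := by
    intro j hj i
    fin_cases i <;> simp [Inst.sched321, hj, hE]
  have hn : ∀ (j : Fin 1) (i : Fin 3), I.sched321 F1 a b (.inr j) i =
      (![H, E - I.qn, 0] : Fin 3 → ℝ) i := by
    intro j i
    fin_cases i <;> simp [Inst.sched321, hE, hH]
  have e : ∀ j : Fin 1, I.time (.inr j) = I.qn := fun j => by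
    rw [Subsingleton.elim j 0]; rfl
  have e' : ∀ j : Fin l, I.time (.inl j) = I.p j := fun _ => rfl
  have b1 := fun j => I.before_nonneg F1 j
  have b2 := fun j => I.before_nonneg F1ᶜ j
  have hflow : ∀ (j : Fin l) (i i' : Fin 3), i < i' →
      I.sched321 F1 a b (.inl j) i + I.p j ≤ I.sched321 F1 a b (.inl j) i' := by
    intro j i i' h
    by_cases hj : j ∈ F1
    · rw [h1 j hj, h1 j hj]
      have h3 := ha j hj
      fin_cases i <;> fin_cases i' <;> simp at h ⊢ <;> linarith
    · rw [h2 j hj, h2 j hj]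
      have h3 := hb j (Finset.mem_compl.2 hj)
      fin_cases i <;> fin_cases i' <;> simp at h ⊢ <;> linarith
  refine ⟨?_, ?_, ?_, hflow⟩
  · rintro (j | j) i
    · have := b1 j
      have := b2 j
      by_cases hj : j ∈ F1
      · rw [h1 j hj]
        fin_cases i <;> simp <;> linarith
      · rw [h2 j hj]
        fin_cases i <;> simp <;> linarith
    · rw [hn]; fin_cases i <;> simp <;> linarith
  · rintro (j | j) i i' h
    · rcases lt_or_gt_of_ne h with h | h
      · exact Or.inl (hflow j i i' h)
      · exact Or.inr (hflow j i' i h)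
    · rw [hn, hn, e]
      fin_cases i <;> fin_cases i' <;> simp at h ⊢ <;> grind
  · have c1 : ∀ i j j', j ∈ F1 → j' ∉ F1 →
        I.sched321 F1 a b (.inl j) i + I.p j ≤ I.sched321 F1 a b (.inl j') i := by
      intro i j j' hj hj'
      rw [h1 j hj, h2 j' hj']
      have := I.before_add_le_P hj
      have := b2 j'
      fin_cases i <;> simp <;> linarith
    have c2 : ∀ i j, I.sched321 F1 a b (.inl j) i + I.p j ≤ I.sched321 F1 a b (.inr 0) i ∨
        I.sched321 F1 a b (.inr 0) i + I.qn ≤ I.sched321 F1 a b (.inl j) i := by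
      intro i j
      have := b1 j
      have := b2 j
      by_cases hj : j ∈ F1
      · rw [h1 j hj, hn]
        have := I.before_add_le_P hj
        fin_cases i <;> simp
        · left; linarith
        · left; linarith
        · right; linarith
      · rw [h2 j hj, hn]
        have := I.before_add_le_P (Finset.mem_compl.2 hj)
        fin_cases i <;> simp
        · left; linarith
        · right; linarith
        · right; linarith
    rintro i (j | j) (j' | j') h
    · rw [e', e']
      by_cases hj : j ∈ F1 <;> by_cases hj' : j' ∈ F1
      · rw [h1 j hj, h1 j' hj']
        rcases lt_trichotomy j j' with h' | h' | h'
        · left; linarith [I.before_add_le hj h']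
        · exact absurd (congrArg Sum.inl h') h
        · right; linarith [I.before_add_le hj' h']
      · exact Or.inl (c1 i j j' hj hj')
      · exact Or.inr (c1 i j' j hj' hj)
      · rw [h2 j hj, h2 j' hj']
        rcases lt_trichotomy j j' with h' | h' | h'
        · left; linarith [I.before_add_le (Finset.mem_compl.2 hj) h']
        · exact absurd (congrArg Sum.inl h') h
        · right; linarith [I.before_add_le (Finset.mem_compl.2 hj') h']
    · rw [e, e', Subsingleton.elim j' 0]; exact c2 i j
    · rw [e, e', Subsingleton.elim j 0]; exact (c2 i j').symm
    · exact absurd (congrArg Sum.inr (Subsingleton.elim j j')) h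

theorem Inst.schedI_feasible (I : Inst l 1) (hI : Antitone I.p) (h : I.p1 ≤ I.qn) (i : Fin l)
    (C : Finset (Fin l)) (hC : C ⊆ Finset.Ioi i) : I.Feasible (I.schedI i C) := by
  refine I.sched321_feasible _ _ _ ?_ (fun j _ => I.le_p1 hI j) (I.p_pos i).le I.p1_nonneg
    ((I.le_p1 hI i).trans h) h
  intro j hj
  rcases Finset.mem_insert.1 hj with rfl | hj
  · exact le_refl _
  · exact hI (Finset.mem_Ioi.1 (hC hj)).le

/-- The last operation is that of `J_n` on `M₁` or that of the last job of `F1ᶜ` on `M₃`. Since `0 <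
i`, the first job belongs to `F1ᶜ`, which is therefore nonempty. -/
theorem Inst.schedI_makespan (I : Inst l 1) (hI : Antitone I.p) (h : I.p1 ≤ I.qn) (i : Fin l)
    (hi : 0 < i.val) (C : Finset (Fin l)) (hC : C ⊆ Finset.Ioi i) :
    I.makespan (I.schedI i C) = I.span321 i (I.p i + I.P C) := by
  have hiC : i ∉ C := fun h => lt_irrefl _ (Finset.mem_Ioi.1 (hC h))
  rw [← I.P_insert hiC]
  have hq := I.qn_pos
  have hfl := (I.schedI_feasible hI h i C hC).flow_order
  unfold Inst.schedI at *
  set F1 := insert i C with hF1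
  have hP1 := I.P_nonneg F1
  have hp1 := I.p1_nonneg
  have hsum := I.P_compl F1
  have hP2 := I.P_nonneg F1ᶜ
  set E := max (I.p i + I.P F1) I.qn + I.qn with hE
  have hE1 : I.p i + I.P F1 + I.qn ≤ E := by
    rw [hE]; linarith [le_max_left (I.p i + I.P F1) I.qn]
  have hE2 : 2 * I.qn ≤ E := by rw [hE]; linarith [le_max_right (I.p i + I.P F1) I.qn]
  have hiq : I.p i ≤ I.qn := (I.le_p1 hI i).trans h
  have hpi := I.p_pos i
  have e : ∀ j : Fin 1, I.time (.inr j) = I.qn := fun j => by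
    rw [Subsingleton.elim j 0]; rfl
  have e' : ∀ j : Fin l, I.time (.inl j) = I.p j := fun _ => rfl
  have hspan : I.span321 i (I.P F1) =
      max (max (I.P Finset.univ) E + I.qn) (E + I.p1 + I.P F1ᶜ) := by
    rw [Inst.span321, ← hE, ← hsum]; congr 1; ring
  rw [hspan]
  have hm1 := le_max_left (max (I.P Finset.univ) E + I.qn) (E + I.p1 + I.P F1ᶜ)
  have hm2 := le_max_right (max (I.P Finset.univ) E + I.qn) (E + I.p1 + I.P F1ᶜ)
  apply le_antisymm
  · refine I.makespan_le _ ?_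
    have h2 : ∀ j : Fin l, I.sched321 F1 (I.p i) I.p1 (.inl j) 2 + I.p j ≤ E + I.p1 + I.P F1ᶜ := by
      intro j
      by_cases hj : j ∈ F1
      · have := I.before_add_le_P hj
        have hG3 : max (2 * I.p i) I.qn + I.P F1 ≤ E := by
          rw [← max_add_add_right]; apply max_le <;> linarith
        simp [Inst.sched321, hj]
        linarith
      · have := I.before_add_le_P (Finset.mem_compl.2 hj)
        simp [Inst.sched321, hj, ← hE]
        linarith
    rintro (j | j) i'
    · rw [e']
      have hj := I.p_pos j
      match i' with
      | 0 => linarith [hfl j 0 2 (by decide), h2 j]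
      | 1 => linarith [hfl j 1 2 (by decide), h2 j]
      | 2 => linarith [h2 j]
    · rw [e]
      have := le_max_right (I.P Finset.univ) E
      match i' with
      | 0 => simp [Inst.sched321, ← hE]
      | 1 =>
        change max (I.p i + I.P F1) I.qn + I.qn ≤ _
        linarith
      | 2 =>
        change 0 + I.qn ≤ _
        linarith
  · apply max_le
    · have := I.completion_le_makespan (I.sched321 F1 (I.p i) I.p1) (.inr 0) 0
      rw [e] at this
      simpa [Inst.sched321, ← hE] using this
    · have hl : 0 < l := i.pos
      have h0 : (⟨0, hl⟩ : Fin l) ∈ F1ᶜ := by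
        rw [Finset.mem_compl, hF1, Finset.mem_insert]
        rintro (h | h)
        · rw [← h] at hi; exact lt_irrefl _ hi
        · exact Nat.not_lt_zero _ (Fin.lt_def.1 (Finset.mem_Ioi.1 (hC h)))
      obtain ⟨j, hj, hj'⟩ := I.P_eq_before_add ⟨_, h0⟩
      have := I.completion_le_makespan (I.sched321 F1 (I.p i) I.p1) (.inl j) 2
      rw [e'] at this
      have hv : I.sched321 F1 (I.p i) I.p1 (.inl j) 2 = E + I.p1 + I.before F1ᶜ j := by
        simp [Inst.sched321, Finset.mem_compl.1 hj, ← hE]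
      rw [hv] at this
      linarith

/-- Either `π^{2,3,1}` is optimal, or one of the schedules `π^i(C, C̄)` is at least as good as the
given feasible schedule. -/
theorem Inst.Feasible.exists_schedI {I : Inst l 1} (hI : Antitone I.p) (h : I.p1 < I.qn)
    {S : Schedule l 1} (hS : I.Feasible S) :
    2 * I.qn + I.P Finset.univ ≤ I.makespan S ∨
    ∃ i : Fin l, 0 < i.val ∧ ∃ C ⊆ Finset.Ioi i,
      I.span321 i (I.p i + I.P C) ≤ I.makespan S := by
  -- The hypotheses are symmetric in `(A, x)` and `(Aᶜ, y)`, which reflects the reversal of time. So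
  -- it suffices to treat the side that avoids the first job.
  have key : ∀ (A : Finset (Fin l)) (x y m : ℝ), I.qn ≤ x → I.qn ≤ y →
      (∀ a ∈ A, I.p a + I.P A ≤ x) → (∀ b ∈ Aᶜ, I.p b + I.P Aᶜ ≤ y) →
      x + I.qn + y ≤ m → I.P Finset.univ + I.qn ≤ m → (∀ j : Fin l, j.val = 0 → j ∉ A) →
      2 * I.qn + I.P Finset.univ ≤ m ∨ ∃ i : Fin l, 0 < i.val ∧ ∃ C ⊆ Finset.Ioi i,
        I.span321 i (I.p i + I.P C) ≤ m := by
    intro A x y m hx hy hA hB hm hm' h0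
    have hc := I.P_compl A
    by_cases hne : A.Nonempty
    · right
      -- The least index is the largest job of `A`, and the first job is the largest of `Aᶜ`. The
      -- two bounds for these jobs are exactly the terms in the makespan of `π^i`.
      set i := A.min' hne
      have hi : i ∈ A := A.min'_mem hne
      have hi0 : 0 < i.val := Nat.pos_of_ne_zero fun h => h0 i h hi
      refine ⟨i, hi0, A.erase i, ?_, ?_⟩
      · intro j hj
        exact Finset.mem_Ioi.2 (A.min'_lt_of_mem_erase_min' hne hj)
      · rw [← I.P_insert (Finset.notMem_erase i A), Finset.insert_erase hi]
        have h1 := hA i hi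
        have hl : 0 < l := i.pos
        have h2 := hB ⟨0, hl⟩ (Finset.mem_compl.2 (h0 _ rfl))
        have e : I.p1 = I.p ⟨0, hl⟩ := by rw [Inst.p1, dif_pos hl]
        have h3 : max (I.p i + I.P A) I.qn ≤ x := max_le h1 hx
        rw [Inst.span321, e]
        refine max_le ?_ (by linarith)
        rw [← max_add_add_right]
        apply max_le <;> linarith
    · rw [Finset.not_nonempty_iff_eq_empty] at hne
      left
      subst hne
      have hP0 : I.P ∅ = 0 := rfl
      by_cases hl : 0 < l
      · have := hB ⟨0, hl⟩ (by simp)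
        have := I.p_pos ⟨0, hl⟩
        linarith
      · have : I.P Finset.univ = 0 := by
          obtain rfl : l = 0 := by omega
          rfl
        linarith
  rcases hS.split_bound with h1 | ⟨h1, A, x, hx, hA, hm, hB⟩
  · left; linarith
  by_cases h0 : ∀ j : Fin l, j.val = 0 → j ∉ A
  · refine key A x (I.makespan S - x - I.qn) _ hx (by linarith) hA (fun b hb => ?_) (by linarith)
      h1 h0
    linarith [hB b hb]
  · push Not at h0
    obtain ⟨j, hj, hjA⟩ := h0
    refine key Aᶜ (I.makespan S - x - I.qn) x _ (by linarith) hx (fun b hb => ?_)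
      (fun a ha => by rw [compl_compl] at ha ⊢; exact hA a ha) (by linarith) h1 ?_
    · linarith [hB b hb]
    · intro j' hj' hj''
      have : j' = j := Fin.ext (hj'.trans hj.symm)
      subst this
      exact Finset.mem_compl.1 hj'' hjA

/-- Every schedule computed for the job `i` is feasible, and it is within `1 + ε` of the best
schedule of that form or not better than `π^{2,3,1}`. -/
theorem Inst.ResultI.approx {I : Inst l 1} (hI : Antitone I.p) (h : I.p1 < I.qn) {ε : ℝ}
    (hε : 0 < ε) {i : Fin l} (hi : 0 < i.val) {S : Schedule l 1} (hS : I.ResultI ε i S) :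
    I.Feasible S ∧ ∀ C ⊆ Finset.Ioi i,
      I.makespan S ≤ (1 + ε) * I.span321 i (I.p i + I.P C) ∨
      2 * I.qn + I.P Finset.univ ≤ I.span321 i (I.p i + I.P C) := by
  have hq := I.qn_pos
  have hms := I.schedI_makespan hI h.le i hi
  have hfe := I.schedI_feasible hI h.le i
  have hiq := (I.le_p1 hI i)
  have hpi := I.p_pos i
  rcases hS with ⟨h2, C, hC, rfl⟩ | ⟨h2, D, hD, hS⟩
  -- Here `E ≥ 2 p_i + P(C') + q_n`, so the second term of the makespan is at least `p_i + p_1 + q_n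
  -- + P(F)`, which exceeds `2 q_n + P(F)` because `p_1 ≥ p_i > q_n / 2`.
  · refine ⟨hfe C hC, fun C' hC' => Or.inr ?_⟩
    have hx : I.p i + I.P C' ≥ 0 := add_nonneg hpi.le (I.P_nonneg _)
    have := le_max_left (I.p i + (I.p i + I.P C')) I.qn
    have := le_max_right (max (I.P Finset.univ) (max (I.p i + (I.p i + I.P C')) I.qn + I.qn) + I.qn)
      (max (I.p i + (I.p i + I.P C')) I.qn + I.qn + I.p1 + (I.P Finset.univ - (I.p i + I.P C')))
    rw [Inst.span321]
    linarith
  · have hmD := hms D hD.1.1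
    -- Up to the capacity `E = 2 q_n` is constant, and a larger `P(C')` only shortens the schedule:
    -- this is Max-Knapsack. The loss `ε P(C')` is at most `ε` times the makespan.
    have small : ∀ C' ⊆ Finset.Ioi i, I.P C' ≤ I.qn - 2 * I.p i →
        I.span321 i (I.p i + I.P D) ≤ (1 + ε) * I.span321 i (I.p i + I.P C') := by
      intro C' hC' hc
      have h3 := hD.2 C' ⟨hC', hc⟩
      have h4 := hD.1.2
      have h5 := I.P_nonneg C'
      rw [Inst.span321, Inst.span321, max_eq_right (show I.p i + (I.p i + I.P D) ≤ I.qn by linarith),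
        max_eq_right (show I.p i + (I.p i + I.P C') ≤ I.qn by linarith)]
      set z := max (max (I.P Finset.univ) (I.qn + I.qn) + I.qn)
        (I.qn + I.qn + I.p1 + (I.P Finset.univ - (I.p i + I.P C')))
      have hz1 : max (I.P Finset.univ) (I.qn + I.qn) + I.qn ≤ z := le_max_left _ _
      have hz2 : I.qn + I.qn + I.p1 + (I.P Finset.univ - (I.p i + I.P C')) ≤ z := le_max_right _ _
      have hz3 := le_max_right (I.P Finset.univ) (I.qn + I.qn)
      have hz4 : I.P C' ≤ z := by linarith
      have hz5 : ε * I.P C' ≤ ε * z := mul_le_mul_of_nonneg_left hz4 hε.le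
      have hz6 : 0 ≤ ε * z := by nlinarith
      apply max_le <;> nlinarith
    rcases hS with ⟨C, hC, hS⟩ | ⟨hno, rfl⟩
    · have hmC := hms C hC.1.1
      have hsub : S = I.schedI i C ∨ S = I.schedI i D := by simpa using hS.1
      refine ⟨?_, fun C' hC' => Or.inl ?_⟩
      · rcases hsub with rfl | rfl
        · exact hfe _ hC.1.1
        · exact hfe _ hD.1.1
      · by_cases hc : I.P C' ≤ I.qn - 2 * I.p i
        · have := hS.2 (I.schedI i D) (by simp)
          rw [hmD] at this
          exact this.trans (small C' hC' hc)
        · have := hS.2 (I.schedI i C) (by simp)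
          rw [hmC] at this
          refine this.trans ?_
          push Not at hc
          -- Beyond the capacity `E` grows with `P(C')`, while in the second term of the makespan
          -- `P(C')` cancels: this is Min-Knapsack.
          have h3 := hC.2 C' ⟨hC', hc⟩
          have h4 := hC.1.2
          have h5 := I.P_nonneg C'
          rw [Inst.span321, Inst.span321,
            max_eq_left (show I.qn ≤ I.p i + (I.p i + I.P C) by linarith),
            max_eq_left (show I.qn ≤ I.p i + (I.p i + I.P C') by linarith)]
          set E' := I.p i + (I.p i + I.P C') + I.qn
          set z := max (max (I.P Finset.univ) E' + I.qn)
            (E' + I.p1 + (I.P Finset.univ - (I.p i + I.P C')))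
          have hz1 : max (I.P Finset.univ) E' + I.qn ≤ z := le_max_left _ _
          have hz2 : E' + I.p1 + (I.P Finset.univ - (I.p i + I.P C')) ≤ z := le_max_right _ _
          have hz3 := le_max_right (I.P Finset.univ) E'
          have hz7 := le_max_left (I.P Finset.univ) E'
          have hz4 : I.P C' ≤ z := by linarith
          have hz5 : ε * I.P C' ≤ ε * z := mul_le_mul_of_nonneg_left hz4 hε.le
          have hz6 : 0 ≤ ε * z := by nlinarith
          apply max_le
          · rw [← max_add_add_right]
            apply max_le <;> linarith
          · linarith
    · refine ⟨hfe _ hD.1.1, fun C' hC' => Or.inl ?_⟩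
      rw [hmD]
      refine small C' hC' ?_
      by_contra hc
      exact hno ⟨C', hC', not_le.1 hc⟩

/-- The first two branches attain a lower bound. In the third, the comparison schedule is no better
than `π^{2,3,1}`, or it is matched by some `π^i(C)` for which the computed schedule loses at most
the factor `1 + ε`. -/
theorem Inst.SortedResultC.isApprox {I : Inst l 1} (hI : Antitone I.p) {ε : ℝ}
    (hε : 0 < ε) {S : Schedule l 1} (hS : I.SortedResultC ε S) : I.IsApprox ε S := by
  have hq := I.qn_pos
  have hscale : ∀ S', I.Feasible S' → I.makespan S ≤ I.makespan S' →
      I.makespan S ≤ (1 + ε) * I.makespan S' := by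
    intro S' hS' h
    have := hS'.open_bound
    nlinarith
  unfold Inst.SortedResultC at hS
  split_ifs at hS with h1 h2
  · subst hS
    refine ⟨I.schedA_feasible hI h1, fun S' hS' => hscale S' hS' ?_⟩
    refine (I.schedA_makespan_le h1).trans ?_
    have hl : 0 < l := by
      by_contra hl
      rw [Inst.p1, dif_neg hl] at h1
      linarith
    rw [Inst.p1, dif_pos hl]
    exact hS'.flow_bound _
  · subst hS
    push Not at h1
    exact ⟨I.sched0_feasible (fun j => (I.le_p1 hI j).trans h1.le) h2, fun S' hS' =>
      hscale S' hS' ((I.sched0_makespan_le h2).trans hS'.open_bound)⟩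
  · push Not at h1 h2
    obtain ⟨f, hf, hS⟩ := hS
    have hp : ∀ j, I.p j ≤ I.qn := fun j => (I.le_p1 hI j).trans h1.le
    have hm := I.sched231_makespan h2.le
    refine ⟨?_, fun S' hS' => ?_⟩
    · rcases hS.1 with (rfl | rfl) | ⟨i, hi, rfl⟩
      · exact I.sched231_feasible hp
      · exact I.sched312_feasible hp h2.le
      · exact ((hf i hi).approx hI h1 hε hi).1
    · have hle := hS.2 I.sched231 (by simp)
      rw [hm] at hle
      rcases hS'.exists_schedI hI h1 with h3 | ⟨i, hi, C, hC, h3⟩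
      · exact hscale S' hS' (hle.trans h3)
      · have hle' := hS.2 (f i) (Or.inr ⟨i, hi, rfl⟩)
        rcases ((hf i hi).approx hI h1 hε hi).2 C hC with h4 | h4
        · exact (hle'.trans h4).trans (mul_le_mul_of_nonneg_left h3 (by linarith))
        · exact hscale S' hS' (hle.trans (h4.trans h3))

theorem Inst.makespan_relabel (I : Inst l 1) (e : Equiv.Perm (Fin l)) (S : Schedule l 1) :
    (I.relabel e).makespan (S.relabel e) = I.makespan S := by
  have ht : ∀ (J : Inst l 1) (T : Schedule l 1) (g : Equiv.Perm (Fin l)),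
      (J.relabel g).makespan (T.relabel g) ≤ J.makespan T := by
    intro J T g
    refine Inst.makespan_le _ _ ?_
    rintro (j | j) i
    · exact J.completion_le_makespan T (.inl (g j)) i
    · exact J.completion_le_makespan T (.inr j) i
  refine le_antisymm (ht I S e) ?_
  have := ht (I.relabel e) (S.relabel e) e.symm
  have h1 : (I.relabel e).relabel e.symm = I := by
    cases I; simp [Inst.relabel, Function.comp_def]
  have h2 : (S.relabel e).relabel e.symm = S := by
    funext j i
    cases j <;> simp [Schedule.relabel]
  rwa [h1, h2] at this

theorem Inst.Feasible.relabel {I : Inst l 1} {S : Schedule l 1} (hS : I.Feasible S)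
    (e : Equiv.Perm (Fin l)) : (I.relabel e).Feasible (S.relabel e) := by
  have ht : ∀ j, (I.relabel e).time j = I.time (Sum.map e id j) := by
    rintro (j | j) <;> rfl
  refine ⟨fun j i => hS.start_nonneg _ _, fun j i i' h => ?_, fun i j j' h => ?_,
    fun j i i' h => hS.flow_order (e j) i i' h⟩
  · rw [ht]; exact hS.job_disjoint _ i i' h
  · rw [ht, ht]
    refine hS.machine_disjoint i _ _ fun h' => h ?_
    exact (Sum.map_injective.2 ⟨e.injective, Function.injective_id⟩) h'

theorem Inst.ResultC.isApprox {I : Inst l 1} {ε : ℝ} (hε : 0 < ε) {S : Schedule l 1}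
    (hS : I.ResultC ε S) : I.IsApprox ε S := by
  obtain ⟨e, he, hS⟩ := hS
  obtain ⟨h1, h2⟩ := Inst.SortedResultC.isApprox (I := I.relabel e) he hε hS
  constructor
  · have := h1.relabel e.symm
    have e1 : (I.relabel e).relabel e.symm = I := by
      cases I; simp [Inst.relabel, Function.comp_def]
    have e2 : (S.relabel e).relabel e.symm = S := by
      funext j i
      cases j <;> simp [Schedule.relabel]
    rwa [e1, e2] at this
  · intro S' hS'
    have := h2 _ (hS'.relabel e)
    rwa [I.makespan_relabel, I.makespan_relabel] at this

end Loop

/-! ### A calculus of total correctness with step counting. -/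

section Semantics

namespace State

/-- Assignment to an integer register. -/
def setI (s : State) (x v : ℕ) : State := { s with ireg := Function.update s.ireg x v }
/-- Assignment to a real register. -/
def setR (s : State) (x : ℕ) (v : ℝ) : State := { s with rreg := Function.update s.rreg x v }
/-- Assignment to a cell of an integer array. -/
def putI (s : State) (a i v : ℕ) : State :=
  { s with iarr := Function.update s.iarr a (Function.update (s.iarr a) i v) }
/-- Assignment to a cell of a real array. -/
def putR (s : State) (a i : ℕ) (v : ℝ) : State :=
  { s with rarr := Function.update s.rarr a (Function.update (s.rarr a) i v) }

variable (s : State) (x y a b i v : ℕ) (r : ℝ)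

@[simp] theorem setI_ireg : (s.setI x v).ireg y = if y = x then v else s.ireg y := by
  simp [setI, Function.update_apply]
@[simp] theorem setI_rreg : (s.setI x v).rreg = s.rreg := rfl
@[simp] theorem setI_iarr : (s.setI x v).iarr = s.iarr := rfl
@[simp] theorem setI_rarr : (s.setI x v).rarr = s.rarr := rfl
@[simp] theorem setR_rreg : (s.setR x r).rreg y = if y = x then r else s.rreg y := by
  simp [setR, Function.update_apply]
@[simp] theorem setR_ireg : (s.setR x r).ireg = s.ireg := rfl
@[simp] theorem setR_iarr : (s.setR x r).iarr = s.iarr := rfl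
@[simp] theorem setR_rarr : (s.setR x r).rarr = s.rarr := rfl
@[simp] theorem putI_iarr : (s.putI a i v).iarr b =
    if b = a then Function.update (s.iarr a) i v else s.iarr b := by
  by_cases h : b = a
  · subst h; simp [putI]
  · simp [putI, h]
@[simp] theorem putI_ireg : (s.putI a i v).ireg = s.ireg := rfl
@[simp] theorem putI_rreg : (s.putI a i v).rreg = s.rreg := rfl
@[simp] theorem putI_rarr : (s.putI a i v).rarr = s.rarr := rfl
@[simp] theorem putR_rarr : (s.putR a i r).rarr b =
    if b = a then Function.update (s.rarr a) i r else s.rarr b := by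
  by_cases h : b = a
  · subst h; simp [putR]
  · simp [putR, h]
@[simp] theorem putR_ireg : (s.putR a i r).ireg = s.ireg := rfl
@[simp] theorem putR_rreg : (s.putR a i r).rreg = s.rreg := rfl
@[simp] theorem putR_iarr : (s.putR a i r).iarr = s.iarr := rfl

end State

infixr:60 ";;" => Prog.seq

/-- Total correctness with a clock: started in `s` at time `T`, the program `c` halts in a state and
at a time that satisfy `Q`. -/
def WP (c : Prog) (s : State) (T : ℕ) (Q : State → ℕ → Prop) : Prop :=
  ∃ s' t, Exec c s s' t ∧ Q s' (T + t)

variable {s : State} {T : ℕ} {Q : State → ℕ → Prop}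

@[simp] theorem wp_skip : WP .skip s T Q ↔ Q s (T + 1) := by
  constructor
  · rintro ⟨s', t, h, hQ⟩; cases h; exact hQ
  · exact fun h => ⟨s, 1, .skip s, h⟩

@[simp] theorem wp_iset {x : ℕ} {e : IExp} :
    WP (.iset x e) s T Q ↔ Q (s.setI x (e.eval s)) (T + (e.cost + 1)) := by
  constructor
  · rintro ⟨s', t, h, hQ⟩; cases h; exact hQ
  · exact fun h => ⟨_, _, .iset x e s, h⟩

@[simp] theorem wp_rset {x : ℕ} {e : RExp} :
    WP (.rset x e) s T Q ↔ Q (s.setR x (e.eval s)) (T + (e.cost + 1)) := by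
  constructor
  · rintro ⟨s', t, h, hQ⟩; cases h; exact hQ
  · exact fun h => ⟨_, _, .rset x e s, h⟩

@[simp] theorem wp_iput {a : ℕ} {i e : IExp} :
    WP (.iput a i e) s T Q ↔ Q (s.putI a (i.eval s) (e.eval s)) (T + (i.cost + e.cost + 1)) := by
  constructor
  · rintro ⟨s', t, h, hQ⟩; cases h; exact hQ
  · exact fun h => ⟨_, _, .iput a i e s, h⟩

@[simp] theorem wp_rput {a : ℕ} {i : IExp} {e : RExp} :
    WP (.rput a i e) s T Q ↔ Q (s.putR a (i.eval s) (e.eval s)) (T + (i.cost + e.cost + 1)) := by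
  constructor
  · rintro ⟨s', t, h, hQ⟩; cases h; exact hQ
  · exact fun h => ⟨_, _, .rput a i e s, h⟩

@[simp] theorem wp_seq {c d : Prog} :
    WP (c ;; d) s T Q ↔ WP c s T fun s' T' => WP d s' T' Q := by
  constructor
  · rintro ⟨s', t, h, hQ⟩
    cases h with
    | seq h1 h2 => exact ⟨_, _, h1, _, _, h2, by rwa [add_assoc]⟩
  · rintro ⟨s', t, h, s'', t', h', hQ⟩
    exact ⟨s'', _, .seq h h', by rwa [← add_assoc]⟩

@[simp] theorem wp_ite {b : BExp} {c d : Prog} :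
    WP (.ite b c d) s T Q ↔
      (b.Holds s → WP c s (T + b.cost) Q) ∧ (¬ b.Holds s → WP d s (T + b.cost) Q) := by
  constructor
  · rintro ⟨s', t, h, hQ⟩
    cases h with
    | ite_true hb h => exact ⟨fun _ => ⟨_, _, h, by rwa [add_assoc]⟩, fun h' => absurd hb h'⟩
    | ite_false hb h => exact ⟨fun h' => absurd h' hb, fun _ => ⟨_, _, h, by rwa [add_assoc]⟩⟩
  · rintro ⟨h1, h2⟩
    by_cases hb : b.Holds s
    · obtain ⟨s', t, h, hQ⟩ := h1 hb
      exact ⟨s', _, .ite_true hb h, by rwa [← add_assoc]⟩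
    · obtain ⟨s', t, h, hQ⟩ := h2 hb
      exact ⟨s', _, .ite_false hb h, by rwa [← add_assoc]⟩

/-- The rule for loops: `Inv` is an invariant and `m` decreases. -/
theorem WP.loop {b : BExp} {c : Prog} (Inv : State → ℕ → Prop) (m : State → ℕ)
    (step : ∀ s T, Inv s T → b.Holds s →
      WP c s (T + b.cost) fun s' T' => Inv s' T' ∧ m s' < m s)
    (done : ∀ s T, Inv s T → ¬ b.Holds s → Q s (T + b.cost))
    (start : Inv s T) : WP (.loop b c) s T Q := by
  generalize hn : m s = n
  induction n using Nat.strong_induction_on generalizing s T with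
  | _ n ih =>
    by_cases hb : b.Holds s
    · obtain ⟨s', t, h, hI, hm⟩ := step s T start hb
      obtain ⟨s'', t', h', hQ⟩ := ih _ (hn ▸ hm) hI rfl
      exact ⟨s'', _, .loop_true hb h h', by rwa [← add_assoc, ← add_assoc]⟩
    · exact ⟨s, _, .loop_false hb, done s T start hb⟩

attribute [simp] IExp.eval IExp.cost RExp.eval RExp.cost BExp.Holds BExp.cost

/-- The state `s'` agrees with `s` except for registers from the number `k` on and
for the arrays that hold the heap. -/
structure Frame (k : ℕ) (s s' : State) : Prop where
  ireg : ∀ x < k, s'.ireg x = s.ireg x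
  rreg : ∀ x < k, s'.rreg x = s.rreg x
  iarr0 : s'.iarr 0 = s.iarr 0
  iarr4 : s'.iarr 4 = s.iarr 4
  rarr : ∀ a, a ≠ 5 → s'.rarr a = s.rarr a

theorem Frame.refl (k : ℕ) (s : State) : Frame k s s :=
  ⟨fun _ _ => rfl, fun _ _ => rfl, rfl, rfl, fun _ _ => rfl⟩

theorem Frame.trans {k : ℕ} {s₁ s₂ s₃ : State} (h : Frame k s₁ s₂) (h' : Frame k s₂ s₃) :
    Frame k s₁ s₃ :=
  ⟨fun x hx => (h'.ireg x hx).trans (h.ireg x hx), fun x hx => (h'.rreg x hx).trans (h.rreg x hx),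
    h'.iarr0.trans h.iarr0, h'.iarr4.trans h.iarr4, fun a ha => (h'.rarr a ha).trans (h.rarr a ha)⟩

theorem Frame.mono {k m : ℕ} (hkm : m ≤ k) {s₁ s₂ : State} (h : Frame k s₁ s₂) : Frame m s₁ s₂ :=
  ⟨fun x hx => h.ireg x (hx.trans_le hkm), fun x hx => h.rreg x (hx.trans_le hkm),
    h.iarr0, h.iarr4, h.rarr⟩

theorem Frame.setI {k x v : ℕ} {s₁ s₂ : State} (h : Frame k s₁ s₂) (hx : k ≤ x) :
    Frame k s₁ (s₂.setI x v) :=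
  ⟨fun y hy => by simp [h.ireg y hy, show y ≠ x by omega], h.rreg, h.iarr0, h.iarr4, h.rarr⟩

theorem Frame.setR {k x : ℕ} {v : ℝ} {s₁ s₂ : State} (h : Frame k s₁ s₂) (hx : k ≤ x) :
    Frame k s₁ (s₂.setR x v) :=
  ⟨h.ireg, fun y hy => by simp [h.rreg y hy, show y ≠ x by omega], h.iarr0, h.iarr4, h.rarr⟩

theorem Frame.putI {k a i v : ℕ} {s₁ s₂ : State} (h : Frame k s₁ s₂) (h0 : a ≠ 0) (h4 : a ≠ 4) :
    Frame k s₁ (s₂.putI a i v) :=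
  ⟨h.ireg, h.rreg, by simp [h.iarr0, h0.symm], by simp [h.iarr4, h4.symm], h.rarr⟩

theorem Frame.putR {k i : ℕ} {v : ℝ} {s₁ s₂ : State} (h : Frame k s₁ s₂) :
    Frame k s₁ (s₂.putR 5 i v) :=
  ⟨h.ireg, h.rreg, h.iarr0, h.iarr4, fun b hb => by simp [h.rarr b hb, hb]⟩

end Semantics

/-! ### Sets of positions as chains of intervals. -/

section Heap

/-- A heap of nodes, each of which has a value, an interval `[fst, lst)` of positions and
a parent. -/
structure Heap where
  val : ℕ → ℝ
  fst : ℕ → ℕ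
  lst : ℕ → ℕ
  par : ℕ → ℕ

/-- The heap in the arrays of a state. -/
def State.heap (s : State) : Heap := ⟨s.rarr 5, s.iarr 1, s.iarr 2, s.iarr 3⟩

@[simp] theorem State.setI_heap (s : State) (x v : ℕ) : (s.setI x v).heap = s.heap := rfl
@[simp] theorem State.setR_heap (s : State) (x : ℕ) (v : ℝ) : (s.setR x v).heap = s.heap := rfl

/-- Two heaps agree on the node `k`. -/
def Heap.Same (h h' : Heap) (k k' : ℕ) : Prop :=
  h'.val k' = h.val k ∧ h'.fst k' = h.fst k ∧ h'.lst k' = h.lst k ∧ h'.par k' = h.par k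

/-- Two heaps agree on the nodes below `k`. -/
def Heap.Below (h h' : Heap) (k : ℕ) : Prop := ∀ j < k, h.Same h' j j

theorem Heap.Below.refl (h : Heap) (k : ℕ) : h.Below h k := fun _ _ => ⟨rfl, rfl, rfl, rfl⟩

theorem Heap.Below.trans {h h' h'' : Heap} {k k' : ℕ} (a : h.Below h' k) (b : h'.Below h'' k')
    (hk : k ≤ k') : h.Below h'' k := fun j hj => by
  obtain ⟨a1, a2, a3, a4⟩ := a j hj
  obtain ⟨b1, b2, b3, b4⟩ := b j (hj.trans_le hk)
  exact ⟨b1.trans a1, b2.trans a2, b3.trans a3, b4.trans a4⟩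

/-- The node `k` represents the set `X`: the union of the intervals on the way to the root. The
value is the total weight. -/
inductive Heap.Rep (w : ℕ → ℝ) (h : Heap) : ℕ → Finset ℕ → Prop
  | nil (k : ℕ) : h.fst k = h.lst k → h.val k = 0 → Rep w h k ∅
  | cons (k : ℕ) (X : Finset ℕ) : h.fst k < h.lst k → h.par k < k → Rep w h (h.par k) X →
      Disjoint X (Finset.Ico (h.fst k) (h.lst k)) →
      h.val k = h.val (h.par k) + ∑ j ∈ Finset.Ico (h.fst k) (h.lst k), w j →
      Rep w h k (X ∪ Finset.Ico (h.fst k) (h.lst k))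

variable {w : ℕ → ℝ} {h h' : Heap} {k k' : ℕ} {X : Finset ℕ}

theorem Heap.Rep.val_eq (hk : h.Rep w k X) : h.val k = ∑ j ∈ X, w j := by
  induction hk with
  | nil k _ hv => simpa using hv
  | cons k X _ _ _ hd hv ih => rw [hv, Finset.sum_union hd, ih]

/-- Lists are rebuilt by copying nodes. A copy at a later position represents the same set, because
it has the same parent and the chain of parents descends through unchanged nodes below `k`. -/
theorem Heap.Rep.of_same (hk : h.Rep w k X) (hs : h.Same h' k k') (hlt : k ≤ k')
    (hb : h.Below h' k) : h'.Rep w k' X := by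
  induction hk generalizing k' with
  | nil k he hv =>
    obtain ⟨h1, h2, h3, h4⟩ := hs
    exact .nil k' (by rw [h2, h3, he]) (by rw [h1, hv])
  | cons k X hlt' hpar hX hd hv ih =>
    obtain ⟨h1, h2, h3, h4⟩ := hs
    have hp := hb _ hpar
    have := ih (k' := h.par k) hp le_rfl (fun j hj => hb j (hj.trans hpar))
    rw [← h2, ← h3] at hd ⊢
    refine .cons k' X (by omega) (by omega) (by rwa [h4]) hd ?_
    rw [h1, h4, hv, hp.1, h2, h3]

theorem Heap.Rep.of_below {m : ℕ} (hk : h.Rep w k X) (hb : h.Below h' m) (hm : k < m) :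
    h'.Rep w k X :=
  hk.of_same (hb k hm) le_rfl fun j hj => hb j (hj.trans hm)

end Heap

/-! ### Trimmed lists and the preservation of brackets. -/

section Trim

/-- The values in the positions `[lo, top)` of `v` form a trimming of the set `A`. -/
structure Trim (v : ℕ → ℝ) (lo top : ℕ) (δ : ℝ) (A : Set ℝ) : Prop where
  mono : ∀ k, lo ≤ k → k + 1 < top → v k ≤ v (k + 1)
  span : ∀ k, lo ≤ k → k + 2 < top → δ < v (k + 2) - v k
  mem : ∀ a ∈ A, lo < top ∧ v lo ≤ a ∧ a ≤ v (top - 1)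
  gap : ∀ a ∈ A, ∀ k, lo ≤ k → k + 1 < top → v k < a → a < v (k + 1) → v (k + 1) - v k ≤ δ

variable {v v' : ℕ → ℝ} {lo top : ℕ} {δ y : ℝ} {A : Set ℝ}

theorem le_of_step_le (h : ∀ k, lo ≤ k → k + 1 < top → v k ≤ v (k + 1)) {i j : ℕ} (hi : lo ≤ i)
    (hij : i ≤ j) (hj : j < top) : v i ≤ v j := by
  induction j, hij using Nat.le_induction with
  | base => exact le_rfl
  | succ j hij ih => exact (ih (by omega)).trans (h j (by omega) hj)

/-- Appending is done only when the overwriting test fails; `hδ` states this failure and preserves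
`span`. -/
theorem Trim.push (h : Trim v lo top δ A) (hlo : lo ≤ top) (hy : lo < top → v (top - 1) ≤ y)
    (hδ : lo + 2 ≤ top → δ < y - v (top - 2)) (hv : ∀ k, lo ≤ k → k < top → v' k = v k)
    (hv' : v' top = y) : Trim v' lo (top + 1) δ (insert y A) := by
  refine ⟨fun k hk hk' => ?_, fun k hk hk' => ?_, fun a ha => ?_, fun a ha k hk hk' h1 h2 => ?_⟩
  · rcases Nat.lt_or_ge (k + 1) top with h' | h'
    · rw [hv k hk (by omega), hv (k + 1) (by omega) h']; exact h.mono k hk h'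
    · obtain rfl : top = k + 1 := by omega
      rw [hv', hv k hk (by omega)]
      exact hy (by omega)
  · rcases Nat.lt_or_ge (k + 2) top with h' | h'
    · rw [hv k hk (by omega), hv (k + 2) (by omega) h']; exact h.span k hk h'
    · obtain rfl : top = k + 2 := by omega
      rw [hv', hv k hk (by omega)]
      exact hδ (by omega)
  · refine ⟨by omega, ?_⟩
    rw [Nat.add_sub_cancel, hv']
    rcases Nat.lt_or_ge lo top with h' | h'
    · rw [hv lo le_rfl h']
      rcases ha with rfl | ha
      · exact ⟨(le_of_step_le h.mono le_rfl (by omega) (by omega)).trans (hy h'), le_rfl⟩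
      · obtain ⟨-, h2, h3⟩ := h.mem a ha
        exact ⟨h2, h3.trans (hy h')⟩
    · obtain rfl : lo = top := by omega
      rw [hv']
      rcases ha with rfl | ha
      · exact ⟨le_rfl, le_rfl⟩
      · exact absurd (h.mem a ha).1 (lt_irrefl _)
  · rcases Nat.lt_or_ge (k + 1) top with h' | h'
    · rw [hv k hk (by omega)] at h1 ⊢
      rw [hv (k + 1) (by omega) h'] at h2 ⊢
      rcases ha with rfl | ha
      · have := le_of_step_le h.mono (show lo ≤ k + 1 by omega) (show k + 1 ≤ top - 1 by omega)
          (by omega)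
        have := hy (by omega)
        linarith
      · exact h.gap a ha k hk h' h1 h2
    · obtain rfl : top = k + 1 := by omega
      rw [hv'] at h2
      rw [hv k hk (by omega)] at h1
      rcases ha with rfl | ha
      · exact absurd h2 (lt_irrefl _)
      · have := (h.mem a ha).2.2
        rw [Nat.add_sub_cancel] at this
        linarith

/-- The overwritten value ends up between `v (top - 1)` and `y`, a gap of length at most `δ`, so
`gap` still holds for it. -/
theorem Trim.replace (h : Trim v lo (top + 1) δ A) (hlo : lo < top) (hy : v top ≤ y)
    (hδ : y - v (top - 1) ≤ δ) (hv : ∀ k, lo ≤ k → k < top → v' k = v k)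
    (hv' : v' top = y) : Trim v' lo (top + 1) δ (insert y A) := by
  refine ⟨fun k hk hk' => ?_, fun k hk hk' => ?_, fun a ha => ?_, fun a ha k hk hk' h1 h2 => ?_⟩
  · rw [hv k hk (by omega)]
    have := h.mono k hk hk'
    rcases Nat.lt_or_ge (k + 1) top with h' | h'
    · rwa [hv (k + 1) (by omega) h']
    · obtain rfl : top = k + 1 := by omega
      rw [hv']; exact this.trans hy
  · rw [hv k hk (by omega)]
    have := h.span k hk hk'
    rcases Nat.lt_or_ge (k + 2) top with h' | h'
    · rwa [hv (k + 2) (by omega) h']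
    · obtain rfl : top = k + 2 := by omega
      rw [hv']; linarith
  · refine ⟨by omega, ?_⟩
    rw [Nat.add_sub_cancel, hv', hv lo le_rfl hlo]
    rcases ha with rfl | ha
    · exact ⟨(le_of_step_le h.mono le_rfl hlo.le (by omega)).trans hy, le_rfl⟩
    · obtain ⟨-, h2, h3⟩ := h.mem a ha
      exact ⟨h2, h3.trans hy⟩
  · rw [hv k hk (by omega)] at h1 ⊢
    rcases Nat.lt_or_ge (k + 1) top with h' | h'
    · rw [hv (k + 1) (by omega) h'] at h2 ⊢
      rcases ha with rfl | ha
      · have := le_of_step_le h.mono (show lo ≤ k + 1 by omega) h'.le (by omega)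
        linarith
      · exact h.gap a ha k hk (by omega) h1 h2
    · obtain rfl : top = k + 1 := by omega
      rw [hv']
      simpa using hδ

/-- Trimming keeps brackets of length at most `δ`. -/
theorem Trim.bracket (h : Trim v lo top δ A) {a b : ℝ} (ha : a ∈ A) (hb : b ∈ A) (hay : a ≤ y)
    (hyb : y ≤ b) (hab : b - a ≤ δ) : ∃ k k', lo ≤ k ∧ k < top ∧ lo ≤ k' ∧ k' < top ∧
      v k ≤ y ∧ y ≤ v k' ∧ v k' - v k ≤ δ := by
  obtain ⟨hlo, ha1, ha2⟩ := h.mem a ha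
  obtain ⟨-, hb1, hb2⟩ := h.mem b hb
  -- The position `k` of the last list value not above `y`.
  have hex : ∃ k, lo ≤ k ∧ k < top ∧ v k ≤ y ∧ (k + 1 < top → y < v (k + 1)) := by
    by_contra hno
    push Not at hno
    have : ∀ k, lo ≤ k → k < top → v k ≤ y := by
      intro k hk
      induction k, hk using Nat.le_induction with
      | base => intro _; exact ha1.trans hay
      | succ k hk ih => intro hk'; exact (hno k hk (by omega) (ih (by omega))).2
    exact absurd (hno (top - 1) (by omega) (by omega) (this _ (by omega) (by omega))).1 (by omega)
  obtain ⟨k, hk, hkt, hky, hnext⟩ := hex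
  rcases Nat.lt_or_ge (k + 1) top with h1 | h1
  · have hy := hnext h1
    by_cases hbk : b ≤ v k
    · exact ⟨k, k, hk, hkt, hk, hkt, hky, hyb.trans hbk, by linarith⟩
    push Not at hbk
    refine ⟨k, k + 1, hk, hkt, by omega, h1, hky, hy.le, ?_⟩
    -- If an endpoint of the given bracket lies strictly inside the gap, then `gap` bounds the gap
    -- by `δ`; otherwise the gap is contained in `[a, b]`.
    by_cases hak : v k < a
    · exact h.gap a ha k hk h1 hak (by linarith)
    by_cases hbk' : b < v (k + 1)
    · exact h.gap b hb k hk h1 hbk hbk'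
    linarith
  · obtain rfl : top = k + 1 := by omega
    rw [Nat.add_sub_cancel] at hb2
    exact ⟨k, k, hk, hkt, hk, hkt, hky, hyb.trans hb2, by linarith⟩

/-- The nodes in the positions `[lo, hi)` of the heap form a trimmed list
of sets from the family `𝒢`. -/
structure Seg (w : ℕ → ℝ) (h : Heap) (lo hi : ℕ) (δ B : ℝ) (𝒢 : Set (Finset ℕ)) : Prop where
  lt : lo < hi
  zero : h.val lo = 0
  mono : ∀ k, lo ≤ k → k + 1 < hi → h.val k ≤ h.val (k + 1)
  span : ∀ k, lo ≤ k → k + 2 < hi → δ < h.val (k + 2) - h.val k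
  le : ∀ k, lo ≤ k → k < hi → h.val k ≤ B
  rep : ∀ k, lo ≤ k → k < hi → ∃ X ∈ 𝒢, h.Rep w k X
  bracket : ∀ X ∈ 𝒢, ∑ j ∈ X, w j ≤ B - δ → ∃ k k', lo ≤ k ∧ k < hi ∧ lo ≤ k' ∧ k' < hi ∧
    h.val k ≤ ∑ j ∈ X, w j ∧ ∑ j ∈ X, w j ≤ h.val k' ∧ h.val k' - h.val k ≤ δ

/-- The list starts at `0`, and by `span` every two positions gain more than `δ`. -/
theorem Seg.length_le {w : ℕ → ℝ} {h : Heap} {lo hi : ℕ} {δ B : ℝ} {𝒢 : Set (Finset ℕ)}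
    (hs : Seg w h lo hi δ B 𝒢) {N : ℕ} (hN : B < (N + 1) * δ) : hi - lo ≤ 2 * N + 2 := by
  by_contra hlt
  have : ∀ m : ℕ, lo + 2 * m < hi → m * δ ≤ h.val (lo + 2 * m) := by
    intro m
    induction m with
    | zero => intro _; simp [hs.zero]
    | succ m ih =>
      intro hm
      have h1 := ih (by omega)
      have h2 := hs.span (lo + 2 * m) (by omega) (by omega)
      push_cast
      rw [show lo + 2 * (m + 1) = lo + 2 * m + 2 by ring]
      linarith
  have h1 := this (N + 1) (by omega)
  have h2 := hs.le (lo + 2 * (N + 1)) (by omega) (by omega)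
  push_cast at h1
  linarith

end Trim

/-! ### Merging a list with its translate. -/

section Merge

/-- The heap with a new node at `k`. -/
def Heap.set (h : Heap) (k : ℕ) (y : ℝ) (a b p : ℕ) : Heap :=
  ⟨Function.update h.val k y, Function.update h.fst k a, Function.update h.lst k b,
    Function.update h.par k p⟩

theorem Heap.set_same (h : Heap) {k j : ℕ} (y : ℝ) (a b p : ℕ) (hj : j ≠ k) :
    h.Same (h.set k y a b p) j j := by
  simp [Heap.Same, Heap.set, hj]

theorem Heap.below_set (h : Heap) {k m : ℕ} (y : ℝ) (a b p : ℕ) (hm : m ≤ k) :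
    h.Below (h.set k y a b p) m :=
  fun j hj => h.set_same y a b p (by omega)

theorem Trim.anti {v : ℕ → ℝ} {lo top : ℕ} {δ : ℝ} {A A' : Set ℝ} (h : Trim v lo top δ A)
    (hA : A' ⊆ A) : Trim v lo top δ A' :=
  ⟨h.mono, h.span, fun a ha => h.mem a (hA ha), fun a ha => h.gap a (hA ha)⟩

/-- The new list, built from position `hi` on, when the candidates in `A` have been treated. -/
structure Pushed (w : ℕ → ℝ) (h₀ h : Heap) (hi top : ℕ) (δ B : ℝ) (𝒢 : Set (Finset ℕ))
    (A : Set ℝ) : Prop where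
  below : h₀.Below h hi
  le_top : hi ≤ top
  trim : Trim h.val hi top δ A
  le : ∀ k, hi ≤ k → k < top → h.val k ≤ B
  rep : ∀ k, hi ≤ k → k < top → ∃ X ∈ 𝒢, h.Rep w k X
  zero : hi < top → h.val hi = 0

open Classical in
/-- The position of a new element of value `y`: the last element is overwritten if the
one before it is close to `y`. -/
noncomputable def Heap.slot (h : Heap) (hi top : ℕ) (δ y : ℝ) : ℕ :=
  if hi + 2 ≤ top ∧ y - h.val (top - 2) ≤ δ then top - 1 else top

variable {w : ℕ → ℝ} {h₀ h : Heap} {lo hi top : ℕ} {δ B x y : ℝ} {𝒢 𝒢' : Set (Finset ℕ)}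
  {A : Set ℝ}

/-- Either outcome of `slot` writes at a position from `hi` on, so the old list, which holds the
parents, stays intact. The first element is never overwritten, as the test requires two elements;
this keeps the value `0` at the start. -/
theorem Pushed.push (hp : Pushed w h₀ h hi top δ B 𝒢 A) {a b p : ℕ}
    (hy : hi < top → h.val (top - 1) ≤ y) (hy0 : top = hi → y = 0) (hyB : y ≤ B)
    (hrep : ∀ (h' : Heap) (k : ℕ), h₀.Below h' hi → hi ≤ k → h'.val k = y → h'.fst k = a →
      h'.lst k = b → h'.par k = p → ∃ X ∈ 𝒢, h'.Rep w k X) :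
    Pushed w h₀ (h.set (h.slot hi top δ y) y a b p) hi (h.slot hi top δ y + 1) δ B 𝒢
      (insert y A) := by
  have key : ∀ m, hi ≤ m → m ≤ top → (m = top ∨ hi < m) →
      Trim (h.set m y a b p).val hi (m + 1) δ (insert y A) →
      Pushed w h₀ (h.set m y a b p) hi (m + 1) δ B 𝒢 (insert y A) := by
    intro m hm hmt hm0 ht
    have hbel : h₀.Below (h.set m y a b p) hi := hp.below.trans (h.below_set y a b p hm) le_rfl
    refine ⟨hbel, by omega, ht, fun k hk hk' => ?_, fun k hk hk' => ?_, fun _ => ?_⟩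
    · by_cases hkm : k = m
      · subst hkm; simpa [Heap.set] using hyB
      · rw [(h.set_same y a b p hkm).1]; exact hp.le k hk (by omega)
    · by_cases hkm : k = m
      · subst hkm
        exact hrep _ _ hbel hk (by simp [Heap.set]) (by simp [Heap.set]) (by simp [Heap.set])
          (by simp [Heap.set])
      · obtain ⟨X, hX, hX'⟩ := hp.rep k hk (by omega)
        exact ⟨X, hX, hX'.of_below (h.below_set y a b p le_rfl) (by omega)⟩
    · by_cases hkm : hi = m
      · subst hkm
        have := hy0 (by omega)
        simpa [Heap.set] using this
      · rw [(h.set_same y a b p hkm).1]; exact hp.zero (by omega)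
  unfold Heap.slot
  have hto := hp.le_top
  split_ifs with hc
  · obtain ⟨m, rfl⟩ : ∃ m, top = m + 1 := ⟨top - 1, by omega⟩
    rw [Nat.add_sub_cancel] at *
    refine key m (by omega) (by omega) (by omega) ?_
    exact hp.trim.replace (by omega) (hy (by omega)) hc.2
      (fun k hk hk' => (h.set_same y a b p (by omega)).1) (by simp [Heap.set])
  · refine key top hto le_rfl (Or.inl rfl) ?_
    exact hp.trim.push hto hy (fun h2 => by
      by_contra hcon
      exact hc ⟨h2, not_lt.1 hcon⟩)
      (fun k hk hk' => (h.set_same y a b p (by omega)).1) (by simp [Heap.set])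

/-- The candidates, up to `B`, that have been treated. -/
def cands (h : Heap) (lo r t : ℕ) (B x : ℝ) : Set ℝ :=
  {z | z ≤ B ∧ ((∃ k, lo ≤ k ∧ k < r ∧ z = h.val k) ∨ ∃ k, lo ≤ k ∧ k < t ∧ z = h.val k + x)}

/-- The state of merging the list `[lo, hi)` with its translate by `x`. -/
structure Merge (w : ℕ → ℝ) (h₀ : Heap) (lo hi : ℕ) (δ B x : ℝ) (𝒢 : Set (Finset ℕ)) (h : Heap)
    (r t top : ℕ) : Prop where
  pushed : Pushed w h₀ h hi top δ B 𝒢 (cands h₀ lo r t B x)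
  lo_r : lo ≤ r
  r_hi : r ≤ hi
  lo_t : lo ≤ t
  t_hi : t ≤ hi
  t_eq : t = hi → r = hi
  start : top = hi → r = lo ∧ t = lo
  next_r : hi < top → r < hi → h.val (top - 1) ≤ h₀.val r
  next_t : hi < top → t < hi → h.val (top - 1) ≤ h₀.val t + x

open Finset in
/-- The family after the addition of the item `[a, b)`. -/
def adjoin (𝒢 : Set (Finset ℕ)) (a b : ℕ) : Set (Finset ℕ) :=
  𝒢 ∪ (fun X => X ∪ Ico a b) '' 𝒢

variable {r t a b : ℕ}

theorem Merge.old (hs : Seg w h₀ lo hi δ B 𝒢)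
    (hm : Merge w h₀ lo hi δ B x (adjoin 𝒢 a b) h r t top)
    (ht : t < hi) (hr : r < hi) (hrt : h₀.val r ≤ h₀.val t + x) :
    (h₀.val r ≤ B → Merge w h₀ lo hi δ B x (adjoin 𝒢 a b)
      (h.set (h.slot hi top δ (h₀.val r)) (h₀.val r) (h₀.fst r) (h₀.lst r) (h₀.par r))
      (r + 1) t (h.slot hi top δ (h₀.val r) + 1)) ∧
    (¬ h₀.val r ≤ B → Merge w h₀ lo hi δ B x (adjoin 𝒢 a b) h (r + 1) t top) := by
  have hlr := hm.lo_r
  have hstep : r + 1 < hi → h₀.val r ≤ h₀.val (r + 1) := hs.mono r hlr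
  constructor
  · intro hB
    have hp := hm.pushed.push (y := h₀.val r) (a := h₀.fst r) (b := h₀.lst r) (p := h₀.par r)
      (fun h1 => hm.next_r h1 hr) (fun h1 => by rw [(hm.start h1).1, hs.zero]) hB
      (by
        intro h' k hb hk h1 h2 h3 h4
        obtain ⟨X, hX, hX'⟩ := hs.rep r hlr hr
        exact ⟨X, Or.inl hX, hX'.of_same ⟨h1, h2, h3, h4⟩ (by omega)
          fun j hj => hb j (by omega)⟩)
    refine ⟨⟨hp.below, hp.le_top, hp.trim.anti ?_, hp.le, hp.rep, hp.zero⟩, by omega, by omega,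
      hm.lo_t, hm.t_hi, by omega, ?_, ?_, ?_⟩
    · rintro z ⟨hz, ⟨k, hk, hk', rfl⟩ | ⟨k, hk, hk', rfl⟩⟩
      · rcases Nat.lt_succ_iff_lt_or_eq.1 hk' with h1 | rfl
        · exact Or.inr ⟨hz, Or.inl ⟨k, hk, h1, rfl⟩⟩
        · exact Or.inl rfl
      · exact Or.inr ⟨hz, Or.inr ⟨k, hk, hk', rfl⟩⟩
    · intro h1
      have := hm.pushed.le_top
      unfold Heap.slot at h1
      split_ifs at h1 <;> omega
    · intro _ h1
      simpa [Heap.set] using hstep h1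
    · intro _ h1
      simpa [Heap.set] using hrt
  · intro hB
    have h0 : r ≠ lo := by
      rintro rfl
      have := hs.le r le_rfl hr
      contradiction
    refine ⟨⟨hm.pushed.below, hm.pushed.le_top, hm.pushed.trim.anti ?_, hm.pushed.le,
      hm.pushed.rep, hm.pushed.zero⟩, by omega, by omega,
      hm.lo_t, hm.t_hi, by omega, fun h1 => absurd (hm.start h1).1 h0,
      fun h1 h2 => (hm.next_r h1 hr).trans (hstep h2), hm.next_t⟩
    rintro z ⟨hz, ⟨k, hk, hk', rfl⟩ | ⟨k, hk, hk', rfl⟩⟩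
    · rcases Nat.lt_succ_iff_lt_or_eq.1 hk' with h1 | rfl
      · exact ⟨hz, Or.inl ⟨k, hk, h1, rfl⟩⟩
      · exact absurd hz hB
    · exact ⟨hz, Or.inr ⟨k, hk, hk', rfl⟩⟩

theorem Merge.new (hs : Seg w h₀ lo hi δ B 𝒢)
    (hm : Merge w h₀ lo hi δ B x (adjoin 𝒢 a b) h r t top)
    (hx : x = ∑ j ∈ Finset.Ico a b, w j) (hx0 : 0 ≤ x) (hab : a < b)
    (hd : ∀ X ∈ 𝒢, Disjoint X (Finset.Ico a b))
    (ht : t < hi) (hrt : ¬ (r < hi ∧ h₀.val r ≤ h₀.val t + x)) :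
    (h₀.val t + x ≤ B → Merge w h₀ lo hi δ B x (adjoin 𝒢 a b)
      (h.set (h.slot hi top δ (h₀.val t + x)) (h₀.val t + x) a b t)
      r (t + 1) (h.slot hi top δ (h₀.val t + x) + 1)) ∧
    (¬ h₀.val t + x ≤ B → Merge w h₀ lo hi δ B x (adjoin 𝒢 a b) h r (t + 1) top) := by
  have hlt := hm.lo_t
  have hstep : t + 1 < hi → h₀.val t ≤ h₀.val (t + 1) := hs.mono t hlt
  have hr : r < hi → h₀.val t + x ≤ h₀.val r := fun h1 => by
    by_contra h2
    exact hrt ⟨h1, (not_le.1 h2).le⟩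
  -- The last translated element comes after all old ones: for `r ≤ t` the old value at `r` is at
  -- most the value at `t`, hence at most its translate, and ties favour the old list.
  have hend : t + 1 = hi → r = hi := by
    intro h1
    by_contra h2
    have h3 := hm.r_hi
    refine hrt ⟨by omega, ?_⟩
    have := le_of_step_le hs.mono hm.lo_r (show r ≤ t by omega) ht
    linarith
  -- The first push is the old element of value `0`, since `x ≥ 0` and ties favour the old list.
  have hst : top ≠ hi := by
    intro h1
    obtain ⟨rfl, rfl⟩ := hm.start h1
    exact hrt ⟨ht, by linarith⟩
  constructor
  · intro hB
    have hp := hm.pushed.push (y := h₀.val t + x) (a := a) (b := b) (p := t)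
      (fun h1 => hm.next_t h1 ht) (fun h1 => absurd h1 hst) hB
      (by
        intro h' k hb hk h1 h2 h3 h4
        obtain ⟨X, hX, hX'⟩ := hs.rep t hlt ht
        have hX'' := hX'.of_below hb ht
        refine ⟨X ∪ Finset.Ico a b, Or.inr ⟨X, hX, rfl⟩, ?_⟩
        subst h2 h3 h4
        refine .cons k X hab (by omega) hX'' (hd X hX) ?_
        rw [h1, hx, (hb _ ht).1])
    refine ⟨⟨hp.below, hp.le_top, hp.trim.anti ?_, hp.le, hp.rep, hp.zero⟩, hm.lo_r, hm.r_hi,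
      by omega, by omega, hend, ?_, ?_, ?_⟩
    · rintro z ⟨hz, ⟨k, hk, hk', rfl⟩ | ⟨k, hk, hk', rfl⟩⟩
      · exact Or.inr ⟨hz, Or.inl ⟨k, hk, hk', rfl⟩⟩
      · rcases Nat.lt_succ_iff_lt_or_eq.1 hk' with h1 | rfl
        · exact Or.inr ⟨hz, Or.inr ⟨k, hk, h1, rfl⟩⟩
        · exact Or.inl rfl
    · intro h1
      have := hm.pushed.le_top
      unfold Heap.slot at h1
      split_ifs at h1 <;> omega
    · intro _ h1
      simpa [Heap.set] using hr h1
    · intro _ h1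
      simpa [Heap.set] using hstep h1
  · intro hB
    refine ⟨⟨hm.pushed.below, hm.pushed.le_top, hm.pushed.trim.anti ?_, hm.pushed.le,
      hm.pushed.rep, hm.pushed.zero⟩, hm.lo_r, hm.r_hi, by omega, by omega, hend,
      fun h1 => absurd h1 hst, hm.next_r,
      fun h1 h2 => (hm.next_t h1 ht).trans (by linarith [hstep h2])⟩
    rintro z ⟨hz, ⟨k, hk, hk', rfl⟩ | ⟨k, hk, hk', rfl⟩⟩
    · exact ⟨hz, Or.inl ⟨k, hk, hk', rfl⟩⟩
    · rcases Nat.lt_succ_iff_lt_or_eq.1 hk' with h1 | rfl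
      · exact ⟨hz, Or.inr ⟨k, hk, h1, rfl⟩⟩
      · exact absurd hz hB

theorem Merge.begin (hs : Seg w h₀ lo hi δ B 𝒢) :
    Merge w h₀ lo hi δ B x 𝒢' h₀ lo lo hi := by
  have := hs.lt
  refine ⟨⟨Heap.Below.refl _ _, le_rfl, ⟨fun k _ _ => by omega, fun k _ _ => by omega, ?_,
    fun a ha k _ _ => by omega⟩, fun k _ _ => by omega, fun k _ _ => by omega,
    fun h => absurd h (lt_irrefl _)⟩, le_rfl, by omega, le_rfl, by omega, by omega,
    fun _ => ⟨rfl, rfl⟩, fun h => absurd h (lt_irrefl _), fun h => absurd h (lt_irrefl _)⟩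
  rintro z ⟨_, ⟨k, _, _, _⟩ | ⟨k, _, _, _⟩⟩ <;> omega

/-- A bracket of `X` is also a bracket for the new list before trimming, and its translate by `x` is
one for `X ∪ [a, b)`. The upper ends do not exceed `B`, because the sets in question weigh at most
`B - δ`. So the precision `δ` is the same after every item. -/
theorem Merge.finish (hs : Seg w h₀ lo hi δ B 𝒢)
    (hm : Merge w h₀ lo hi δ B x (adjoin 𝒢 a b) h r t top)
    (hx : x = ∑ j ∈ Finset.Ico a b, w j) (hx0 : 0 ≤ x)
    (hd : ∀ X ∈ 𝒢, Disjoint X (Finset.Ico a b)) (ht : ¬ t < hi) :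
    Seg w h hi top δ B (adjoin 𝒢 a b) := by
  have ht' : t = hi := by have := hm.t_hi; omega
  have hr' := hm.t_eq ht'
  subst hr' ht'
  have hlt : t < top := by
    have h1 := hm.pushed.le_top
    have h2 := hs.lt
    rcases h1.eq_or_lt with h3 | h3
    · have := (hm.start h3.symm).1; omega
    · exact h3
  refine ⟨hlt, hm.pushed.zero hlt, hm.pushed.trim.mono, hm.pushed.trim.span, hm.pushed.le,
    hm.pushed.rep, ?_⟩
  rintro X (hX | ⟨X, hX, rfl⟩) hXB
  · obtain ⟨k, k', h1, h2, h3, h4, h5, h6, h7⟩ := hs.bracket X hX hXB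
    have h8 : h₀.val k' ≤ B := by linarith
    obtain ⟨m, m', g⟩ := hm.pushed.trim.bracket (a := h₀.val k) (b := h₀.val k')
      ⟨by linarith, Or.inl ⟨k, h1, h2, rfl⟩⟩ ⟨h8, Or.inl ⟨k', h3, h4, rfl⟩⟩ h5 h6 h7
    exact ⟨m, m', g⟩
  · have hsum : ∑ j ∈ X ∪ Finset.Ico a b, w j = ∑ j ∈ X, w j + x := by
      rw [Finset.sum_union (hd X hX), hx]
    simp only [hsum] at hXB ⊢
    obtain ⟨k, k', h1, h2, h3, h4, h5, h6, h7⟩ := hs.bracket X hX (by linarith)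
    obtain ⟨m, m', g⟩ := hm.pushed.trim.bracket (y := ∑ j ∈ X, w j + x)
      (a := h₀.val k + x) (b := h₀.val k' + x)
      ⟨by linarith, Or.inr ⟨k, h1, h2, rfl⟩⟩ ⟨by linarith, Or.inr ⟨k', h3, h4, rfl⟩⟩
      (by linarith) (by linarith) (by linarith)
    exact ⟨m, m', g⟩

end Merge

/-! ### The program that adds one item to the list. -/

section Emit

/-- Strict comparison of integers. -/
@[simp] def BExp.ilt (e₁ e₂ : IExp) : BExp := .neg (.ile e₂ e₁)
/-- Strict comparison of reals. -/
@[simp] def BExp.rlt (e₁ e₂ : RExp) : BExp := .neg (.rle e₂ e₁)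
/-- Increment of an integer register. -/
@[simp] def Prog.inc (x : ℕ) : Prog := .iset x (.add (.reg x) (.lit 1))

/-- Copy the next element of the old list into the registers for the next candidate. -/
def takeOld : Prog :=
  .rset 31 (.get 5 (.reg 32)) ;; .iset 35 (.get 1 (.reg 32)) ;; .iset 36 (.get 2 (.reg 32)) ;;
  .iset 37 (.get 3 (.reg 32)) ;; .inc 32

/-- Put the next element of the translated list into the registers for the next candidate. -/
def takeNew : Prog :=
  .rset 31 (.add (.get 5 (.reg 33)) (.reg 30)) ;; .iset 35 (.reg 30) ;; .iset 36 (.reg 31) ;;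
  .iset 37 (.reg 33) ;; .inc 33

/-- Append the candidate to the new list, with trimming. -/
def pushNode : Prog :=
  .ite (.rle (.reg 31) (.reg 24))
    (.ite (.conj (.ile (.add (.reg 50) (.lit 2)) (.reg 34))
        (.rle (.sub (.reg 31) (.get 5 (.sub (.reg 34) (.lit 2)))) (.reg 23)))
      (.iset 34 (.sub (.reg 34) (.lit 1))) .skip ;;
    .rput 5 (.reg 34) (.reg 31) ;; .iput 1 (.reg 34) (.reg 35) ;; .iput 2 (.reg 34) (.reg 36) ;;
    .iput 3 (.reg 34) (.reg 37) ;; .inc 34)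
    .skip

/-- Add the item `[ireg 30, ireg 31)` of weight `rreg 30` to the list
`[ireg 51, ireg 50)`: merge the list with its translate, trim the result to the
precision `rreg 23` and drop everything above `rreg 24`. -/
def emit : Prog :=
  .iset 32 (.reg 51) ;; .iset 33 (.reg 51) ;; .iset 34 (.reg 50) ;;
  .loop (.ilt (.reg 33) (.reg 50))
    (.ite (.conj (.ilt (.reg 32) (.reg 50))
        (.rle (.get 5 (.reg 32)) (.add (.get 5 (.reg 33)) (.reg 30)))) takeOld takeNew ;;
      pushNode) ;;
  .iset 51 (.reg 50) ;; .iset 50 (.reg 34)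

variable {s : State} {T : ℕ} {Q : State → ℕ → Prop}

/-- Properties of the registers that are kept while an item is added. -/
structure EmitFrame (s₀ s : State) : Prop where
  frame : Frame 30 s₀ s
  i30 : s.ireg 30 = s₀.ireg 30
  i31 : s.ireg 31 = s₀.ireg 31
  i50 : s.ireg 50 = s₀.ireg 50
  i51 : s.ireg 51 = s₀.ireg 51
  r30 : s.rreg 30 = s₀.rreg 30

theorem EmitFrame.trans {s₁ s₂ s₃ : State} (h : EmitFrame s₁ s₂) (h' : EmitFrame s₂ s₃) :
    EmitFrame s₁ s₃ :=
  ⟨h.frame.trans h'.frame, h'.i30.trans h.i30, h'.i31.trans h.i31, h'.i50.trans h.i50,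
    h'.i51.trans h.i51, h'.r30.trans h.r30⟩

theorem pushNode_spec
    (h : ∀ s' T', EmitFrame s s' → s'.ireg 32 = s.ireg 32 → s'.ireg 33 = s.ireg 33 → T' ≤ T + 50 →
      (s.rreg 31 ≤ s.rreg 24 →
        s'.ireg 34 = s.heap.slot (s.ireg 50) (s.ireg 34) (s.rreg 23) (s.rreg 31) + 1 ∧
        s'.heap = s.heap.set (s.heap.slot (s.ireg 50) (s.ireg 34) (s.rreg 23) (s.rreg 31))
          (s.rreg 31) (s.ireg 35) (s.ireg 36) (s.ireg 37)) →
      (¬ s.rreg 31 ≤ s.rreg 24 → s'.ireg 34 = s.ireg 34 ∧ s'.heap = s.heap) →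
      Q s' T') : WP pushNode s T Q := by
  have hfr := Frame.refl 30 s
  simp only [pushNode, wp_ite, wp_seq, wp_iset, wp_skip, wp_rput, wp_iput, Prog.inc]
  refine ⟨fun hB => ⟨fun hc => ?_, fun hc => ?_⟩, fun hB => ?_⟩
  · have hsl : s.heap.slot (s.ireg 50) (s.ireg 34) (s.rreg 23) (s.rreg 31) = s.ireg 34 - 1 := by
      rw [Heap.slot, if_pos]; exact hc
    refine h _ _ ⟨?_, ?_, ?_, ?_, ?_, ?_⟩ ?_ ?_ ?_ (fun _ => ⟨?_, ?_⟩) (fun h' => absurd hB h')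
    · exact (((((hfr.setI (by decide)).putR).putI (by decide) (by decide)).putI (by decide)
        (by decide)).putI (by decide) (by decide)).setI (by decide)
    all_goals try rw [hsl]
    all_goals simp [State.heap, Heap.set]
  · have hsl : s.heap.slot (s.ireg 50) (s.ireg 34) (s.rreg 23) (s.rreg 31) = s.ireg 34 := by
      rw [Heap.slot, if_neg]; exact hc
    refine h _ _ ⟨?_, ?_, ?_, ?_, ?_, ?_⟩ ?_ ?_ ?_ (fun _ => ⟨?_, ?_⟩) (fun h' => absurd hB h')
    · exact ((((hfr.putR).putI (by decide) (by decide)).putI (by decide)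
        (by decide)).putI (by decide) (by decide)).setI (by decide)
    all_goals try rw [hsl]
    all_goals simp [State.heap, Heap.set]
  · refine h _ _ ⟨hfr, rfl, rfl, rfl, rfl, rfl⟩ rfl rfl ?_ (fun h' => absurd h' hB)
      fun _ => ⟨rfl, rfl⟩
    simp

/-- Each round of the loop advances one of two pointers that run over the old list, so the cost is
linear in its length. -/
theorem emit_spec {w : ℕ → ℝ} {𝒢 : Set (Finset ℕ)}
    (hs : Seg w s.heap (s.ireg 51) (s.ireg 50) (s.rreg 23) (s.rreg 24) 𝒢)
    (hab : s.ireg 30 < s.ireg 31)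
    (hx : s.rreg 30 = ∑ j ∈ Finset.Ico (s.ireg 30) (s.ireg 31), w j) (hx0 : 0 ≤ s.rreg 30)
    (hd : ∀ X ∈ 𝒢, Disjoint X (Finset.Ico (s.ireg 30) (s.ireg 31)))
    (h : ∀ s' T', Frame 30 s s' → s.ireg 50 ≤ s'.ireg 50 → s.heap.Below s'.heap (s.ireg 50) →
      Seg w s'.heap (s'.ireg 51) (s'.ireg 50) (s.rreg 23) (s.rreg 24)
        (adjoin 𝒢 (s.ireg 30) (s.ireg 31)) →
      T' ≤ T + (200 * (s.ireg 50 - s.ireg 51) + 20) → Q s' T') : WP emit s T Q := by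
  simp only [emit, wp_seq, wp_iset]
  apply WP.loop (Inv := fun s' T' => EmitFrame s s' ∧
      Merge w s.heap (s.ireg 51) (s.ireg 50) (s.rreg 23) (s.rreg 24) (s.rreg 30)
        (adjoin 𝒢 (s.ireg 30) (s.ireg 31)) s'.heap (s'.ireg 32) (s'.ireg 33) (s'.ireg 34) ∧
      T' ≤ T + (100 * ((s'.ireg 32 - s.ireg 51) + (s'.ireg 33 - s.ireg 51)) + 6))
    (m := fun s' => (s.ireg 50 - s'.ireg 32) + (s.ireg 50 - s'.ireg 33))
  · rintro s₁ T₁ ⟨hf, hm, hT⟩ hb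
    have hb' : s₁.ireg 33 < s.ireg 50 := by
      simpa [hf.i50] using hb
    have ed : s₁.rreg 23 = s.rreg 23 := hf.frame.rreg 23 (by decide)
    have eB : s₁.rreg 24 = s.rreg 24 := hf.frame.rreg 24 (by decide)
    have hlr := hm.lo_r
    have hlt := hm.lo_t
    have hrh := hm.r_hi
    have ht := hm.pushed.below _ hb'
    have ht1 : s₁.rarr 5 (s₁.ireg 33) = s.heap.val (s₁.ireg 33) := ht.1
    simp only [wp_seq, wp_ite]
    have hfr := Frame.refl 30 s₁
    refine ⟨fun hc => ?_, fun hc => ?_⟩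
    · have hr1 : s₁.ireg 32 < s.ireg 50 := by
        simpa [hf.i50] using hc.1
      obtain ⟨g1, g2, g3, g4⟩ := hm.pushed.below _ hr1
      have hrt : s.heap.val (s₁.ireg 32) ≤ s.heap.val (s₁.ireg 33) + s.rreg 30 := by
        have := hc.2
        simp only [BExp.Holds, RExp.eval, IExp.eval, ht1, hf.r30] at this
        rwa [← g1]
      obtain ⟨k1, k2⟩ := hm.old hs hb' hr1 hrt
      simp only [takeOld, wp_seq, wp_iset, wp_rset, Prog.inc]
      apply pushNode_spec
      intro s₂ T₂ hf2 e32 e33 hT2 p1 p2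
      have e1 : EmitFrame s₁ s₂ := by
        refine EmitFrame.trans ⟨?_, ?_, ?_, ?_, ?_, ?_⟩ hf2
        · exact ((((hfr.setR (by decide)).setI (by decide)).setI (by decide)).setI
            (by decide)).setI (by decide)
        all_goals simp
      simp [ed, eB, hf.i50] at p1 p2 e32 e33 hT2
      have y1 : s₁.rarr 5 (s₁.ireg 32) = s.heap.val (s₁.ireg 32) := g1
      have y2 : s₁.iarr 1 (s₁.ireg 32) = s.heap.fst (s₁.ireg 32) := g2
      have y3 : s₁.iarr 2 (s₁.ireg 32) = s.heap.lst (s₁.ireg 32) := g3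
      have y4 : s₁.iarr 3 (s₁.ireg 32) = s.heap.par (s₁.ireg 32) := g4
      rw [y1, y2, y3, y4] at p1
      rw [y1] at p2
      refine ⟨⟨hf.trans e1, ?_, by rw [e32, e33]; omega⟩, by rw [e32, e33]; omega⟩
      rw [e32, e33]
      by_cases hB : s.heap.val (s₁.ireg 32) ≤ s.rreg 24
      · obtain ⟨q1, q2⟩ := p1 hB
        rw [q1, q2]
        exact k1 hB
      · obtain ⟨q1, q2⟩ := p2 (not_le.1 hB)
        rw [q1, q2]
        exact k2 hB
    · have hrt : ¬ (s₁.ireg 32 < s.ireg 50 ∧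
          s.heap.val (s₁.ireg 32) ≤ s.heap.val (s₁.ireg 33) + s.rreg 30) := by
        rintro ⟨h1, h2⟩
        refine hc ⟨by simpa [hf.i50] using h1, ?_⟩
        simp only [BExp.Holds, RExp.eval, IExp.eval, ht1, hf.r30]
        exact (hm.pushed.below _ h1).1.trans_le h2
      obtain ⟨k1, k2⟩ := hm.new hs hx hx0 hab hd hb' hrt
      simp only [takeNew, wp_seq, wp_iset, wp_rset, Prog.inc]
      apply pushNode_spec
      intro s₂ T₂ hf2 e32 e33 hT2 p1 p2
      have e1 : EmitFrame s₁ s₂ := by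
        refine EmitFrame.trans ⟨?_, ?_, ?_, ?_, ?_, ?_⟩ hf2
        · exact ((((hfr.setR (by decide)).setI (by decide)).setI (by decide)).setI
            (by decide)).setI (by decide)
        all_goals simp
      simp [ed, eB, hf.i50, hf.i30, hf.i31, hf.r30, ht1] at p1 p2 e32 e33 hT2
      refine ⟨⟨hf.trans e1, ?_, by rw [e32, e33]; omega⟩, by rw [e32, e33]; omega⟩
      rw [e32, e33]
      by_cases hB : s.heap.val (s₁.ireg 33) + s.rreg 30 ≤ s.rreg 24
      · obtain ⟨q1, q2⟩ := p1 hB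
        rw [q1, q2]
        exact k1 hB
      · obtain ⟨q1, q2⟩ := p2 (not_le.1 hB)
        rw [q1, q2]
        exact k2 hB
  · rintro s₁ T₁ ⟨hf, hm, hT⟩ hb
    have hb' : ¬ s₁.ireg 33 < s.ireg 50 := by
      simpa [hf.i50] using hb
    have hseg := hm.finish hs hx hx0 hd hb'
    have := hm.r_hi
    have := hm.t_hi
    have hle := hm.pushed.le_top
    apply h
    · exact (hf.frame.setI (by decide)).setI (by decide)
    · simpa using hle
    · exact hm.pushed.below
    · simpa [State.heap, hf.i50] using hseg
    · simp
      omega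
  · refine ⟨⟨?_, by simp, by simp, by simp, by simp, by simp⟩, ?_, ?_⟩
    · exact (((Frame.refl 30 s).setI (by decide)).setI (by decide)).setI (by decide)
    · simp
      exact Merge.begin hs
    · simp

end Emit

/-! ### Reducing the number of items: classes of large items and groups of small ones. -/

section Families

open Finset

variable {w : ℕ → ℝ} {l : ℕ} {c η : ℝ} {N : ℕ}

/-- The assumptions on the items `w 0 ≥ … ≥ w (l - 1) > 0`, the capacity `c`, the precision `η` and
the bound `N` for the lengths of lists. -/
structure Ctx (l : ℕ) (w : ℕ → ℝ) (c η : ℝ) (N : ℕ) : Prop where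
  c_pos : 0 < c
  η_pos : 0 < η
  η_le : η ≤ 1 / 8
  pos : ∀ k < l, 0 < w k
  anti : ∀ i j, i ≤ j → j < l → w j ≤ w i
  lt_N : 3 * c < (N + 1) * (η * c)

/-- The family `𝒢'` contains all unions of members of `𝒢` with subsets of `U`. -/
def Ext (𝒢 : Set (Finset ℕ)) (U : Finset ℕ) (𝒢' : Set (Finset ℕ)) : Prop :=
  ∀ X ∈ 𝒢, ∀ Z ⊆ U, X ∪ Z ∈ 𝒢'

theorem Ext.refl (𝒢 : Set (Finset ℕ)) : Ext 𝒢 ∅ 𝒢 := by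
  intro X hX Z hZ
  rwa [subset_empty.1 hZ, union_empty]

theorem Ext.trans {𝒢 𝒢' 𝒢'' : Set (Finset ℕ)} {U V : Finset ℕ} (h : Ext 𝒢 U 𝒢')
    (h' : Ext 𝒢' V 𝒢'') : Ext 𝒢 (U ∪ V) 𝒢'' := by
  intro X hX Z hZ
  have h1 := h' _ (h X hX (Z ∩ U) inter_subset_right) (Z ∩ V) inter_subset_right
  rwa [union_assoc, ← inter_union_distrib_left, inter_eq_left.2 hZ] at h1

theorem Ext.adjoin (𝒢 : Set (Finset ℕ)) (k : ℕ) : Ext 𝒢 {k} (adjoin 𝒢 k (k + 1)) := by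
  intro X hX Z hZ
  rcases subset_singleton_iff.1 hZ with rfl | rfl
  · rw [union_empty]; exact Or.inl hX
  · exact Or.inr ⟨X, hX, by simp⟩

theorem subset_of_mem_adjoin {𝒢 : Set (Finset ℕ)} {a b : ℕ} {V : Finset ℕ}
    (h : ∀ X ∈ 𝒢, X ⊆ V) {X : Finset ℕ} (hX : X ∈ adjoin 𝒢 a b) : X ⊆ V ∪ Ico a b := by
  rcases hX with hX | ⟨X, hX, rfl⟩
  · exact (h X hX).trans subset_union_left
  · exact union_subset_union_left (h X hX)

/-- The differences `Z \ I` and `I \ Z` are equally large, and `t` separates their weights. -/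
theorem sum_le_sum_of_threshold {Z I : Finset ℕ} {t : ℝ} (hc : Z.card = I.card)
    (hZ : ∀ z ∈ Z \ I, w z ≤ t) (hI : ∀ i ∈ I \ Z, t ≤ w i) : ∑ j ∈ Z, w j ≤ ∑ j ∈ I, w j := by
  have h1 := sum_le_card_nsmul (Z \ I) w t hZ
  have h2 := card_nsmul_le_sum (I \ Z) w t hI
  rw [card_sdiff_comm hc] at h1
  rw [← sum_inter_add_sum_sdiff Z I w, ← sum_inter_add_sum_sdiff I Z w, inter_comm I Z]
  linarith

theorem sum_le_sum_first (ha : ∀ i j, i ≤ j → j < l → w j ≤ w i) {j e : ℕ} (he : e ≤ l)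
    {Z : Finset ℕ} (hZ : Z ⊆ Ico j e) : ∑ k ∈ Z, w k ≤ ∑ k ∈ Ico j (j + Z.card), w k := by
  have hcard : Z.card ≤ e - j := by simpa using card_le_card hZ
  refine sum_le_sum_of_threshold (t := w (j + Z.card - 1)) (by simp) (fun z hz => ?_)
    fun i hi => ?_
  · have h1 := mem_Ico.1 (hZ (mem_sdiff.1 hz).1)
    have h2 := (mem_sdiff.1 hz).2
    rw [mem_Ico] at h2
    exact ha _ _ (by omega) (by omega)
  · have h1 := mem_Ico.1 (mem_sdiff.1 hi).1
    exact ha _ _ (by omega) (by omega)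

theorem sum_last_le_sum (ha : ∀ i j, i ≤ j → j < l → w j ≤ w i) {j e : ℕ} (he : e ≤ l)
    {Z : Finset ℕ} (hZ : Z ⊆ Ico j e) : ∑ k ∈ Ico (e - Z.card) e, w k ≤ ∑ k ∈ Z, w k := by
  have hcard : Z.card ≤ e - j := by simpa using card_le_card hZ
  refine sum_le_sum_of_threshold (t := w (e - Z.card)) (by simp; omega) (fun z hz => ?_)
    fun i hi => ?_
  · have h1 := mem_Ico.1 (mem_sdiff.1 hz).1
    exact ha _ _ (by omega) (by omega)
  · have h1 := mem_Ico.1 (hZ (mem_sdiff.1 hi).1)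
    have h2 := (mem_sdiff.1 hi).2
    have h3 := card_pos.2 ⟨i, (mem_sdiff.1 hi).1⟩
    rw [mem_Ico] at h2
    exact ha _ _ (by omega) (by omega)

theorem Ctx.sum_mono (hc : Ctx l w c η N) {X Y : Finset ℕ} (h : X ⊆ Y) (hY : ∀ k ∈ Y, k < l) :
    ∑ k ∈ X, w k ≤ ∑ k ∈ Y, w k :=
  sum_le_sum_of_subset_of_nonneg h fun k hk _ => (hc.pos k (hY k hk)).le

/-- A class of items of almost equal weight is represented by its first and its last items. -/
theorem Ctx.class_cover (hc : Ctx l w c η N) {j k m e : ℕ} (he : e ≤ l) (hjk : j ≤ k)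
    (hkm : k ≤ m) (hme : m ≤ e) (hw : ∀ i, j ≤ i → i < e → w j ≤ (1 + η) * w i)
    (hk : k = e ∨ 3 * c < ∑ i ∈ Ico j k, w i) (hm : k = m ∨ 3 * c < ∑ i ∈ Ico m e, w i)
    {Z : Finset ℕ} (hZ : Z ⊆ Ico j e) (hZc : ∑ i ∈ Z, w i ≤ 2 * c) :
    (∃ X ⊆ Ico j k ∪ Ico m e, ∑ i ∈ X, w i ≤ ∑ i ∈ Z, w i ∧
      ∑ i ∈ Z, w i ≤ (1 + η) * ∑ i ∈ X, w i) ∧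
    ∃ X ⊆ Ico j k ∪ Ico m e, ∑ i ∈ Z, w i ≤ ∑ i ∈ X, w i ∧
      ∑ i ∈ X, w i ≤ (1 + η) * ∑ i ∈ Z, w i := by
  have hη := hc.η_pos
  have hη' := hc.η_le
  have hcp := hc.c_pos
  have hcard : Z.card ≤ e - j := by simpa using card_le_card hZ
  -- Subsets of the class with equally many elements differ in weight by a factor of at most `1 +
  -- η`.
  have hbound : ∀ X Y : Finset ℕ, X ⊆ Ico j e → Y ⊆ Ico j e → X.card = Y.card →
      ∑ i ∈ X, w i ≤ (1 + η) * ∑ i ∈ Y, w i := by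
    intro X Y hX hY hXY
    have h1 : ∑ i ∈ X, w i ≤ X.card • w j := sum_le_card_nsmul _ _ _ fun i hi => by
      have := mem_Ico.1 (hX hi)
      exact hc.anti _ _ this.1 (by omega)
    have h2 : Y.card • w j ≤ ∑ i ∈ Y, (1 + η) * w i := card_nsmul_le_sum _ _ _ fun i hi => by
      have := mem_Ico.1 (hY hi)
      exact hw i this.1 this.2
    rw [mul_sum, ← hXY] at *
    exact h1.trans h2
  constructor
  · have hsub : Ico (e - Z.card) e ⊆ Ico j e := Ico_subset_Ico (by omega) le_rfl
    have hle := sum_last_le_sum hc.anti he hZ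
    refine ⟨Ico (e - Z.card) e, ?_, hle, hbound _ _ hZ hsub (by simp; omega)⟩
    rcases hm with rfl | hm
    · rwa [Ico_union_Ico_eq_Ico hjk (by omega)]
    -- The lightest `Z.card` items weigh at most `2 c`, so they cannot reach beyond a tail of weight
    -- more than `3 c`.
    · refine subset_trans (Ico_subset_Ico ?_ le_rfl) subset_union_right
      by_contra hlt
      have := hc.sum_mono (X := Ico m e) (Y := Ico (e - Z.card) e)
        (Ico_subset_Ico (by omega) le_rfl) fun k hk => by have := mem_Ico.1 hk; omega
      linarith
  · have hsub : Ico j (j + Z.card) ⊆ Ico j e := Ico_subset_Ico le_rfl (by omega)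
    have hle := hbound _ _ hsub hZ (by simp)
    refine ⟨Ico j (j + Z.card), ?_, sum_le_sum_first hc.anti he hZ, hle⟩
    refine subset_trans (Ico_subset_Ico le_rfl ?_) subset_union_left
    rcases hk with rfl | hk
    · omega
    -- The heaviest `Z.card` items weigh at most `(1 + η) · 2 c < 3 c`, so they stay within the
    -- head.
    · by_contra hlt
      have := hc.sum_mono (X := Ico j k) (Y := Ico j (j + Z.card))
        (Ico_subset_Ico le_rfl (by omega)) fun k hk => by have := mem_Ico.1 hk; omega
      nlinarith

/-- Every set of items in `[e₀, j)` of weight at most `2 c` is represented in the family `𝒢`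
within a factor of `1 + η`, from below and from above. -/
def Approx (w : ℕ → ℝ) (c η : ℝ) (e₀ j : ℕ) (𝒢 : Set (Finset ℕ)) : Prop :=
  ∀ Y ⊆ Ico e₀ j, ∑ i ∈ Y, w i ≤ 2 * c →
    (∃ X ∈ 𝒢, ∑ i ∈ X, w i ≤ ∑ i ∈ Y, w i ∧ ∑ i ∈ Y, w i ≤ (1 + η) * ∑ i ∈ X, w i) ∧
    ∃ X ∈ 𝒢, ∑ i ∈ Y, w i ≤ ∑ i ∈ X, w i ∧ ∑ i ∈ X, w i ≤ (1 + η) * ∑ i ∈ Y, w i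

theorem Approx.base (e₀ : ℕ) : Approx w c η e₀ e₀ {∅} := by
  intro Y hY _
  rw [Ico_self, subset_empty] at hY
  subst hY
  exact ⟨⟨∅, rfl, by simp⟩, ∅, rfl, by simp⟩

/-- The part of `Y` before `j` is represented in `𝒢`, the part in the class by `class_cover`.
Relative errors on disjoint parts combine to the same relative error, so nothing is lost from class
to class. -/
theorem Ctx.approx_class (hc : Ctx l w c η N) {e₀ j k m e : ℕ} (he : e ≤ l)
    (hjk : j ≤ k) (hkm : k ≤ m) (hme : m ≤ e) (hw : ∀ i, j ≤ i → i < e → w j ≤ (1 + η) * w i)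
    (hk : k = e ∨ 3 * c < ∑ i ∈ Ico j k, w i) (hm : k = m ∨ 3 * c < ∑ i ∈ Ico m e, w i)
    {𝒢 𝒢' : Set (Finset ℕ)} (hsub : ∀ X ∈ 𝒢, X ⊆ Ico e₀ j)
    (hext : Ext 𝒢 (Ico j k ∪ Ico m e) 𝒢') (ha : Approx w c η e₀ j 𝒢) :
    Approx w c η e₀ e 𝒢' := by
  intro Y hY hYc
  have hpos : ∀ X ⊆ Y, 0 ≤ ∑ i ∈ X, w i := fun X hX => sum_nonneg fun i hi => by
    have := mem_Ico.1 (hY (hX hi))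
    exact (hc.pos i (by omega)).le
  have hsplit : ∑ i ∈ Y, w i = ∑ i ∈ Y.filter (· < j), w i + ∑ i ∈ Y.filter (¬ · < j), w i :=
    (sum_filter_add_sum_filter_not Y _ w).symm
  have p1 := hpos _ (filter_subset (· < j) Y)
  have p2 := hpos _ (filter_subset (¬ · < j) Y)
  obtain ⟨⟨X₁, hX₁, a1, a2⟩, X₂, hX₂, a3, a4⟩ := ha (Y.filter (· < j)) (fun i hi => by
    have h1 := mem_filter.1 hi
    have h2 := mem_Ico.1 (hY h1.1)
    exact mem_Ico.2 ⟨h2.1, h1.2⟩) (by linarith)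
  obtain ⟨⟨Z₁, hZ₁, b1, b2⟩, Z₂, hZ₂, b3, b4⟩ := hc.class_cover he hjk hkm hme hw hk hm
    (Z := Y.filter (¬ · < j)) (fun i hi => by
    have h1 := mem_filter.1 hi
    have h2 := mem_Ico.1 (hY h1.1)
    exact mem_Ico.2 ⟨not_lt.1 h1.2, h2.2⟩) (by linarith)
  have hd : ∀ X ∈ 𝒢, ∀ Z ⊆ Ico j k ∪ Ico m e, ∑ i ∈ X ∪ Z, w i = ∑ i ∈ X, w i + ∑ i ∈ Z, w i := by
    intro X hX Z hZ
    refine sum_union (disjoint_left.2 fun i hi hi' => ?_)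
    have h1 := mem_Ico.1 (hsub X hX hi)
    rcases mem_union.1 (hZ hi') with h2 | h2 <;> have := mem_Ico.1 h2 <;> omega
  have e1 := hd X₁ hX₁ Z₁ hZ₁
  have e2 := hd X₂ hX₂ Z₂ hZ₂
  refine ⟨⟨_, hext X₁ hX₁ Z₁ hZ₁, ?_⟩, _, hext X₂ hX₂ Z₂ hZ₂, ?_⟩
  · rw [e1, hsplit]; constructor <;> linarith
  · rw [e2, hsplit]; constructor <;> linarith

/-- The approximation after grouping the small items. -/
def ApproxAdd (w : ℕ → ℝ) (c η : ℝ) (e₀ j : ℕ) (𝒢 : Set (Finset ℕ)) : Prop :=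
  ∀ Y ⊆ Ico e₀ j, ∑ i ∈ Y, w i ≤ 2 * c →
    (∃ X ∈ 𝒢, ∑ i ∈ X, w i ≤ ∑ i ∈ Y, w i ∧
      ∑ i ∈ Y, w i ≤ (1 + η) * ∑ i ∈ X, w i + 2 * (η * c)) ∧
    ∃ X ∈ 𝒢, ∑ i ∈ Y, w i ≤ ∑ i ∈ X, w i ∧ ∑ i ∈ X, w i ≤ (1 + η) * ∑ i ∈ Y, w i + 2 * (η * c)

/-- Every weight up to that of `[j₀, j)` is close to the weights of members `[j₀, e)`
of a set `E`. -/
def Grid (w : ℕ → ℝ) (d : ℝ) (j₀ j : ℕ) (E : Set ℕ) : Prop :=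
  ∀ y, 0 ≤ y → y ≤ ∑ i ∈ Ico j₀ j, w i → ∃ a ∈ E, ∃ b ∈ E, ∑ i ∈ Ico j₀ a, w i ≤ y ∧
    y ≤ ∑ i ∈ Ico j₀ b, w i ∧ ∑ i ∈ Ico j₀ b, w i ≤ ∑ i ∈ Ico j₀ a, w i + d

theorem Grid.step {d : ℝ} {j₀ j j' : ℕ} {E E' : Set ℕ} (h : Grid w d j₀ j E) (hE : E ⊆ E')
    (h0 : j₀ ≤ j) (hj : j ≤ j') (hd : ∑ i ∈ Ico j j', w i ≤ d) (hjE : j ∈ E) (hjE' : j' ∈ E') :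
    Grid w d j₀ j' E' := by
  intro y hy hy'
  rcases le_total y (∑ i ∈ Ico j₀ j, w i) with h1 | h1
  · obtain ⟨a, ha, b, hb, h2⟩ := h y hy h1
    exact ⟨a, hE ha, b, hE hb, h2⟩
  · refine ⟨j, hE hjE, j', hjE', h1, hy', ?_⟩
    rw [← sum_Ico_consecutive w h0 hj]
    linarith

/-- The small items of `Y` are replaced by a prefix `[j₀, e)` of nearly the same weight; the
additive error `2 η c` bounds the weight of a group. By `hend` the weight to be matched lies in the
range of the grid. -/
theorem Ctx.approx_small (hc : Ctx l w c η N) {e₀ j₀ j : ℕ} {E : Set ℕ} {𝒢 𝒢' : Set (Finset ℕ)}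
    (hEl : ∀ e ∈ E, e ≤ l) (hend : j = l ∨ 3 * c < ∑ i ∈ Ico j₀ j, w i)
    (hg : Grid w (2 * (η * c)) j₀ j E) (hsub : ∀ X ∈ 𝒢, X ⊆ Ico e₀ j₀)
    (hE : ∀ X ∈ 𝒢, ∀ e ∈ E, X ∪ Ico j₀ e ∈ 𝒢') (ha : Approx w c η e₀ j₀ 𝒢) :
    ApproxAdd w c η e₀ l 𝒢' := by
  intro Y hY hYc
  have hη := hc.η_pos
  have hcp := hc.c_pos
  have hpos : ∀ X ⊆ Y, 0 ≤ ∑ i ∈ X, w i := fun X hX => sum_nonneg fun i hi => by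
    have := mem_Ico.1 (hY (hX hi))
    exact (hc.pos i (by omega)).le
  have hsplit : ∑ i ∈ Y, w i = ∑ i ∈ Y.filter (· < j₀), w i + ∑ i ∈ Y.filter (¬ · < j₀), w i :=
    (sum_filter_add_sum_filter_not Y _ w).symm
  have p1 := hpos _ (filter_subset (· < j₀) Y)
  have p2 := hpos _ (filter_subset (¬ · < j₀) Y)
  obtain ⟨⟨X₁, hX₁, a1, a2⟩, X₂, hX₂, a3, a4⟩ := ha (Y.filter (· < j₀)) (fun i hi => by
    have h1 := mem_filter.1 hi
    have h2 := mem_Ico.1 (hY h1.1)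
    exact mem_Ico.2 ⟨h2.1, h1.2⟩) (by linarith)
  obtain ⟨a, haE, b, hbE, b1, b2, b3⟩ := hg (∑ i ∈ Y.filter (¬ · < j₀), w i) p2 (by
    rcases hend with rfl | hend
    · refine hc.sum_mono (fun i hi => ?_) fun i hi => (mem_Ico.1 hi).2
      have h1 := mem_filter.1 hi
      have h2 := mem_Ico.1 (hY h1.1)
      exact mem_Ico.2 ⟨not_lt.1 h1.2, h2.2⟩
    · linarith)
  have hd : ∀ X ∈ 𝒢, ∀ e, ∑ i ∈ X ∪ Ico j₀ e, w i = ∑ i ∈ X, w i + ∑ i ∈ Ico j₀ e, w i := by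
    intro X hX e
    refine sum_union (disjoint_left.2 fun i hi hi' => ?_)
    have h1 := mem_Ico.1 (hsub X hX hi)
    have := mem_Ico.1 hi'
    omega
  refine ⟨⟨_, hE X₁ hX₁ a haE, ?_⟩, _, hE X₂ hX₂ b hbE, ?_⟩
  · rw [hd X₁ hX₁, hsplit]
    refine ⟨by linarith, ?_⟩
    have : 0 ≤ ∑ i ∈ Ico j₀ a, w i := sum_nonneg fun i hi => by
      have := mem_Ico.1 hi
      have := hEl a haE
      exact (hc.pos i (by omega)).le
    nlinarith
  · rw [hd X₂ hX₂, hsplit]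
    refine ⟨by linarith, by nlinarith⟩

end Families

/-! ### The program for the large items. -/

section Large

open Finset

variable {w : ℕ → ℝ} {l : ℕ} {c η : ℝ} {N : ℕ} {H : Heap} {m : ℕ} {s : State} {T : ℕ}
  {Q : State → ℕ → Prop} {𝒢 : Set (Finset ℕ)}

/-- The registers and the heap during the dynamic program: the current list represents sets of
the family `𝒢`, and the first `m` nodes are those of `H`. -/
structure DP (l : ℕ) (w : ℕ → ℝ) (c η : ℝ) (H : Heap) (m : ℕ) (s : State)
    (𝒢 : Set (Finset ℕ)) : Prop where
  i1 : s.ireg 1 = l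
  r3 : s.rreg 3 = η
  arr : s.rarr 4 = w
  r23 : s.rreg 23 = η * c
  r24 : s.rreg 24 = 3 * c
  seg : Seg w s.heap (s.ireg 51) (s.ireg 50) (η * c) (3 * c) 𝒢
  le : m ≤ s.ireg 50
  below : H.Below s.heap m

theorem DP.setI (dp : DP l w c η H m s 𝒢) {x v : ℕ} (h1 : 1 ≠ x) (h50 : 50 ≠ x) (h51 : 51 ≠ x) :
    DP l w c η H m (s.setI x v) 𝒢 :=
  ⟨by simp [h1, dp.i1], dp.r3, dp.arr, dp.r23, dp.r24, by
    simp only [State.setI_ireg, h50, h51, if_false]; exact dp.seg, by simp [h50, dp.le], dp.below⟩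

theorem DP.setR (dp : DP l w c η H m s 𝒢) {x : ℕ} {v : ℝ} (h3 : 3 ≠ x) (h23 : 23 ≠ x)
    (h24 : 24 ≠ x) : DP l w c η H m (s.setR x v) 𝒢 :=
  ⟨dp.i1, by simp [h3, dp.r3], dp.arr, by simp [h23, dp.r23], by simp [h24, dp.r24], dp.seg,
    dp.le, dp.below⟩

/-- A bound for the number of steps for one item. -/
def emitCost (N : ℕ) : ℕ := 200 * (2 * N + 2) + 30

theorem DP.emit (hc : Ctx l w c η N) (dp : DP l w c η H m s 𝒢) {a b : ℕ} (ha : s.ireg 30 = a)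
    (hb : s.ireg 31 = b) (hab : a < b) (hbl : b ≤ l) (hx : s.rreg 30 = ∑ i ∈ Ico a b, w i)
    (hd : ∀ X ∈ 𝒢, Disjoint X (Ico a b))
    (h : ∀ s' T', Frame 30 s s' → DP l w c η H m s' (adjoin 𝒢 a b) → T' ≤ T + emitCost N →
      Q s' T') : WP emit s T Q := by
  subst ha hb
  have hlen := dp.seg.length_le hc.lt_N
  apply emit_spec (w := w) (𝒢 := 𝒢)
  · rw [dp.r23, dp.r24]; exact dp.seg
  · exact hab
  · exact hx
  · rw [hx]
    exact sum_nonneg fun i hi => (hc.pos i ((mem_Ico.1 hi).2.trans_le hbl)).le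
  · exact hd
  · intro s' T' hf hle hb hs hT
    rw [dp.r23, dp.r24] at hs
    refine h s' T' hf ⟨?_, ?_, ?_, ?_, ?_, hs, dp.le.trans hle, dp.below.trans hb dp.le⟩ ?_
    · rw [hf.ireg 1 (by decide), dp.i1]
    · rw [hf.rreg 3 (by decide), dp.r3]
    · rw [hf.rarr 4 (by decide), dp.arr]
    · rw [hf.rreg 23 (by decide), dp.r23]
    · rw [hf.rreg 24 (by decide), dp.r24]
    · rw [emitCost]; omega

/-- Add the single position in the register `x` as an item. -/
def emitOne (x : ℕ) : Prog :=
  .iset 30 (.reg x) ;; .iset 31 (.add (.reg x) (.lit 1)) ;; .rset 30 (.get 4 (.reg x)) ;; emit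

theorem DP.emitOne (hc : Ctx l w c η N) (dp : DP l w c η H m s 𝒢) {x k : ℕ} (hx : x < 30)
    (hk : s.ireg x = k) (hkl : k < l) (hd : ∀ X ∈ 𝒢, k ∉ X)
    (h : ∀ s' T', Frame 30 s s' → DP l w c η H m s' (adjoin 𝒢 k (k + 1)) →
      T' ≤ T + (emitCost N + 10) → Q s' T') : WP (emitOne x) s T Q := by
  have h30 : x ≠ 30 := by omega
  have h31 : x ≠ 31 := by omega
  simp only [MixedShop.emitOne, wp_seq, wp_iset, wp_rset]
  refine DP.emit hc (((dp.setI ?_ ?_ ?_).setI ?_ ?_ ?_).setR ?_ ?_ ?_) (a := k) (b := k + 1)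
    ?_ ?_ (by omega) (by omega) ?_ ?_ ?_
  any_goals decide
  any_goals simp [hk, dp.arr, h30, h31]
  · exact hd
  · intro s' T' hf dp' hT
    exact h s' T' ((((Frame.refl 30 s).setI (by decide)).setI (by decide)).setR
      (by decide) |>.trans hf) dp' (by omega)

/-- Add the first items of the class `[ireg 26, ireg 27)`, up to a total of `rreg 24`. -/
def classHead : Prog :=
  .iset 28 (.reg 26) ;; .rset 28 (.ofInt (.lit 0)) ;;
  .loop (.conj (.ilt (.reg 28) (.reg 27)) (.rle (.reg 28) (.reg 24)))
    (emitOne 28 ;; .rset 28 (.add (.reg 28) (.get 4 (.reg 28))) ;; .inc 28)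

/-- Add the last items of the class, above `ireg 28`, up to a total of `rreg 24`. -/
def classTail : Prog :=
  .iset 29 (.reg 27) ;; .rset 29 (.ofInt (.lit 0)) ;;
  .loop (.conj (.ilt (.reg 28) (.reg 29)) (.rle (.reg 29) (.reg 24)))
    (.iset 29 (.sub (.reg 29) (.lit 1)) ;; emitOne 29 ;;
      .rset 29 (.add (.reg 29) (.get 4 (.reg 29))))

/-- Few items of weight more than half the precision have a total of at most `3 c`. -/
theorem Ctx.count_le (hc : Ctx l w c η N) {a b : ℕ} (hw : ∀ i ∈ Ico a b, η * c < 2 * w i)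
    (hs : ∑ i ∈ Ico a b, w i ≤ 3 * c) : b - a < 2 * N + 2 := by
  have h1 : (b - a) • (η * c / 2) ≤ ∑ i ∈ Ico a b, w i := by
    have := card_nsmul_le_sum (Ico a b) w (η * c / 2) fun i hi => by linarith [hw i hi]
    simpa using this
  rw [nsmul_eq_mul] at h1
  have h2 := hc.lt_N
  have h3 : 0 < η * c := mul_pos hc.η_pos hc.c_pos
  by_contra hlt
  have h4 : (2 * N + 2 : ℝ) ≤ ((b - a : ℕ) : ℝ) := by exact_mod_cast not_lt.1 hlt
  nlinarith

theorem classHead_spec (hc : Ctx l w c η N) (dp : DP l w c η H m s 𝒢) {e₀ j e : ℕ}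
    (hj : s.ireg 26 = j) (he : s.ireg 27 = e) (hje : j ≤ e) (hel : e ≤ l)
    (h0 : e₀ ≤ j) (hw : ∀ i ∈ Ico j e, η * c < 2 * w i) (hsub : ∀ X ∈ 𝒢, X ⊆ Ico e₀ j)
    (h : ∀ s' T' 𝒢' g, Frame 28 s s' → DP l w c η H m s' 𝒢' → s'.ireg 28 = j + g → j + g ≤ e →
      g ≤ 2 * N + 2 → (j + g = e ∨ 3 * c < ∑ i ∈ Ico j (j + g), w i) →
      Ext 𝒢 (Ico j (j + g)) 𝒢' → (∀ X ∈ 𝒢', X ⊆ Ico e₀ (j + g)) →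
      T' ≤ T + (g * (emitCost N + 40) + 20) → Q s' T') : WP classHead s T Q := by
  simp only [classHead, wp_seq, wp_iset, wp_rset]
  apply WP.loop (Inv := fun s' T' => Frame 28 s s' ∧ ∃ 𝒢' g, DP l w c η H m s' 𝒢' ∧
      s'.ireg 28 = j + g ∧ j + g ≤ e ∧ g ≤ 2 * N + 2 ∧ s'.rreg 28 = ∑ i ∈ Ico j (j + g), w i ∧
      Ext 𝒢 (Ico j (j + g)) 𝒢' ∧ (∀ X ∈ 𝒢', X ⊆ Ico e₀ (j + g)) ∧
      T' ≤ T + (g * (emitCost N + 40) + 5)) (m := fun s' => e - s'.ireg 28)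
  · rintro s₁ T₁ ⟨hf, 𝒢', g, dp₁, hk, hge, hgN, htot, hext, hsub', hT⟩ hb
    have e27 : s₁.ireg 27 = e := by rw [hf.ireg 27 (by decide), he]
    simp [hk, e27, htot, dp₁.r24] at hb
    simp only [wp_seq, wp_rset, Prog.inc, wp_iset]
    refine dp₁.emitOne hc (by decide) hk (by omega) (fun X hX hk' => ?_) ?_
    · have := mem_Ico.1 (hsub' X hX hk'); omega
    · intro s₂ T₂ hf₂ dp₂ hT₂
      have e28 : s₂.ireg 28 = j + g := by rw [hf₂.ireg 28 (by decide), hk]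
      have f28 := hf₂.rreg 28 (by decide)
      refine ⟨⟨((hf.trans (hf₂.mono (by decide))).setR (by decide)).setI (by decide),
        adjoin 𝒢' (j + g) (j + g + 1), g + 1, ?_, ?_, by omega, ?_, ?_, ?_, ?_, ?_⟩, ?_⟩
      · exact (dp₂.setR (by decide) (by decide) (by decide)).setI (by decide) (by decide)
          (by decide)
      · simp [e28]; omega
      -- An item is added only while the earlier ones weigh at most `3 c`, hence while there are
      -- fewer than `2 N + 2` of them.
      · have := hc.count_le (a := j) (b := j + g) (fun i hi => hw i (by
          rw [mem_Ico] at *; omega)) hb.2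
        omega
      · simp [e28, dp₂.arr, f28, htot]
        rw [← add_assoc, sum_Ico_succ_top (by omega)]
      · have := hext.trans (Ext.adjoin 𝒢' (j + g))
        rwa [← insert_eq_of_mem (mem_singleton_self (j + g)), pair_eq_singleton,
          ← Nat.Ico_succ_singleton, Ico_union_Ico_eq_Ico (by omega) (by omega)] at this
      · intro X hX
        have := subset_of_mem_adjoin hsub' hX
        rwa [Ico_union_Ico_eq_Ico (by omega) (by omega)] at this
      · simp at hT₂ ⊢
        rw [add_mul]
        omega
      · simp [e28, hk]
        omega
  · rintro s₁ T₁ ⟨hf, 𝒢', g, dp₁, hk, hge, hgN, htot, hext, hsub', hT⟩ hb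
    have e27 : s₁.ireg 27 = e := by rw [hf.ireg 27 (by decide), he]
    simp [hk, e27, htot, dp₁.r24] at hb
    refine h s₁ _ 𝒢' g hf dp₁ hk hge hgN ?_ hext hsub' (by simp; omega)
    rcases Nat.lt_or_ge (j + g) e with h1 | h1
    · exact Or.inr (hb h1)
    · exact Or.inl (by omega)
  · refine ⟨((Frame.refl 28 s).setI (by decide)).setR (by decide), 𝒢, 0, ?_, by simp [hj],
      by omega, by omega, by simp, ?_, by simpa using hsub, by simp⟩
    · exact (dp.setI (by decide) (by decide) (by decide)).setR (by decide) (by decide) (by decide)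
    · simpa using Ext.refl 𝒢

theorem classTail_spec (hc : Ctx l w c η N) (dp : DP l w c η H m s 𝒢) {k e : ℕ} {V : Finset ℕ}
    (hk : s.ireg 28 = k) (he : s.ireg 27 = e) (hke : k ≤ e) (hel : e ≤ l)
    (hV : ∀ i ∈ V, i < k) (hw : ∀ i ∈ Ico k e, η * c < 2 * w i) (hsub : ∀ X ∈ 𝒢, X ⊆ V)
    (h : ∀ s' T' 𝒢' g, Frame 28 s s' → DP l w c η H m s' 𝒢' → k ≤ e - g → g ≤ e →
      g ≤ 2 * N + 2 → (k = e - g ∨ 3 * c < ∑ i ∈ Ico (e - g) e, w i) →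
      Ext 𝒢 (Ico (e - g) e) 𝒢' → (∀ X ∈ 𝒢', X ⊆ V ∪ Ico (e - g) e) →
      T' ≤ T + (g * (emitCost N + 40) + 20) → Q s' T') : WP classTail s T Q := by
  simp only [classTail, wp_seq, wp_iset, wp_rset]
  apply WP.loop (Inv := fun s' T' => Frame 29 s s' ∧ ∃ 𝒢' g, DP l w c η H m s' 𝒢' ∧
      s'.ireg 29 = e - g ∧ k ≤ e - g ∧ g ≤ e ∧ g ≤ 2 * N + 2 ∧
      s'.rreg 29 = ∑ i ∈ Ico (e - g) e, w i ∧
      Ext 𝒢 (Ico (e - g) e) 𝒢' ∧ (∀ X ∈ 𝒢', X ⊆ V ∪ Ico (e - g) e) ∧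
      T' ≤ T + (g * (emitCost N + 40) + 5)) (m := fun s' => s'.ireg 29)
  · rintro s₁ T₁ ⟨hf, 𝒢', g, dp₁, hm, hge, hge', hgN, htot, hext, hsub', hT⟩ hb
    have e28 : s₁.ireg 28 = k := by rw [hf.ireg 28 (by decide), hk]
    simp [hm, e28, htot, dp₁.r24] at hb
    have hpred : e - g - 1 = e - (g + 1) := by omega
    have hsing : Ico (e - (g + 1)) e = Ico (e - g) e ∪ {e - (g + 1)} := by
      ext i; simp only [mem_union, mem_Ico, mem_singleton]; omega
    have hsing' : Ico (e - (g + 1)) (e - (g + 1) + 1) = {e - (g + 1)} := by simp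
    simp only [wp_seq, wp_rset, wp_iset]
    refine (dp₁.setI (x := 29) (by decide) (by decide) (by decide)).emitOne hc (x := 29)
      (k := e - (g + 1)) (by decide) ?_ (by omega) (fun X hX hk' => ?_) ?_
    · simp [hm, hpred]
    · rcases mem_union.1 (hsub' X hX hk') with h1 | h1
      · have := hV _ h1; omega
      · have := mem_Ico.1 h1; omega
    · intro s₂ T₂ hf₂ dp₂ hT₂
      have e29 : s₂.ireg 29 = e - (g + 1) := by
        rw [hf₂.ireg 29 (by decide)]; simp [hm, hpred]
      have f29 := hf₂.rreg 29 (by decide)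
      refine ⟨⟨((hf.setI (x := 29) (by decide)).trans (hf₂.mono (by decide))).setR (by decide),
        adjoin 𝒢' (e - (g + 1)) (e - (g + 1) + 1), g + 1, ?_, ?_, by omega, by omega, ?_, ?_, ?_,
        ?_, ?_⟩, ?_⟩
      · exact dp₂.setR (by decide) (by decide) (by decide)
      · simp [e29]
      · have := hc.count_le (a := e - g) (b := e) (fun i hi => hw i (by
          rw [mem_Ico] at *; omega)) hb.2
        omega
      · rw [hsing, sum_union (by simp; omega)]
        simp [e29, dp₂.arr, f29, htot]
      · rw [hsing]
        exact hext.trans (Ext.adjoin 𝒢' _)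
      · intro X hX
        have := subset_of_mem_adjoin hsub' hX
        rwa [hsing', union_assoc, ← hsing] at this
      · simp at hT₂ ⊢
        rw [add_mul]
        omega
      · simp [e29, hm]
        omega
  · rintro s₁ T₁ ⟨hf, 𝒢', g, dp₁, hm, hge, hge', hgN, htot, hext, hsub', hT⟩ hb
    have e28 : s₁.ireg 28 = k := by rw [hf.ireg 28 (by decide), hk]
    simp [hm, e28, htot, dp₁.r24] at hb
    refine h s₁ _ 𝒢' g (hf.mono (by decide)) dp₁ hge hge' hgN ?_ hext hsub' (by simp; omega)
    rcases Nat.lt_or_ge k (e - g) with h1 | h1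
    · exact Or.inr (hb (by omega))
    · exact Or.inl (by omega)
  · refine ⟨((Frame.refl 29 s).setI (by decide)).setR (by decide), 𝒢, 0, ?_, by simp [he],
      by omega, by omega, by omega, by simp, ?_, by simpa using hsub, by simp⟩
    · exact (dp.setI (by decide) (by decide) (by decide)).setR (by decide) (by decide) (by decide)
    · simpa using Ext.refl 𝒢

/-- Find the end `ireg 27` of the class of items that starts at `ireg 26`. -/
def classEnd : Prog :=
  .rset 27 (.get 4 (.reg 26)) ;; .iset 27 (.add (.reg 26) (.lit 1)) ;;
  .loop (.conj (.ilt (.reg 27) (.reg 1))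
      (.rle (.reg 27) (.mul (.add (.ofInt (.lit 1)) (.reg 3)) (.get 4 (.reg 27))))) (.inc 27)

theorem classEnd_spec (hc : Ctx l w c η N) (dp : DP l w c η H m s 𝒢) {j : ℕ}
    (hj : s.ireg 26 = j) (hjl : j < l)
    (h : ∀ s' T' e, Frame 27 s s' → DP l w c η H m s' 𝒢 → s'.ireg 27 = e → j < e → e ≤ l →
      (∀ i, j ≤ i → i < e → w j ≤ (1 + η) * w i) → (e < l → (1 + η) * w e < w j) →
      T' ≤ T + 30 * (e - j) → Q s' T') : WP classEnd s T Q := by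
  simp only [classEnd, wp_seq, wp_iset, wp_rset]
  apply WP.loop (Inv := fun s' T' => Frame 27 s s' ∧ DP l w c η H m s' 𝒢 ∧ s'.rreg 27 = w j ∧
      j < s'.ireg 27 ∧ s'.ireg 27 ≤ l ∧
      (∀ i, j ≤ i → i < s'.ireg 27 → w j ≤ (1 + η) * w i) ∧
      T' + 15 ≤ T + 30 * (s'.ireg 27 - j)) (m := fun s' => l - s'.ireg 27)
  · rintro s₁ T₁ ⟨hf, dp₁, hr, h1, h2, h3, hT⟩ hb
    simp [dp₁.i1, hr, dp₁.arr, dp₁.r3] at hb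
    simp only [Prog.inc, wp_iset]
    refine ⟨⟨hf.setI (by decide), dp₁.setI (by decide) (by decide) (by decide), ?_, ?_, ?_, ?_,
      ?_⟩, ?_⟩
    · simpa using hr
    · simp; omega
    · simp; omega
    · simp
      intro i hi hi'
      rcases hi'.lt_or_eq with h4 | rfl
      · exact h3 i hi h4
      · exact hb.2
    · simp; omega
    · simp; omega
  · rintro s₁ T₁ ⟨hf, dp₁, hr, h1, h2, h3, hT⟩ hb
    simp [dp₁.i1, hr, dp₁.arr, dp₁.r3] at hb
    exact h s₁ _ _ hf dp₁ rfl h1 h2 h3 hb (by simp; omega)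
  · refine ⟨((Frame.refl 27 s).setR (by decide)).setI (by decide), ?_, ?_, ?_, ?_, ?_, ?_⟩
    · exact (dp.setR (by decide) (by decide) (by decide)).setI (by decide) (by decide) (by decide)
    · simp [dp.arr, hj]
    · simp [hj]
    · simp [hj]; omega
    · simp [hj]
      intro i hi hi'
      obtain rfl : i = j := by omega
      nlinarith [hc.pos i hjl, hc.η_pos]
    · simp [hj]

/-- Treat the items of weight more than `rreg 23`, class by class. -/
def largeItems : Prog :=
  .loop (.conj (.ilt (.reg 26) (.reg 1)) (.rlt (.reg 23) (.get 4 (.reg 26))))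
    (classEnd ;; classHead ;; classTail ;; .iset 26 (.reg 27))

/-- Passing a class lowers the leading weight by a factor of more than `1 + η`. It starts at no more
than `c`, and the loop runs only while it exceeds `η c`, so there are at most `K` classes; each
contributes at most `2 N + 2` items from either end. -/
theorem largeItems_spec (hc : Ctx l w c η N) {e₀ K : ℕ} (dp : DP l w c η H m s {∅})
    (hj : s.ireg 26 = e₀) (h0l : e₀ ≤ l) (hwc : e₀ < l → w e₀ ≤ c)
    (hK : c ≤ (1 + η) ^ K * (η * c))
    (h : ∀ s' T' 𝒢 j g, Frame 26 s s' → DP l w c η H m s' 𝒢 → s'.ireg 26 = j → e₀ ≤ j → j ≤ l →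
      (j < l → w j ≤ η * c) → Approx w c η e₀ j 𝒢 → (∀ X ∈ 𝒢, X ⊆ Ico e₀ j) →
      g ≤ j - e₀ → g ≤ K * (4 * N + 4) →
      T' ≤ T + ((j - e₀) * 200 + g * (emitCost N + 40) + 20) → Q s' T') :
    WP largeItems s T Q := by
  have hη := hc.η_pos
  have hδ : 0 < η * c := mul_pos hc.η_pos hc.c_pos
  unfold largeItems
  apply WP.loop (Inv := fun s' T' => Frame 26 s s' ∧ ∃ 𝒢 j g r, DP l w c η H m s' 𝒢 ∧
      s'.ireg 26 = j ∧ e₀ ≤ j ∧ j ≤ l ∧ (j < l → (1 + η) ^ r * w j ≤ c) ∧ r ≤ K ∧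
      Approx w c η e₀ j 𝒢 ∧ (∀ X ∈ 𝒢, X ⊆ Ico e₀ j) ∧ g ≤ j - e₀ ∧ g ≤ r * (4 * N + 4) ∧
      T' ≤ T + ((j - e₀) * 200 + g * (emitCost N + 40))) (m := fun s' => l - s'.ireg 26)
  · rintro s₁ T₁ ⟨hf, 𝒢, j, g, r, dp₁, hj₁, hj0, hjl, hr, hrK, happ, hsub, hg, hgr, hT⟩ hb
    simp [dp₁.i1, hj₁, dp₁.r23, dp₁.arr] at hb
    obtain ⟨hjl', hδj⟩ := hb
    have hrj := hr hjl'
    simp only [wp_seq, wp_iset]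
    refine classEnd_spec hc dp₁ hj₁ hjl' ?_
    intro s₂ T₂ e hf₂ dp₂ he hje hel hcls hnext hT₂
    -- Each item of the class weighs at least `8/9` of the first, which exceeds `η c`; thus
    -- `count_le` applies.
    have hwi : ∀ i ∈ Ico j e, η * c < 2 * w i := by
      intro i hi
      rw [mem_Ico] at hi
      have h1 := hcls i hi.1 hi.2
      have h2 := hc.pos i (by omega)
      have h3 := hc.η_le
      nlinarith
    have e26 : s₂.ireg 26 = j := by rw [hf₂.ireg 26 (by decide), hj₁]
    refine classHead_spec hc dp₂ e26 he hje.le hel hj0 hwi hsub ?_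
    intro s₃ T₃ 𝒢₃ g₃ hf₃ dp₃ hk₃ hge₃ hgN₃ hfull₃ hext₃ hsub₃ hT₃
    have e27 : s₃.ireg 27 = e := by rw [hf₃.ireg 27 (by decide), he]
    refine classTail_spec hc dp₃ (V := Ico e₀ (j + g₃)) hk₃ e27 hge₃ hel
      (fun i hi => (mem_Ico.1 hi).2) (fun i hi => hwi i (by rw [mem_Ico] at *; omega)) hsub₃ ?_
    intro s₄ T₄ 𝒢₄ g₄ hf₄ dp₄ hk₄ hge₄ hgN₄ hfull₄ hext₄ hsub₄ hT₄
    have e27' : s₄.ireg 27 = e := by rw [hf₄.ireg 27 (by decide), e27]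
    have hrK' : r < K := by
      by_contra hcon
      have h1 : (1 + η) ^ K ≤ (1 + η) ^ r := pow_le_pow_right₀ (by linarith) (not_lt.1 hcon)
      have h2 : 0 < (1 + η) ^ r := by positivity
      nlinarith
    refine ⟨⟨((((hf.trans (hf₂.mono (by decide))).trans (hf₃.mono (by decide))).trans
      (hf₄.mono (by decide))).setI (by decide)), 𝒢₄, e, g + g₃ + g₄, r + 1,
      dp₄.setI (by decide) (by decide) (by decide), by simp [e27'], by omega, hel, ?_, hrK', ?_,
      ?_, by omega, ?_, ?_⟩, ?_⟩
    · intro hel'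
      have h1 := hnext hel'
      have h2 : 0 < (1 + η) ^ r := by positivity
      rw [pow_succ]
      nlinarith
    · exact hc.approx_class hel (by omega) hk₄ (by omega) hcls hfull₃ hfull₄ hsub
        (hext₃.trans hext₄) happ
    · intro X hX i hi
      rcases mem_union.1 (hsub₄ X hX hi) with h1 | h1 <;> rw [mem_Ico] at * <;> omega
    · rw [add_mul]; omega
    · simp at hT₂ hT₃ hT₄ ⊢
      rw [add_mul, add_mul]
      omega
    · simp [e27', hj₁]; omega
  · rintro s₁ T₁ ⟨hf, 𝒢, j, g, r, dp₁, hj₁, hj0, hjl, hr, hrK, happ, hsub, hg, hgr, hT⟩ hb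
    simp [dp₁.i1, hj₁, dp₁.r23, dp₁.arr] at hb
    exact h s₁ _ 𝒢 j g hf dp₁ hj₁ hj0 hjl hb happ hsub hg
      (hgr.trans (Nat.mul_le_mul_right _ hrK)) (by simp; omega)
  · exact ⟨Frame.refl 26 s, {∅}, e₀, 0, 0, dp, hj, le_rfl, h0l, by simpa using hwc,
      Nat.zero_le _, Approx.base e₀, by simp, by simp, by simp, by simp⟩

end Large

/-! ### The program for the small items, and the whole dynamic program. -/

section Small

open Finset

variable {w : ℕ → ℝ} {l : ℕ} {c η : ℝ} {N : ℕ} {H : Heap} {m : ℕ} {s : State} {T : ℕ}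
  {Q : State → ℕ → Prop} {𝒢 : Set (Finset ℕ)}

/-- Find the end `ireg 27` of the group that starts at `ireg 26`: its weight
`rreg 27` exceeds the precision, or there is no further item. -/
def groupEnd : Prog :=
  .iset 27 (.reg 26) ;; .rset 27 (.ofInt (.lit 0)) ;;
  .loop (.conj (.ilt (.reg 27) (.reg 1)) (.rle (.reg 27) (.reg 23)))
    (.rset 27 (.add (.reg 27) (.get 4 (.reg 27))) ;; .inc 27)

/-- The last item of a group joins while the group weighs at most `η c`, and itself weighs at most
`η c`; hence the bound `2 η c`. -/
theorem groupEnd_spec (hc : Ctx l w c η N) (dp : DP l w c η H m s 𝒢) {j : ℕ}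
    (hj : s.ireg 26 = j) (hjl : j < l) (hw : ∀ i, j ≤ i → i < l → w i ≤ η * c)
    (h : ∀ s' T' e, Frame 27 s s' → DP l w c η H m s' 𝒢 → s'.ireg 27 = e → j < e → e ≤ l →
      s'.rreg 27 = ∑ i ∈ Ico j e, w i → ∑ i ∈ Ico j e, w i ≤ 2 * (η * c) →
      (e < l → η * c < ∑ i ∈ Ico j e, w i) →
      T' ≤ T + (30 * (e - j) + 20) → Q s' T') : WP groupEnd s T Q := by
  have hδ : 0 < η * c := mul_pos hc.η_pos hc.c_pos
  simp only [groupEnd, wp_seq, wp_iset, wp_rset]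
  apply WP.loop (Inv := fun s' T' => Frame 27 s s' ∧ DP l w c η H m s' 𝒢 ∧ ∃ e, s'.ireg 27 = e ∧
      s'.rreg 27 = ∑ i ∈ Ico j e, w i ∧ j ≤ e ∧ e ≤ l ∧ ∑ i ∈ Ico j e, w i ≤ 2 * (η * c) ∧
      T' ≤ T + (30 * (e - j) + 5)) (m := fun s' => l - s'.ireg 27)
  · rintro s₁ T₁ ⟨hf, dp₁, e, he, hr, h1, h2, h3, hT⟩ hb
    simp [dp₁.i1, he, dp₁.r23, hr] at hb
    simp only [Prog.inc, wp_iset, wp_seq, wp_rset]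
    have hsum := sum_Ico_succ_top h1 w
    refine ⟨⟨(hf.setR (by decide)).setI (by decide), (dp₁.setR (by decide) (by decide)
      (by decide)).setI (by decide) (by decide) (by decide), e + 1, ?_, ?_, by omega, by omega,
      ?_, ?_⟩, ?_⟩
    · simp [he]
    · simp [hr, he, dp₁.arr, hsum]
    · have := hw e h1 hb.1
      linarith
    · simp; omega
    · simp [he]; omega
  · rintro s₁ T₁ ⟨hf, dp₁, e, he, hr, h1, h2, h3, hT⟩ hb
    simp [dp₁.i1, he, dp₁.r23, hr] at hb
    refine h s₁ _ e hf dp₁ he ?_ h2 hr h3 hb (by simp; omega)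
    rcases h1.eq_or_lt with rfl | h1
    · have := hb hjl
      rw [Ico_self, sum_empty] at this
      linarith
    · exact h1
  · refine ⟨((Frame.refl 27 s).setI (by decide)).setR (by decide), (dp.setI (by decide)
      (by decide) (by decide)).setR (by decide) (by decide) (by decide), j, by simp [hj], by simp,
      le_rfl, hjl.le, ?_, by simp⟩
    simp [hδ.le]

/-- Treat the small items: consecutive groups of them are added as single items, up
to a total of `rreg 24`. -/
def smallItems : Prog :=
  .rset 26 (.ofInt (.lit 0)) ;;
  .loop (.conj (.ilt (.reg 26) (.reg 1)) (.rle (.reg 26) (.reg 24)))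
    (groupEnd ;; .iset 30 (.reg 26) ;; .iset 31 (.reg 27) ;; .rset 30 (.reg 27) ;; emit ;;
      .rset 26 (.add (.reg 26) (.reg 27)) ;; .iset 26 (.reg 27))

/-- All groups except possibly the last weigh more than `η c`, and a group is started only while the
total is at most `3 c`; so there are at most `N + 1` of them. The set `E` in the invariant collects
`j₀` and the ends of the groups. -/
theorem smallItems_spec (hc : Ctx l w c η N) {e₀ j₀ : ℕ} (dp : DP l w c η H m s 𝒢)
    (hj : s.ireg 26 = j₀) (h0 : e₀ ≤ j₀) (h0l : j₀ ≤ l)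
    (hw : ∀ i, j₀ ≤ i → i < l → w i ≤ η * c) (happ : Approx w c η e₀ j₀ 𝒢)
    (hsub : ∀ X ∈ 𝒢, X ⊆ Ico e₀ j₀)
    (h : ∀ s' T' 𝒢' g, Frame 26 s s' → DP l w c η H m s' 𝒢' → ApproxAdd w c η e₀ l 𝒢' →
      (∀ X ∈ 𝒢', X ⊆ Ico e₀ l) → g ≤ l - j₀ → g ≤ N + 1 →
      T' ≤ T + ((l - j₀) * 200 + g * (emitCost N + 40) + 40) → Q s' T') :
    WP smallItems s T Q := by
  have hδ : 0 < η * c := mul_pos hc.η_pos hc.c_pos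
  simp only [smallItems, wp_seq, wp_rset]
  apply WP.loop (Inv := fun s' T' => Frame 26 s s' ∧ ∃ (𝒢' : Set (Finset ℕ)) (j g : ℕ) (E : Set ℕ), DP l w c η H m s' 𝒢' ∧
      s'.ireg 26 = j ∧ s'.rreg 26 = ∑ i ∈ Ico j₀ j, w i ∧ j₀ ≤ j ∧ j ≤ l ∧
      (j < l → (g : ℝ) * (η * c) ≤ ∑ i ∈ Ico j₀ j, w i) ∧ g ≤ N + 1 ∧ g ≤ j - j₀ ∧
      Grid w (2 * (η * c)) j₀ j E ∧ j ∈ E ∧ (∀ e ∈ E, e ≤ l) ∧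
      (∀ X ∈ 𝒢, ∀ e ∈ E, X ∪ Ico j₀ e ∈ 𝒢') ∧ (∀ X ∈ 𝒢', X ⊆ Ico e₀ j) ∧
      T' ≤ T + ((j - j₀) * 200 + g * (emitCost N + 40) + 20)) (m := fun s' => l - s'.ireg 26)
  · rintro s₁ T₁ ⟨hf, 𝒢', j, g, E, dp₁, hj₁, htot, hj0, hjl, hgs, hgN, hgj, hgrid, hjE, hEl, hE,
      hsub', hT⟩ hb
    simp [dp₁.i1, hj₁, dp₁.r24, htot] at hb
    have hgN' : g < N + 1 := by
      have h1 := hgs hb.1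
      have h2 := hc.lt_N
      have h3 : (g : ℝ) * (η * c) < (N + 1) * (η * c) := by linarith
      have h4 := lt_of_mul_lt_mul_right h3 hδ.le
      exact_mod_cast h4
    simp only [wp_seq, wp_iset, wp_rset]
    refine groupEnd_spec hc dp₁ hj₁ hb.1 (fun i hi hi' => hw i (by omega) hi') ?_
    intro s₂ T₂ e hf₂ dp₂ he hje hel hx hx2 hxl hT₂
    have e26 : s₂.ireg 26 = j := by rw [hf₂.ireg 26 (by decide), hj₁]
    have f26 : s₂.rreg 26 = ∑ i ∈ Ico j₀ j, w i := by rw [hf₂.rreg 26 (by decide), htot]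
    refine DP.emit hc (((dp₂.setI ?_ ?_ ?_).setI ?_ ?_ ?_).setR ?_ ?_ ?_) (a := j) (b := e)
      ?_ ?_ hje hel ?_ ?_ ?_
    any_goals decide
    · simp [e26]
    · simp [he]
    · simp [hx]
    · intro X hX
      exact disjoint_left.2 fun i hi hi' => by
        have := mem_Ico.1 (hsub' X hX hi)
        have := mem_Ico.1 hi'
        omega
    · intro s₃ T₃ hf₃ dp₃ hT₃
      have g26 := hf₃.rreg 26 (by decide)
      have g27 := hf₃.rreg 27 (by decide)
      have k27 := hf₃.ireg 27 (by decide)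
      simp [f26] at g26
      simp [hx] at g27
      simp [he] at k27
      have hsum := sum_Ico_consecutive w hj0 hje.le
      refine ⟨⟨?_, adjoin 𝒢' j e, e, g + 1, insert e E, ?_, by simp [k27], ?_, by omega, hel,
        ?_, hgN', by omega, ?_, by simp, ?_, ?_, ?_, ?_⟩, ?_⟩
      · have hf₂' : Frame 26 s₁ s₂ := hf₂.mono (by decide)
        have hf₃' := hf₃.mono (show 26 ≤ 30 by decide)
        exact (((hf.trans (((hf₂'.setI (by decide)).setI (by decide)).setR (by decide))).trans
          hf₃').setR (by decide)).setI (by decide)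
      · exact (dp₃.setR (by decide) (by decide) (by decide)).setI (by decide) (by decide)
          (by decide)
      · simp [g26, g27, hsum]
      · intro h1
        have h2 := hxl h1
        have h3 := hgs hb.1
        rw [← hsum]
        push_cast
        linarith
      · exact hgrid.step (fun a ha => Or.inr ha) hj0 hje.le hx2 hjE (Or.inl rfl)
      · rintro a (rfl | ha)
        · exact hel
        · exact hEl a ha
      · rintro X hX a (rfl | ha)
        -- The prefix that ends at `e` is the prefix that ends at `j` with the new group adjoined.
        · refine Or.inr ⟨X ∪ Ico j₀ j, hE X hX j hjE, ?_⟩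
          simp only [union_assoc, Ico_union_Ico_eq_Ico hj0 hje.le]
        · exact Or.inl (hE X hX a ha)
      · intro X hX
        have := subset_of_mem_adjoin hsub' hX
        rwa [Ico_union_Ico_eq_Ico (by omega) hje.le] at this
      · simp at hT₂ hT₃ ⊢
        rw [add_mul]
        omega
      · simp [k27, hj₁]; omega
  · rintro s₁ T₁ ⟨hf, 𝒢', j, g, E, dp₁, hj₁, htot, hj0, hjl, hgs, hgN, hgj, hgrid, hjE, hEl, hE,
      hsub', hT⟩ hb
    simp [dp₁.i1, hj₁, dp₁.r24, htot] at hb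
    refine h s₁ _ 𝒢' g hf dp₁ (hc.approx_small hEl ?_ hgrid hsub hE happ)
      (fun X hX => (hsub' X hX).trans (Ico_subset_Ico le_rfl hjl)) (by omega) hgN
      (by simp; omega)
    rcases Nat.lt_or_ge j l with h1 | h1
    · exact Or.inr (hb h1)
    · exact Or.inl (by omega)
  · refine ⟨(Frame.refl 26 s).setR (by decide), 𝒢, j₀, 0, {j₀}, dp.setR (by decide)
      (by decide) (by decide), by simp [hj], by simp, le_rfl, h0l, by simp, by omega, by omega,
      ?_, by simp, by simp [h0l], ?_, hsub, by simp⟩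
    · intro y hy hy'
      rw [Ico_self, sum_empty] at hy'
      refine ⟨j₀, rfl, j₀, rfl, ?_⟩
      simp only [Ico_self, sum_empty]
      refine ⟨hy, hy', by linarith⟩
    · rintro X hX e rfl
      simpa using hX

/-- Create the list that consists of the empty set only. -/
def startList : Prog :=
  .rset 23 (.mul (.reg 3) (.reg 21)) ;; .rset 24 (.mul (.ofInt (.lit 3)) (.reg 21)) ;;
  .rput 5 (.reg 50) (.ofInt (.lit 0)) ;; .iput 1 (.reg 50) (.lit 0) ;;
  .iput 2 (.reg 50) (.lit 0) ;; .iset 51 (.reg 50) ;; .inc 50 ;; .iset 26 (.reg 21)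

/-- The dynamic program for the items from position `ireg 21` on and the capacity `rreg 21`. -/
def knapsack : Prog := startList ;; largeItems ;; smallItems

theorem knapsack_spec (hc : Ctx l w c η N) {e₀ K : ℕ} (h1 : s.ireg 1 = l) (h3 : s.rreg 3 = η)
    (h4 : s.rarr 4 = w) (hcr : s.rreg 21 = c) (he : s.ireg 21 = e₀) (h0l : e₀ ≤ l)
    (hwc : e₀ < l → w e₀ ≤ c) (hK : c ≤ (1 + η) ^ K * (η * c))
    (h : ∀ s' T' 𝒢 g, Frame 23 s s' → DP l w c η s.heap (s.ireg 50) s' 𝒢 →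
      ApproxAdd w c η e₀ l 𝒢 → (∀ X ∈ 𝒢, X ⊆ Ico e₀ l) → g ≤ l →
      g ≤ K * (4 * N + 4) + (N + 1) →
      T' ≤ T + (l * 200 + g * (emitCost N + 40) + 100) → Q s' T') : WP knapsack s T Q := by
  have hcp := hc.c_pos
  have hη := hc.η_pos
  simp only [knapsack, startList, Prog.inc, wp_seq, wp_iset, wp_rset, wp_iput, wp_rput]
  refine largeItems_spec hc (H := s.heap) (m := s.ireg 50) (e₀ := e₀) (K := K)
    ⟨by simp [h1], by simp [h3], by simp [h4], by simp [h3, hcr], by simp [hcr], ?_, by simp,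
    ?_⟩ (by simp [he]) h0l hwc hK ?_
  · simp
    refine ⟨by omega, by simp [State.heap], fun k _ _ => by omega, fun k _ _ => by omega,
      fun k _ _ => ?_, fun k _ _ => ⟨∅, rfl, ?_⟩, ?_⟩
    · obtain rfl : k = s.ireg 50 := by omega
      simp [State.heap]
      positivity
    · obtain rfl : k = s.ireg 50 := by omega
      exact .nil _ (by simp [State.heap]) (by simp [State.heap])
    · rintro X rfl _
      refine ⟨s.ireg 50, s.ireg 50, le_rfl, by omega, le_rfl, by omega, ?_⟩
      simp [State.heap]
      positivity
  · intro k hk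
    have : k ≠ s.ireg 50 := by omega
    simp [Heap.Same, State.heap, this]
  · intro s₁ T₁ 𝒢 j g hf₁ dp₁ hj h0j hjl hwj happ hsub hg1 hg2 hT₁
    refine smallItems_spec hc dp₁ hj h0j hjl (fun i hi hi' => ?_) happ hsub ?_
    · exact (hc.anti j i hi hi').trans (hwj (by omega))
    · intro s₂ T₂ 𝒢₂ g₂ hf₂ dp₂ happ₂ hsub₂ hg3 hg4 hT₂
      refine h s₂ T₂ 𝒢₂ (g + g₂) ?_ dp₂ happ₂ hsub₂ (by omega) (by omega) ?_
      · have hfs := Frame.refl 23 s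
        exact ((((((((hfs.setR (by decide)).setR (by decide)).putR).putI (by decide)
          (by decide)).putI (by decide) (by decide)).setI (by decide)).setI (by decide)).setI
          (by decide)).trans ((hf₁.mono (by decide)).trans (hf₂.mono (by decide)))
      · simp at hT₁
        rw [add_mul]
        omega

end Small

/-! ### Reading both knapsack solutions off the final list. -/

section Selection

open Finset

variable {w : ℕ → ℝ} {l i e₀ : ℕ} {c η ε : ℝ} {N : ℕ}

/-- An approximate solution of Max-Knapsack for the positions after `i`. -/
def KMax (w : ℕ → ℝ) (l i : ℕ) (c ε : ℝ) (D : Finset ℕ) : Prop :=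
  D ⊆ Ico (i + 1) l ∧ ∑ j ∈ D, w j ≤ c ∧
    ∀ D' ⊆ Ico (i + 1) l, ∑ j ∈ D', w j ≤ c → (1 - ε) * ∑ j ∈ D', w j ≤ ∑ j ∈ D, w j

/-- An approximate solution of Min-Knapsack for the positions after `i`. -/
def KMin (w : ℕ → ℝ) (l i : ℕ) (c ε : ℝ) (C : Finset ℕ) : Prop :=
  C ⊆ Ico (i + 1) l ∧ c < ∑ j ∈ C, w j ∧
    ∀ C' ⊆ Ico (i + 1) l, c < ∑ j ∈ C', w j → ∑ j ∈ C, w j ≤ (1 + ε) * ∑ j ∈ C', w j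

/-- The items after `i` of weight more than `c` are those before `e₀`. -/
structure Cut (w : ℕ → ℝ) (l i : ℕ) (c : ℝ) (e₀ : ℕ) : Prop where
  pos : ∀ k < l, 0 < w k
  anti : ∀ i j, i ≤ j → j < l → w j ≤ w i
  lt : i < e₀
  le : e₀ ≤ l
  big : ∀ k, i < k → k < e₀ → c < w k
  small : ∀ k, e₀ ≤ k → k < l → w k ≤ c

theorem Cut.sum_mono (h : Cut w l i c e₀) {X Y : Finset ℕ} (hXY : X ⊆ Y)
    (hY : Y ⊆ Ico (i + 1) l) : ∑ k ∈ X, w k ≤ ∑ k ∈ Y, w k :=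
  sum_le_sum_of_subset_of_nonneg hXY fun k hk _ => (h.pos k (mem_Ico.1 (hY hk)).2).le

theorem Cut.sum_nonneg (h : Cut w l i c e₀) {X : Finset ℕ} (hX : X ⊆ Ico (i + 1) l) :
    0 ≤ ∑ k ∈ X, w k := by
  simpa using h.sum_mono (empty_subset X) hX

theorem Cut.le_sum (h : Cut w l i c e₀) {X : Finset ℕ} (hX : X ⊆ Ico (i + 1) l) {k : ℕ}
    (hk : k ∈ X) : w k ≤ ∑ k ∈ X, w k := by
  simpa using h.sum_mono (singleton_subset_iff.2 hk) hX

theorem Cut.subset_of_le (h : Cut w l i c e₀) {X : Finset ℕ} (hX : X ⊆ Ico (i + 1) l)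
    (hc : ∑ k ∈ X, w k ≤ c) : X ⊆ Ico e₀ l := by
  intro k hk
  have h1 := mem_Ico.1 (hX hk)
  refine mem_Ico.2 ⟨?_, h1.2⟩
  by_contra h2
  have := h.big k (by omega) (by omega)
  have := h.le_sum hX hk
  linarith

/-- A set that contains a big item weighs at least as much as the last big item. -/
theorem Cut.last_le (h : Cut w l i c e₀) {X : Finset ℕ} (hX : X ⊆ Ico (i + 1) l)
    (hne : ¬ X ⊆ Ico e₀ l) : i + 1 < e₀ ∧ w (e₀ - 1) ≤ ∑ k ∈ X, w k := by
  obtain ⟨k, hk, hk'⟩ := not_subset.1 hne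
  have h1 := mem_Ico.1 (hX hk)
  rw [mem_Ico] at hk'
  have hle := h.le
  exact ⟨by omega, (h.anti k (e₀ - 1) (by omega) (by omega)).trans (h.le_sum hX hk)⟩

theorem Cut.sub (h : Cut w l i c e₀) : Ico e₀ l ⊆ Ico (i + 1) l :=
  Ico_subset_Ico h.lt le_rfl

theorem Cut.kmax_all (h : Cut w l i c e₀) (hε : 0 ≤ ε) (hT : ∑ k ∈ Ico e₀ l, w k ≤ c) :
    KMax w l i c ε (Ico e₀ l) := by
  refine ⟨h.sub, hT, fun D' hD' hc => ?_⟩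
  have h1 := h.sum_mono (h.subset_of_le hD' hc) h.sub
  have h2 := h.sum_nonneg hD'
  nlinarith

/-- All the small items together fit, so a set that does not fit contains a big item; the lightest
big item alone is an exact optimum. -/
theorem Cut.kmin_single (h : Cut w l i c e₀) (hε : 0 ≤ ε) (hie : i + 1 < e₀)
    (hT : ∑ k ∈ Ico e₀ l, w k ≤ c) : KMin w l i c ε (Ico (e₀ - 1) e₀) := by
  have hle := h.le
  have hs : ∑ k ∈ Ico (e₀ - 1) e₀, w k = w (e₀ - 1) := by
    have := sum_Ico_succ_top (le_refl (e₀ - 1)) w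
    rw [Nat.sub_add_cancel (by omega)] at this
    simpa using this
  refine ⟨Ico_subset_Ico (by omega) hle, ?_, fun C' hC' hc => ?_⟩
  · rw [hs]; exact h.big _ (by omega) (by omega)
  · rw [hs]
    by_cases h1 : C' ⊆ Ico e₀ l
    · have := h.sum_mono h1 h.sub
      linarith
    · have := (h.last_le hC' h1).2
      have := h.sum_nonneg hC'
      nlinarith

theorem Cut.infeasible (h : Cut w l i c e₀) (hie : ¬ i + 1 < e₀)
    (hT : ∑ k ∈ Ico e₀ l, w k ≤ c) {C : Finset ℕ} (hC : C ⊆ Ico (i + 1) l) :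
    ∑ k ∈ C, w k ≤ c := by
  obtain rfl : e₀ = i + 1 := by have := h.lt; omega
  exact (h.sum_mono hC subset_rfl).trans hT

/-- Fill greedily: the prefix before the first overflow and the item that causes it together exceed
`c`, so one of them weighs at least `c / 2`. This lets additive errors of order `η c` count as
relative errors. -/
theorem Cut.exists_half (h : Cut w l i c e₀) (hc : 0 < c) (hT : c < ∑ k ∈ Ico e₀ l, w k) :
    ∃ D ⊆ Ico e₀ l, ∑ k ∈ D, w k ≤ c ∧ c / 2 ≤ ∑ k ∈ D, w k := by
  have hex : ∃ k, e₀ ≤ k ∧ k < l ∧ ∑ j ∈ Ico e₀ k, w j ≤ c ∧ c < ∑ j ∈ Ico e₀ (k + 1), w j := by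
    by_contra hno
    push Not at hno
    have : ∀ k, e₀ ≤ k → k ≤ l → ∑ j ∈ Ico e₀ k, w j ≤ c := by
      intro k hk
      induction k, hk using Nat.le_induction with
      | base => intro _; simpa using hc.le
      | succ k hk ih => intro hk'; exact hno k hk hk' (ih (by omega))
    have := this l h.le le_rfl
    linarith
  obtain ⟨k, hk, hkl, h1, h2⟩ := hex
  rw [sum_Ico_succ_top hk] at h2
  by_cases h3 : c / 2 ≤ ∑ j ∈ Ico e₀ k, w j
  · exact ⟨Ico e₀ k, Ico_subset_Ico le_rfl hkl.le, h1, h3⟩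
  · refine ⟨{k}, singleton_subset_iff.2 (mem_Ico.2 ⟨hk, hkl⟩), ?_, ?_⟩
    · simpa using h.small k hk hkl
    · rw [sum_singleton]; linarith

/-- Drop items as long as the rest exceeds `c`. The result weighs at most `2 c`, the range in which
the family is known to approximate. -/
theorem Cut.exists_minimal (h : Cut w l i c e₀) (hc : 0 < c) {C : Finset ℕ} (hC : C ⊆ Ico e₀ l)
    (hT : c < ∑ k ∈ C, w k) :
    ∃ C' ⊆ C, c < ∑ k ∈ C', w k ∧ ∑ k ∈ C', w k ≤ 2 * c := by
  induction C using Finset.induction_on with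
  | empty => simp at hT; linarith
  | insert a C ha ih =>
    by_cases h1 : c < ∑ k ∈ C, w k
    · obtain ⟨C', h2, h3⟩ := ih ((subset_insert a C).trans hC) h1
      exact ⟨C', h2.trans (subset_insert a C), h3⟩
    · refine ⟨insert a C, subset_rfl, hT, ?_⟩
      have h2 := mem_Ico.1 (hC (mem_insert_self a C))
      have := h.small a h2.1 h2.2
      rw [sum_insert ha]
      linarith

/-- The last list element of value at most `c` and the next one solve the knapsack problems, if a
single big item is also taken into account. -/
theorem Seg.select {h : Heap} {lo hi k : ℕ} {𝒢 : Set (Finset ℕ)} (hc : Ctx l w c η N)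
    (hcut : Cut w l i c e₀) (hs : Seg w h lo hi (η * c) (3 * c) 𝒢) (hε : 8 * η ≤ ε)
    (ha : ApproxAdd w c η e₀ l 𝒢) (hsub : ∀ X ∈ 𝒢, X ⊆ Ico e₀ l)
    (hT : c < ∑ k ∈ Ico e₀ l, w k) (hk : lo ≤ k) (hk' : k < hi) (hkc : h.val k ≤ c)
    (hnext : k + 1 < hi → c < h.val (k + 1)) :
    k + 1 < hi ∧ (∃ D, h.Rep w k D ∧ KMax w l i c ε D) ∧
    ∃ C, h.Rep w (k + 1) C ∧ C ⊆ Ico (i + 1) l ∧ c < ∑ j ∈ C, w j ∧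
      ∀ C' ⊆ Ico (i + 1) l, c < ∑ j ∈ C', w j →
        ∑ j ∈ C, w j ≤ (1 + ε) * ∑ j ∈ C', w j ∨
        (i + 1 < e₀ ∧ w (e₀ - 1) ≤ ∑ j ∈ C', w j) := by
  have hη := hc.η_pos
  have hη' := hc.η_le
  have hcp := hc.c_pos
  -- The upper representative `X` of the reduced set weighs at most `(1 + η) · 2 c + 2 η c ≤ 3 c - η
  -- c`, so it has a bracket. The upper end of the bracket exceeds `c` and lies beyond `k`. With `S`
  -- the weight of `C'`, the excess over `S` is at most `η S + 3 η c ≤ 4 η S`.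
  have upper : ∀ C' ⊆ Ico e₀ l, c < ∑ j ∈ C', w j → k + 1 < hi ∧
      h.val (k + 1) ≤ (1 + 8 * η) * ∑ j ∈ C', w j := by
    intro C' hC' hcC
    obtain ⟨C₂, h1, h2, h3⟩ := hcut.exists_minimal hcp hC' hcC
    have h4 := hcut.sum_mono h1 (hC'.trans hcut.sub)
    obtain ⟨-, X, hX, h5, h6⟩ := ha C₂ (h1.trans hC') h3
    obtain ⟨m, m', g1, g2, g3, g4, g5, g6, g7⟩ := hs.bracket X hX (by nlinarith)
    have g8 : k < m' := by
      by_contra g8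
      have := le_of_step_le hs.mono g3 (not_lt.1 g8) hk'
      linarith
    have g9 := le_of_step_le hs.mono (show lo ≤ k + 1 by omega) g8 g4
    refine ⟨by omega, ?_⟩
    nlinarith
  have hk1 := (upper _ subset_rfl hT).1
  refine ⟨hk1, ?_, ?_⟩
  · obtain ⟨D, hD, hrep⟩ := hs.rep k hk hk'
    refine ⟨D, hrep, (hsub D hD).trans hcut.sub, hrep.val_eq ▸ hkc, ?_⟩
    rw [← hrep.val_eq]
    -- The lower end of the bracket of `X` is at most `c`, hence lies at or before `k`. With `S` the
    -- weight of `D'`, the deficit is at most `η S + 3 η c ≤ 7 η S`, because `c ≤ 2 S`.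
    have lower : ∀ D' ⊆ Ico e₀ l, ∑ j ∈ D', w j ≤ c → c / 2 ≤ ∑ j ∈ D', w j →
        (1 - 8 * η) * ∑ j ∈ D', w j ≤ h.val k := by
      intro D' hD' h1 h2
      obtain ⟨⟨X, hX, h3, h4⟩, -⟩ := ha D' hD' (by linarith)
      obtain ⟨m, m', g1, g2, g3, g4, g5, g6, g7⟩ := hs.bracket X hX (by nlinarith)
      have g8 : m ≤ k := by
        by_contra g8
        have := le_of_step_le hs.mono (show lo ≤ k + 1 by omega) (show k + 1 ≤ m by omega) g2
        linarith [hnext hk1]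
      have g9 := le_of_step_le hs.mono g1 g8 hk'
      have g10 : ∑ j ∈ X, w j ≤ h.val k + η * c := by linarith
      have g11 : (1 + η) * ∑ j ∈ X, w j ≤ ∑ j ∈ X, w j + η * ∑ j ∈ D', w j := by nlinarith
      nlinarith
    intro D' hD' h1
    have hD'' := hcut.subset_of_le hD' h1
    have h0 := hcut.sum_nonneg hD'
    have hle : (1 - ε) * ∑ j ∈ D', w j ≤ (1 - 8 * η) * ∑ j ∈ D', w j := by nlinarith
    refine hle.trans ?_
    by_cases h2 : c / 2 ≤ ∑ j ∈ D', w j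
    · exact lower D' hD'' h1 h2
    · obtain ⟨D₀, h3, h4, h5⟩ := hcut.exists_half hcp hT
      refine le_trans ?_ (lower D₀ h3 h4 h5)
      nlinarith
  · obtain ⟨C, hC, hrep⟩ := hs.rep (k + 1) (by omega) hk1
    refine ⟨C, hrep, (hsub C hC).trans hcut.sub, hrep.val_eq ▸ hnext hk1, fun C' hC' h1 => ?_⟩
    rw [← hrep.val_eq]
    by_cases h2 : C' ⊆ Ico e₀ l
    · left
      have h3 := (upper C' h2 h1).2
      have h0 := hcut.sum_nonneg hC'
      nlinarith
    · exact Or.inr (hcut.last_le hC' h2)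

end Selection

/-! ### Subprograms: makespans, the cut, and the case in which all small items fit. -/

section Solve

open Finset

variable {w : ℕ → ℝ} {l i e₀ : ℕ} {c η ε q P : ℝ} {N K : ℕ} {s : State} {T : ℕ}
  {Q : State → ℕ → Prop}

/-- The heap only grows, and the registers below `20` are kept. -/
structure Grows (s s' : State) : Prop where
  frame : Frame 20 s s'
  le : s.ireg 50 ≤ s'.ireg 50
  below : s.heap.Below s'.heap (s.ireg 50)

theorem Grows.refl (s : State) : Grows s s := ⟨Frame.refl _ _, le_rfl, Heap.Below.refl _ _⟩

theorem Grows.trans {s₁ s₂ s₃ : State} (h : Grows s₁ s₂) (h' : Grows s₂ s₃) : Grows s₁ s₃ :=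
  ⟨h.frame.trans h'.frame, h.le.trans h'.le, h.below.trans h'.below h.le⟩

theorem Grows.setI {s₁ s₂ : State} (h : Grows s₁ s₂) {x v : ℕ} (hx : 20 ≤ x) (h50 : 50 ≠ x) :
    Grows s₁ (s₂.setI x v) :=
  ⟨h.frame.setI hx, by simpa [h50] using h.le, h.below⟩

theorem Grows.setR {s₁ s₂ : State} (h : Grows s₁ s₂) {x : ℕ} {v : ℝ} (hx : 20 ≤ x) :
    Grows s₁ (s₂.setR x v) :=
  ⟨h.frame.setR hx, h.le, h.below⟩

/-- The global registers and arrays while the jobs are treated: `q` is the time of `J_n`, `P` the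
total time of the flow-shop jobs, `w` the list of their times. -/
structure Base (l : ℕ) (w : ℕ → ℝ) (η q P : ℝ) (s : State) : Prop where
  i1 : s.ireg 1 = l
  r1 : s.rreg 1 = q
  r2 : s.rreg 2 = P
  r3 : s.rreg 3 = η
  arr : s.rarr 4 = w
  hp : 0 < s.ireg 50
  root : s.heap.Rep w 0 ∅

theorem Base.grows {s' : State} (h : Base l w η q P s) (g : Grows s s') : Base l w η q P s' :=
  ⟨(g.frame.ireg 1 (by decide)).trans h.i1, (g.frame.rreg 1 (by decide)).trans h.r1,
    (g.frame.rreg 2 (by decide)).trans h.r2, (g.frame.rreg 3 (by decide)).trans h.r3,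
    (g.frame.rarr 4 (by decide)).trans h.arr, h.hp.trans_le g.le, h.root.of_below g.below h.hp⟩

/-- Create a node for the interval `[a, b)` of weight `r` and store it in the register `x`. -/
def newNode (r : RExp) (a b : IExp) (x : ℕ) : Prog :=
  .rput 5 (.reg 50) r ;; .iput 1 (.reg 50) a ;; .iput 2 (.reg 50) b ;;
  .iput 3 (.reg 50) (.lit 0) ;; .iset x (.reg 50) ;; .inc 50

theorem newNode_spec (hb : Base l w η q P s) {r : RExp} {a b : IExp} {x a' b' : ℕ} (hx : 20 ≤ x)
    (hx' : x < 50)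
    (ha : ∀ s' : State, s'.ireg = s.ireg → a.eval s' = a')
    (hb' : ∀ s' : State, s'.ireg = s.ireg → b.eval s' = b')
    (hr : r.eval s = ∑ j ∈ Ico a' b', w j) (hab : a' < b')
    (h : ∀ s' T', Grows s s' → (∀ y, y ≠ x → y ≠ 50 → s'.ireg y = s.ireg y) →
      s'.rreg = s.rreg → s'.ireg x = s.ireg 50 → s.ireg 50 < s'.ireg 50 →
      s'.heap.Rep w (s.ireg 50) (Ico a' b') → T' ≤ T + (r.cost + a.cost + b.cost + 20) →
      Q s' T') : WP (newNode r a b x) s T Q := by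
  simp only [newNode, Prog.inc, wp_seq, wp_iset, wp_iput, wp_rput]
  rw [ha (s.putR 5 _ _) rfl, hb' ((s.putR 5 _ _).putI 1 _ _) rfl, hr]
  have hx50 : x ≠ 50 := by omega
  have hbelow : s.heap.Below (s.heap.set (s.ireg 50) (∑ j ∈ Ico a' b', w j) a' b' 0)
      (s.ireg 50) := s.heap.below_set _ _ _ _ le_rfl
  have key : ∀ s' : State, s'.heap = s.heap.set (s.ireg 50) (∑ j ∈ Ico a' b', w j) a' b' 0 →
      s.heap.Below s'.heap (s.ireg 50) ∧ s'.heap.Rep w (s.ireg 50) (Ico a' b') := by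
    intro s' hs'
    rw [hs']
    refine ⟨hbelow, ?_⟩
    have hroot := hb.root.of_below hbelow hb.hp
    have h1 : (s.heap.set (s.ireg 50) (∑ j ∈ Ico a' b', w j) a' b' 0).fst (s.ireg 50) = a' := by
      simp [Heap.set]
    have h2 : (s.heap.set (s.ireg 50) (∑ j ∈ Ico a' b', w j) a' b' 0).lst (s.ireg 50) = b' := by
      simp [Heap.set]
    have h3 : (s.heap.set (s.ireg 50) (∑ j ∈ Ico a' b', w j) a' b' 0).par (s.ireg 50) = 0 := by
      simp [Heap.set]
    have := Heap.Rep.cons (w := w)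
      (h := s.heap.set (s.ireg 50) (∑ j ∈ Ico a' b', w j) a' b' 0) (s.ireg 50) ∅
      (by rw [h1, h2]; exact hab) (by rw [h3]; exact hb.hp) (by rw [h3]; exact hroot)
      (disjoint_empty_left _)
      (by rw [h1, h2, h3, hroot.val_eq]; simp [Heap.set])
    rwa [h1, h2, empty_union] at this
  refine h _ _ ⟨?_, ?_, (key _ ?_).1⟩ (fun y hy hy' => ?_) rfl ?_ ?_ (key _ ?_).2 ?_
  · exact ((((((Frame.refl 20 s).putR).putI (by decide) (by decide)).putI (by decide)
      (by decide)).putI (by decide) (by decide)).setI hx).setI (by decide)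
  · simp [hx50.symm]
  · simp [State.heap, Heap.set]
  · simp [hy, hy']
  · simp [hx50]
  · simp [hx50.symm]
  · simp [State.heap, Heap.set]
  · simp; omega

/-- The makespan of `π^i(C, C̄)` as a function of `x = P(F¹)`. -/
noncomputable def spanVal (q P p₁ p x : ℝ) : ℝ :=
  max (max P (max (p + x) q + q) + q) (max (p + x) q + q + p₁ + (P - x))

/-- Compute the makespan of the schedule for the job `ireg 10` and the node `ireg 40`. -/
def spanProg : Prog :=
  .rset 40 (.add (.get 4 (.reg 10)) (.get 5 (.reg 40))) ;;
  .rset 41 (.add (.get 4 (.reg 10)) (.reg 40)) ;;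
  .ite (.rle (.reg 41) (.reg 1)) (.rset 41 (.reg 1)) .skip ;;
  .rset 41 (.add (.reg 41) (.reg 1)) ;;
  .rset 42 (.reg 41) ;;
  .ite (.rle (.reg 42) (.reg 2)) (.rset 42 (.reg 2)) .skip ;;
  .rset 42 (.add (.reg 42) (.reg 1)) ;;
  .rset 43 (.add (.add (.reg 41) (.get 4 (.lit 0))) (.sub (.reg 2) (.reg 40))) ;;
  .ite (.rle (.reg 42) (.reg 43)) (.rset 42 (.reg 43)) .skip

theorem wp_max {x : ℕ} {e : RExp}
    (h : ∀ s' T', s' = s.setR x (max (s.rreg x) (e.eval s)) ∨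
        (s' = s ∧ s.rreg x = max (s.rreg x) (e.eval s)) → T' ≤ T + (2 * e.cost + 4) → Q s' T') :
    WP (.ite (.rle (.reg x) e) (.rset x e) .skip) s T Q := by
  simp only [wp_ite, wp_rset, wp_skip]
  refine ⟨fun hb => ?_, fun hb => ?_⟩
  · refine h _ _ (Or.inl ?_) (by simp; omega)
    rw [max_eq_right (by simpa using hb)]
  · refine h _ _ (Or.inr ⟨rfl, ?_⟩) (by simp; omega)
    rw [max_eq_left]
    simpa using (not_le.1 hb).le

theorem spanProg_spec (hb : Base l w η q P s) (hi : s.ireg 10 = i) {k : ℕ} (hk : s.ireg 40 = k)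
    (h : ∀ s' T', s'.ireg = s.ireg → s'.heap = s.heap → Frame 40 s s' →
      s'.rreg 42 = spanVal q P (w 0) (w i) (w i + s.heap.val k) → T' ≤ T + 80 → Q s' T') :
    WP spanProg s T Q := by
  have hval : s.rarr 5 k = s.heap.val k := rfl
  have fr := Frame.refl 40 s
  simp only [spanProg, wp_seq, wp_rset]
  refine wp_max fun s₁ T₁ h₁ hT₁ => ?_
  have r1 : s₁.rreg 41 = max (w i + (w i + s.heap.val k)) q ∧ s₁.rreg 40 = w i + s.heap.val k ∧
      s₁.ireg = s.ireg ∧ s₁.heap = s.heap ∧ Frame 40 s s₁ := by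
    rcases h₁ with rfl | ⟨rfl, h₁⟩
    · refine ⟨?_, ?_, rfl, rfl, ((fr.setR (by decide)).setR (by decide)).setR (by decide)⟩ <;>
        simp [hi, hk, hb.arr, hval, hb.r1]
    · refine ⟨?_, ?_, rfl, rfl, (fr.setR (by decide)).setR (by decide)⟩
      · rw [h₁]
        simp [hi, hk, hb.arr, hval, hb.r1]
      · simp [hi, hk, hb.arr, hval]
  obtain ⟨a1, a2, a3, a4, a5⟩ := r1
  clear h₁
  have b1 : s₁.rreg 1 = q := (a5.rreg 1 (by decide)).trans hb.r1
  have b2 : s₁.rreg 2 = P := (a5.rreg 2 (by decide)).trans hb.r2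
  have b4 : s₁.rarr 4 = w := (a5.rarr 4 (by decide)).trans hb.arr
  refine wp_max fun s₂ T₂ h₂ hT₂ => ?_
  have r2 : s₂.rreg 42 = max (max (w i + (w i + s.heap.val k)) q + q) P ∧
      s₂.rreg 41 = max (w i + (w i + s.heap.val k)) q + q ∧ s₂.rreg 40 = w i + s.heap.val k ∧
      s₂.ireg = s.ireg ∧ s₂.heap = s.heap ∧ Frame 40 s s₂ := by
    rcases h₂ with rfl | ⟨rfl, h₂⟩
    · refine ⟨?_, ?_, ?_, a3, a4, ((a5.setR (by decide)).setR (by decide)).setR (by decide)⟩ <;>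
        simp [a1, a2, b1, b2]
    · refine ⟨?_, ?_, ?_, a3, a4, (a5.setR (by decide)).setR (by decide)⟩
      · rw [h₂]
        simp [a1, b1, b2]
      · simp [a1, b1]
      · simp [a2]
  obtain ⟨c0, c1, c2, c3, c4, c5⟩ := r2
  clear h₂
  have b1 : s₂.rreg 1 = q := (c5.rreg 1 (by decide)).trans hb.r1
  have b2 : s₂.rreg 2 = P := (c5.rreg 2 (by decide)).trans hb.r2
  have b4 : s₂.rarr 4 = w := (c5.rarr 4 (by decide)).trans hb.arr
  refine wp_max fun s₃ T₃ h₃ hT₃ => ?_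
  have hT : T₃ ≤ T + 80 := by simp at hT₁ hT₂ hT₃; omega
  rcases h₃ with rfl | ⟨rfl, h₃⟩
  · refine h _ _ c3 c4 (((c5.setR (by decide)).setR (by decide)).setR (by decide)) ?_ hT
    simp [c0, c1, c2, b1, b2, b4, spanVal, max_comm P]
  · refine h _ _ c3 c4 ((c5.setR (by decide)).setR (by decide)) ?_ hT
    rw [h₃]
    simp [c0, c1, c2, b1, b2, b4, spanVal, max_comm P]

/-- Find the first position `ireg 21` after `ireg 10` of an item of weight at most `rreg 21`, and
the total weight `rreg 22` of the items from there on. -/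
def findCut : Prog :=
  .iset 21 (.add (.reg 10) (.lit 1)) ;;
  .loop (.conj (.ilt (.reg 21) (.reg 1)) (.rlt (.reg 21) (.get 4 (.reg 21)))) (.inc 21) ;;
  .rset 22 (.ofInt (.lit 0)) ;; .iset 22 (.reg 21) ;;
  .loop (.ilt (.reg 22) (.reg 1)) (.rset 22 (.add (.reg 22) (.get 4 (.reg 22))) ;; .inc 22)

theorem findCut_spec (hb : Base l w η q P s) (hpos : ∀ k < l, 0 < w k)
    (hanti : ∀ i j, i ≤ j → j < l → w j ≤ w i) (hi : s.ireg 10 = i) (hil : i < l)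
    (h : ∀ s' T' e₀, Grows s s' → s'.ireg 21 = e₀ → s'.rreg 21 = s.rreg 21 →
      s'.rreg 22 = ∑ j ∈ Ico e₀ l, w j → Cut w l i (s.rreg 21) e₀ → T' ≤ T + (40 * l + 40) →
      Q s' T') : WP findCut s T Q := by
  simp only [findCut, wp_seq, wp_iset]
  apply WP.loop (Inv := fun s' T' => Grows s s' ∧ s'.rreg 21 = s.rreg 21 ∧ ∃ e, s'.ireg 21 = e ∧
      i < e ∧ e ≤ l ∧ (∀ k, i < k → k < e → s.rreg 21 < w k) ∧ T' ≤ T + (20 * e + 4))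
    (m := fun s' => l - s'.ireg 21)
  · rintro s₁ T₁ ⟨hg, hr, e, he, h1, h2, h3, hT⟩ hb₁
    have hB := hb.grows hg
    simp [hB.i1, hB.arr, he, hr] at hb₁
    simp only [Prog.inc, wp_iset]
    refine ⟨⟨hg.setI (by decide) (by decide), hr, e + 1, by simp [he], by omega, by omega, ?_, ?_⟩,
      ?_⟩
    · intro k hk hk'
      rcases Nat.lt_succ_iff_lt_or_eq.1 hk' with h4 | rfl
      · exact h3 k hk h4
      · exact hb₁.2
    · simp; omega
    · simp [he]; omega
  · rintro s₁ T₁ ⟨hg, hr, e, he, h1, h2, h3, hT⟩ hb₁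
    have hB := hb.grows hg
    simp [hB.i1, hB.arr, he, hr] at hb₁
    have hcut : Cut w l i (s.rreg 21) e := by
      refine ⟨hpos, hanti, h1, h2, h3, fun k hk hk' => ?_⟩
      exact (hanti e k hk hk').trans (hb₁ (by omega))
    simp only [wp_rset]
    apply WP.loop (Inv := fun s' T' => Grows s s' ∧ s'.ireg 21 = e ∧ s'.rreg 21 = s.rreg 21 ∧
      ∃ k, s'.ireg 22 = k ∧ e ≤ k ∧ k ≤ l ∧ s'.rreg 22 = ∑ j ∈ Ico e k, w j ∧
        T' ≤ T + (40 * k + 18)) (m := fun s' => l - s'.ireg 22)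
    · rintro s₂ T₂ ⟨hg₂, he₂, hr₂, k, hk, h4, h5, h6, hT₂⟩ hb₂
      have hB := hb.grows hg₂
      simp [hB.i1, hk] at hb₂
      simp only [Prog.inc, wp_iset, wp_seq, wp_rset]
      refine ⟨⟨(hg₂.setR (by decide)).setI (by decide) (by decide), by simp [he₂], by simp [hr₂],
        k + 1, by simp [hk], by omega, by omega, ?_, ?_⟩, ?_⟩
      · simp [h6, hk, hB.arr, sum_Ico_succ_top h4]
      · simp; omega
      · simp [hk]; omega
    · rintro s₂ T₂ ⟨hg₂, he₂, hr₂, k, hk, h4, h5, h6, hT₂⟩ hb₂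
      have hB := hb.grows hg₂
      simp [hB.i1, hk] at hb₂
      obtain rfl : k = l := by omega
      exact h s₂ _ e hg₂ he₂ hr₂ h6 hcut (by simp; omega)
    · refine ⟨(hg.setR (by decide)).setI (by decide) (by decide), by simp [he], by simp [hr],
        e, by simp [he], le_rfl, h2, by simp, ?_⟩
      simp; omega
  · refine ⟨(Grows.refl s).setI (by decide) (by decide), by simp, i + 1, by simp [hi], by omega,
      by omega, fun k _ _ => by omega, ?_⟩
    simp

/-- The nodes `ireg 23` and `ireg 24` are approximate solutions of Max-Knapsack and
Min-Knapsack; they are equal if the latter is infeasible. -/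
structure Cands (w : ℕ → ℝ) (l i : ℕ) (c ε : ℝ) (s : State) (D C : Finset ℕ) : Prop where
  rep_d : s.heap.Rep w (s.ireg 23) D
  lt_d : s.ireg 23 < s.ireg 50
  rep_c : s.heap.Rep w (s.ireg 24) C
  lt_c : s.ireg 24 < s.ireg 50
  kmax : KMax w l i c ε D
  kmin : KMin w l i c ε C ∨ (C = D ∧ ∀ C' ⊆ Ico (i + 1) l, ∑ j ∈ C', w j ≤ c)

/-- The case that all items of weight at most `c` fit together. -/
def solveAll : Prog :=
  .ite (.ilt (.reg 21) (.reg 1)) (newNode (.reg 22) (.reg 21) (.reg 1) 23)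
    (.iset 23 (.lit 0)) ;;
  .ite (.ilt (.add (.reg 10) (.lit 1)) (.reg 21))
    (newNode (.get 4 (.sub (.reg 21) (.lit 1))) (.sub (.reg 21) (.lit 1)) (.reg 21) 24)
    (.iset 24 (.reg 23))

theorem sum_Ico_pred {e : ℕ} (he : 0 < e) : ∑ j ∈ Ico (e - 1) e, w j = w (e - 1) := by
  have := sum_Ico_succ_top (le_refl (e - 1)) w
  rw [Nat.sub_add_cancel he] at this
  simpa using this

theorem solveAll_spec (hb : Base l w η q P s) (hi : s.ireg 10 = i) (he : s.ireg 21 = e₀)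
    (hcut : Cut w l i c e₀) (hε : 0 ≤ ε) (hT0 : s.rreg 22 = ∑ j ∈ Ico e₀ l, w j)
    (hT : ∑ j ∈ Ico e₀ l, w j ≤ c)
    (h : ∀ s' T' D C, Grows s s' → Cands w l i c ε s' D C → T' ≤ T + 100 → Q s' T') :
    WP solveAll s T Q := by
  have second : ∀ s₁ T₁, Grows s s₁ → s₁.ireg 21 = e₀ → s₁.heap.Rep w (s₁.ireg 23) (Ico e₀ l) →
      s₁.ireg 23 < s₁.ireg 50 → T₁ ≤ T + 40 →
      WP (.ite (.ilt (.add (.reg 10) (.lit 1)) (.reg 21))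
        (newNode (.get 4 (.sub (.reg 21) (.lit 1))) (.sub (.reg 21) (.lit 1)) (.reg 21) 24)
        (.iset 24 (.reg 23))) s₁ T₁ Q := by
    intro s₁ T₁ hg he₁ hrep hlt hT₁
    have hB := hb.grows hg
    have e10 : s₁.ireg 10 = i := (hg.frame.ireg 10 (by decide)).trans hi
    simp only [wp_ite]
    refine ⟨fun hc => ?_, fun hc => ?_⟩
    · simp [e10, he₁] at hc
      refine newNode_spec hB (a' := e₀ - 1) (b' := e₀) (by decide) (by decide)
        (fun s' hs' => by simp [hs', he₁]) (fun s' hs' => by simp [hs', he₁]) ?_ (by omega) ?_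
      · simp [hB.arr, he₁, sum_Ico_pred (w := w) (show 0 < e₀ by omega)]
      · intro s₂ T₂ hg₂ hreg _ h24 hlt₂ hrep₂ hT₂
        have e23 := hreg 23 (by decide) (by decide)
        refine h s₂ T₂ _ _ (hg.trans hg₂) ⟨?_, ?_, ?_, ?_, hcut.kmax_all hε hT,
          Or.inl (hcut.kmin_single hε hc hT)⟩ (by simp at hT₂; omega)
        · rw [e23]; exact hrep.of_below hg₂.below hlt
        · omega
        · rwa [h24]
        · omega
    · simp [e10, he₁] at hc
      simp only [wp_iset]
      refine h _ _ _ _ (hg.setI (by decide) (by decide)) ⟨by simpa using hrep, by simpa using hlt,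
        by simpa using hrep, by simpa using hlt, hcut.kmax_all hε hT,
        Or.inr ⟨rfl, fun C' hC' => hcut.infeasible (by omega) hT hC'⟩⟩ (by simp; omega)
  simp only [solveAll, wp_seq]
  rw [wp_ite]
  refine ⟨fun hc => ?_, fun hc => ?_⟩
  · simp [hb.i1, he] at hc
    refine newNode_spec hb (a' := e₀) (b' := l) (by decide) (by decide)
      (fun s' hs' => by simp [hs', he]) (fun s' hs' => by simp [hs', hb.i1]) (by simpa using hT0)
      hc ?_
    intro s₁ T₁ hg hreg _ h23 hlt hrep hT₁
    refine second s₁ T₁ hg ((hreg 21 (by decide) (by decide)).trans he) (by rwa [h23]) (by omega)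
      (by simp at hT₁; omega)
  -- Without small items the set is empty, and the root, node `0`, represents it.
  · simp [hb.i1, he] at hc
    rw [wp_iset]
    refine second _ _ ((Grows.refl s).setI (by decide) (by decide)) (by simp [he]) ?_ ?_
      (by simp)
    · rw [Ico_eq_empty_of_le hc]
      simpa using hb.root
    · simpa using hb.hp

end Solve

/-! ### Computing a schedule for a single job `i`. -/

section Solve

open Finset

variable {w : ℕ → ℝ} {l i e₀ : ℕ} {c η ε q P : ℝ} {N K : ℕ} {s : State} {T : ℕ}
  {Q : State → ℕ → Prop}

/-- The assumptions on the list of processing times and the parameters of the algorithm. -/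
structure Data (l : ℕ) (w : ℕ → ℝ) (η : ℝ) (N K : ℕ) : Prop where
  pos : ∀ k < l, 0 < w k
  anti : ∀ i j, i ≤ j → j < l → w j ≤ w i
  η_pos : 0 < η
  η_le : η ≤ 1 / 8
  lt_N : 3 < (N + 1) * η
  le_K : 1 ≤ (1 + η) ^ K * η

/-- The conditions on `N` and `K` are free of `c`, so the same parameters serve the knapsack
problems of all jobs. -/
theorem Data.ctx (hd : Data l w η N K) (hc : 0 < c) : Ctx l w c η N :=
  ⟨hc, hd.η_pos, hd.η_le, hd.pos, hd.anti, by have := hd.lt_N; nlinarith⟩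

/-- The case that the items of weight at most `c` do not fit together. -/
def solveSome : Prog :=
  knapsack ;; .iset 23 (.reg 51) ;;
  .loop (.conj (.ilt (.add (.reg 23) (.lit 1)) (.reg 50))
    (.rle (.get 5 (.add (.reg 23) (.lit 1))) (.reg 21))) (.inc 23) ;;
  .iset 24 (.add (.reg 23) (.lit 1)) ;;
  .ite (.conj (.ilt (.add (.reg 10) (.lit 1)) (.reg 21))
      (.rle (.get 4 (.sub (.reg 21) (.lit 1))) (.get 5 (.reg 24))))
    (newNode (.get 4 (.sub (.reg 21) (.lit 1))) (.sub (.reg 21) (.lit 1)) (.reg 21) 24)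
    .skip

/-- The list element above `c` competes only with sets of small items. A set with a big item weighs
at least the lightest big item, so the lighter of these two candidates solves Min-Knapsack. -/
theorem solveSome_spec (hd : Data l w η N K) (hb : Base l w η q P s) (hi : s.ireg 10 = i)
    (he : s.ireg 21 = e₀) (hcr : s.rreg 21 = c) (hcut : Cut w l i c e₀) (hε : 8 * η ≤ ε)
    (hc0 : 0 ≤ c) (hT : c < ∑ j ∈ Ico e₀ l, w j)
    (h : ∀ s' T' D C g, Grows s s' → Cands w l i c ε s' D C → g ≤ l →
      g ≤ K * (4 * N + 4) + (N + 1) →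
      T' ≤ T + (l * 200 + (g + 1) * (emitCost N + 40) + 200) → Q s' T') :
    WP solveSome s T Q := by
  have he0l : e₀ < l := by
    by_contra hlt
    rw [Ico_eq_empty_of_le (not_lt.1 hlt), sum_empty] at hT
    linarith
  have hcp : 0 < c := (hcut.pos e₀ he0l).trans_le (hcut.small e₀ le_rfl he0l)
  have hctx := hd.ctx hcp
  have hη := hd.η_pos
  simp only [solveSome, wp_seq]
  refine knapsack_spec hctx (K := K) hb.i1 hb.r3 hb.arr hcr he hcut.le
    (fun _ => hcut.small e₀ le_rfl he0l) (by have := hd.le_K; nlinarith) ?_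
  intro s₁ T₁ 𝒢 g hf₁ dp₁ happ hsub hg hg' hT₁
  have hgr : Grows s s₁ := ⟨hf₁.mono (by decide), dp₁.le, dp₁.below⟩
  have e21 : s₁.ireg 21 = e₀ := (hf₁.ireg 21 (by decide)).trans he
  have f21 : s₁.rreg 21 = c := (hf₁.rreg 21 (by decide)).trans hcr
  have e10 : s₁.ireg 10 = i := (hf₁.ireg 10 (by decide)).trans hi
  have hlen := dp₁.seg.length_le hctx.lt_N
  have hlt := dp₁.seg.lt
  rw [wp_iset]
  apply WP.loop (Inv := fun s' T' => ∃ k, s' = s₁.setI 23 k ∧ s₁.ireg 51 ≤ k ∧ k < s₁.ireg 50 ∧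
    s₁.heap.val k ≤ c ∧ T' ≤ T₁ + (20 * (k - s₁.ireg 51) + 2))
    (m := fun s' => s₁.ireg 50 - s'.ireg 23)
  · rintro s₂ T₂ ⟨k, rfl, h1, h2, h3, hT₂⟩ hb₂
    simp [f21] at hb₂
    simp only [Prog.inc, wp_iset]
    refine ⟨⟨k + 1, ?_, by omega, hb₂.1, hb₂.2, ?_⟩, ?_⟩
    · simp [State.setI]
    · simp; omega
    · simp; omega
  · rintro s₂ T₂ ⟨k, rfl, h1, h2, h3, hT₂⟩ hb₂
    simp [f21] at hb₂
    obtain ⟨hk1, ⟨D, hD, hmax⟩, C, hC, hCs, hCc, hCmin⟩ :=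
      dp₁.seg.select hctx hcut hε happ hsub hT h1 h2 h3 hb₂
    have hg₃ : Grows s ((s₁.setI 23 k).setI 24 (k + 1)) :=
      (hgr.setI (by decide) (by decide)).setI (by decide) (by decide)
    have hB := hb.grows hg₃
    have hval : s₁.rarr 5 (k + 1) = s₁.heap.val (k + 1) := rfl
    have harr : s₁.rarr 4 = w := dp₁.arr
    have hle := hcut.le
    simp only [wp_iset, wp_ite, wp_skip]
    refine ⟨fun hc => ?_, fun hc => ?_⟩
    · simp [e10, e21, hval, harr] at hc
      have hs : ∑ j ∈ Ico (e₀ - 1) e₀, w j = w (e₀ - 1) := sum_Ico_pred (by omega)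
      simp
      refine newNode_spec hB (a' := e₀ - 1) (b' := e₀) (by decide) (by decide)
        (fun s' hs' => by simp [hs', e21]) (fun s' hs' => by simp [hs', e21]) ?_ (by omega) ?_
      · simp [harr, e21, hs]
      · intro s₄ T₄ hg₄ hreg _ h24 hlt₄ hrep₄ hT₄
        have e23 := hreg 23 (by decide) (by decide)
        simp at e23 h24 hlt₄ hrep₄
        refine h s₄ T₄ D (Ico (e₀ - 1) e₀) g (hg₃.trans hg₄) ⟨?_, by omega, ?_, by omega, hmax, Or.inl ⟨?_, ?_,
          fun C' hC' hc' => ?_⟩⟩ hg hg' ?_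
        · rw [e23]; exact hD.of_below hg₄.below h2
        · rwa [h24]
        · exact Ico_subset_Ico (by omega) hle
        · rw [hs]; exact hcut.big _ (by omega) (by omega)
        · rw [hs]
          rcases hCmin C' hC' hc' with h4 | h4
          · rw [← hC.val_eq] at h4
            exact hc.2.trans h4
          · have := hcut.sum_nonneg hC'
            nlinarith [h4.2]
        · simp at hT₄ hT₂
          rw [emitCost] at *
          rw [add_mul]
          omega
    · simp [e10, e21, hval, harr] at hc
      refine h _ _ D C g hg₃ ⟨by simpa using hD, by simpa using h2, by simpa using hC,
        by simpa using hk1, hmax, Or.inl ⟨hCs, hCc, fun C' hC' hc' => ?_⟩⟩ hg hg' ?_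
      · rcases hCmin C' hC' hc' with h4 | h4
        · exact h4
        · have h5 := hc h4.1
          rw [hC.val_eq] at h5
          have := hcut.sum_nonneg hC'
          nlinarith [h4.2]
      · simp at hT₂ ⊢
        rw [emitCost] at *
        rw [add_mul]
        omega
  · exact ⟨s₁.ireg 51, by simp, le_rfl, hlt, by rw [dp₁.seg.zero]; exact hc0, by simp⟩

/-- Choose the better one of the two candidates. -/
def pickBest : Prog :=
  .iset 40 (.reg 23) ;; spanProg ;; .rset 20 (.reg 42) ;; .iset 20 (.reg 23) ;;
  .iset 40 (.reg 24) ;; spanProg ;;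
  .ite (.rlt (.reg 42) (.reg 20)) (.rset 20 (.reg 42) ;; .iset 20 (.reg 24)) .skip

theorem pickBest_spec (hb : Base l w η q P s) (hi : s.ireg 10 = i) {D C : Finset ℕ}
    (hc : Cands w l i c ε s D C)
    (h : ∀ s' T' X, Grows s s' → s'.ireg 20 < s'.ireg 50 → s'.heap.Rep w (s'.ireg 20) X →
      s'.rreg 20 = spanVal q P (w 0) (w i) (w i + ∑ j ∈ X, w j) → (X = D ∨ X = C) →
      s'.rreg 20 ≤ spanVal q P (w 0) (w i) (w i + ∑ j ∈ D, w j) →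
      s'.rreg 20 ≤ spanVal q P (w 0) (w i) (w i + ∑ j ∈ C, w j) →
      T' ≤ T + 250 → Q s' T') : WP pickBest s T Q := by
  have g1 : Grows s (s.setI 40 (s.ireg 23)) := (Grows.refl s).setI (by decide) (by decide)
  simp only [pickBest, wp_seq, wp_iset, wp_rset]
  refine spanProg_spec (hb.grows g1) (i := i) (by simpa using hi) (k := s.ireg 23) (by simp) ?_
  intro s₁ T₁ hreg₁ hheap₁ hf₁ hv₁ hT₁
  have g2 : Grows s s₁ := g1.trans ⟨hf₁.mono (by decide), by rw [hreg₁]; simp, by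
    rw [hheap₁]; exact Heap.Below.refl _ _⟩
  have e23 : s₁.ireg 23 = s.ireg 23 := by rw [hreg₁]; simp
  have e24 : s₁.ireg 24 = s.ireg 24 := by rw [hreg₁]; simp
  have e50 : s₁.ireg 50 = s.ireg 50 := by rw [hreg₁]; simp
  have e10 : s₁.ireg 10 = i := by rw [hreg₁]; simpa using hi
  rw [State.setI_heap] at hv₁ hheap₁
  have g3 := ((g2.setR (x := 20) (v := s₁.rreg 42) (by decide)).setI (x := 20)
    (v := s.ireg 23) (by decide) (by decide)).setI (x := 40) (v := s.ireg 24) (by decide) (by decide)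
  simp only [RExp.eval, IExp.eval, State.setR_ireg, State.setI_ireg, e23, e24]
  refine spanProg_spec (hb.grows g3) (i := i) (by simpa using e10) (k := s.ireg 24) (by simp) ?_
  intro s₂ T₂ hreg₂ hheap₂ hf₂ hv₂ hT₂
  simp only [State.setI_heap, State.setR_heap, hheap₁] at hv₂ hheap₂
  have g4 : Grows s s₂ := g3.trans ⟨hf₂.mono (by decide), by rw [hreg₂]; simp, by
    rw [hheap₂, State.setI_heap, State.setI_heap, State.setR_heap, hheap₁]
    exact Heap.Below.refl _ _⟩
  have e20 : s₂.ireg 20 = s.ireg 23 := by rw [hreg₂]; simp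
  have e24' : s₂.ireg 24 = s.ireg 24 := by rw [hreg₂]; simp [e24]
  have e50' : s₂.ireg 50 = s.ireg 50 := by rw [hreg₂]; simp [e50]
  have f20 : s₂.rreg 20 = s₁.rreg 42 := by rw [hf₂.rreg 20 (by decide)]; simp
  rw [hc.rep_d.val_eq] at hv₁
  rw [hc.rep_c.val_eq] at hv₂
  rw [hv₁] at f20
  simp only [wp_ite, wp_seq, wp_rset, wp_iset, wp_skip]
  refine ⟨fun hlt => ?_, fun hlt => ?_⟩
  · simp [f20, hv₂] at hlt
    refine h _ _ C ((g4.setR (by decide)).setI (by decide) (by decide)) ?_ ?_ ?_ (Or.inr rfl) ?_ ?_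
      ?_
    · simp [e24', e50', hc.lt_c]
    · simp [e24', hheap₂, hc.rep_c]
    · simp [hv₂]
    · simpa [hv₂] using hlt.le
    · simp [hv₂]
    · simp at hT₁ hT₂ ⊢; omega
  · simp [f20, hv₂] at hlt
    refine h _ _ D g4 ?_ ?_ f20 (Or.inl rfl) f20.le ?_ ?_
    · rw [e20, e50']; exact hc.lt_d
    · rw [e20, hheap₂]; exact hc.rep_d
    · rw [f20]; exact hlt
    · simp at hT₁ hT₂ ⊢; omega

/-- The set `X` is a possible choice for the job `i`. -/
def Chosen (w : ℕ → ℝ) (l i : ℕ) (q P ε : ℝ) (X : Finset ℕ) : Prop :=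
  (q < 2 * w i ∧ X ⊆ Ico (i + 1) l) ∨
  (2 * w i ≤ q ∧ ∃ D C, KMax w l i (q - 2 * w i) ε D ∧
    (KMin w l i (q - 2 * w i) ε C ∨
      (C = D ∧ ∀ C' ⊆ Ico (i + 1) l, ∑ j ∈ C', w j ≤ q - 2 * w i)) ∧ (X = D ∨ X = C) ∧
    spanVal q P (w 0) (w i) (w i + ∑ j ∈ X, w j) ≤
      spanVal q P (w 0) (w i) (w i + ∑ j ∈ D, w j) ∧
    spanVal q P (w 0) (w i) (w i + ∑ j ∈ X, w j) ≤
      spanVal q P (w 0) (w i) (w i + ∑ j ∈ C, w j))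

theorem Chosen.subset {X : Finset ℕ} (h : Chosen w l i q P ε X) : X ⊆ Ico (i + 1) l := by
  rcases h with h | ⟨-, D, C, hD, hC, hX, -⟩
  · exact h.2
  · rcases hX with rfl | rfl
    · exact hD.1
    · rcases hC with hC | ⟨rfl, -⟩
      · exact hC.1
      · exact hD.1

/-- Compute a node `ireg 20` and the makespan `rreg 20` for the job `ireg 10`. -/
def solveJob : Prog :=
  .rset 21 (.sub (.reg 1) (.mul (.ofInt (.lit 2)) (.get 4 (.reg 10)))) ;;
  .ite (.rlt (.reg 21) (.ofInt (.lit 0)))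
    (.iset 20 (.lit 0) ;; .iset 40 (.lit 0) ;; spanProg ;; .rset 20 (.reg 42))
    (findCut ;; .ite (.rle (.reg 22) (.reg 21)) solveAll solveSome ;; pickBest)

/-- For `2 p_i > q_n` every set is admissible, so the empty set, stored in node `0`, is taken
without running the dynamic program. -/
theorem solveJob_spec (hd : Data l w η N K) (hb : Base l w η q P s) (hi : s.ireg 10 = i)
    (hil : i < l) (hε : 8 * η ≤ ε)
    (h : ∀ s' T' X g, Grows s s' → s'.ireg 20 < s'.ireg 50 → s'.heap.Rep w (s'.ireg 20) X →
      s'.rreg 20 = spanVal q P (w 0) (w i) (w i + ∑ j ∈ X, w j) → Chosen w l i q P ε X → g ≤ l →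
      g ≤ K * (4 * N + 4) + (N + 1) →
      T' ≤ T + (l * 240 + (g + 1) * (emitCost N + 40) + 700) → Q s' T') :
    WP solveJob s T Q := by
  have hη := hd.η_pos
  have g1 : Grows s (s.setR 21 (q - 2 * w i)) := (Grows.refl s).setR (by decide)
  simp only [solveJob, wp_seq, wp_rset]
  have hev : (RExp.sub (.reg 1) (.mul (.ofInt (.lit 2)) (.get 4 (.reg 10)))).eval s =
      q - 2 * w i := by simp [hb.r1, hb.arr, hi]
  rw [hev, wp_ite]
  refine ⟨fun hlt => ?_, fun hlt => ?_⟩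
  · simp at hlt
    simp only [wp_seq, wp_iset, wp_rset]
    have g2 := (g1.setI (x := 20) (v := 0) (by decide) (by decide)).setI (x := 40) (v := 0)
      (by decide) (by decide)
    refine spanProg_spec (hb.grows g2) (i := i) (by simpa using hi) (k := 0) (by simp) ?_
    intro s₁ T₁ hreg₁ hheap₁ hf₁ hv₁ hT₁
    simp only [State.setI_heap, State.setR_heap] at hv₁ hheap₁
    have e20 : s₁.ireg 20 = 0 := by rw [hreg₁]; simp
    have e50 : s₁.ireg 50 = s.ireg 50 := by rw [hreg₁]; simp
    refine h _ _ ∅ 0 (g2.trans ⟨(hf₁.mono (by decide)).setR (by decide), by simp [hreg₁], ?_⟩)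
      ?_ ?_ ?_ (Or.inl ⟨hlt, by simp⟩) (by omega) (by omega) ?_
    · simp [hheap₁, Heap.Below.refl]
    · simp [e20, e50, hb.hp]
    · simp [e20, hheap₁, hb.root]
    · simp [hv₁, hb.root.val_eq]
    · simp at hT₁ ⊢; omega
  · simp at hlt
    simp only [wp_seq]
    have hB := hb.grows g1
    refine findCut_spec hB hd.pos hd.anti (by simpa using hi) hil ?_
    intro s₂ T₂ e₀ g2 he₂ hr₂ hT0 hcut hT₂
    simp at hr₂ hcut
    have g2' := g1.trans g2
    have hB₂ := hb.grows g2'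
    have e10 : s₂.ireg 10 = i := (g2'.frame.ireg 10 (by decide)).trans hi
    have fin : ∀ s₃ T₃ D C g, Grows s₂ s₃ → Cands w l i (q - 2 * w i) ε s₃ D C → g ≤ l →
        g ≤ K * (4 * N + 4) + (N + 1) →
        T₃ ≤ T₂ + (l * 200 + (g + 1) * (emitCost N + 40) + 250) → WP pickBest s₃ T₃ Q := by
      intro s₃ T₃ D C g g3 hc hg hg' hT₃
      have g3' := g2'.trans g3
      refine pickBest_spec (hb.grows g3') ((g3'.frame.ireg 10 (by decide)).trans hi) hc ?_
      intro s₄ T₄ X g4 hlt₄ hrep₄ hv₄ hX h5 h6 hT₄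
      refine h s₄ T₄ X g (g3'.trans g4) hlt₄ hrep₄ hv₄ (Or.inr ⟨hlt, D, C, hc.kmax, hc.kmin, hX,
        ?_, ?_⟩) hg hg' ?_
      · rwa [← hv₄]
      · rwa [← hv₄]
      · simp only [BExp.rlt, BExp.cost, RExp.cost, IExp.cost] at hT₂
        generalize (g + 1) * (emitCost N + 40) = G at *
        linarith
    rw [wp_ite]
    refine ⟨fun hle => ?_, fun hle => ?_⟩
    · simp [hT0, hr₂] at hle
      refine solveAll_spec (ε := ε) hB₂ e10 he₂ hcut (by linarith) hT0 hle ?_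
      intro s₃ T₃ D C g3 hc hT₃
      refine fin s₃ T₃ D C 0 g3 hc (by omega) (by omega) ?_
      simp at hT₃; omega
    · simp only [BExp.Holds, RExp.eval, hT0, hr₂, not_le] at hle
      refine solveSome_spec hd hB₂ e10 he₂ hr₂ hcut hε (by linarith) hle ?_
      intro s₃ T₃ D C g g3 hc hg hg' hT₃
      refine fin s₃ T₃ D C g g3 hc hg hg' ?_
      simp only [BExp.cost, RExp.cost] at hT₃; omega

end Solve

/-! ### The loop over all jobs `i`. -/

section Search

open Finset

variable {w : ℕ → ℝ} {l k : ℕ} {η ε q P : ℝ} {N K : ℕ} {s : State} {T : ℕ}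
  {Q : State → ℕ → Prop}

/-- The jobs from `1` on and before `k` have been treated, with the choices `f`. The best job so
far is in the register `11` (`0` if none beats the value `2 q + P`), its node in the
register `12`. -/
structure Best (w : ℕ → ℝ) (l k : ℕ) (q P ε : ℝ) (f : ℕ → Finset ℕ) (s : State) : Prop where
  chosen : ∀ j, 0 < j → j < k → Chosen w l j q P ε (f j)
  le : ∀ j, 0 < j → j < k → s.rreg 10 ≤ spanVal q P (w 0) (w j) (w j + ∑ i ∈ f j, w i)
  le_start : s.rreg 10 ≤ 2 * q + P
  attained : (s.ireg 11 = 0 ∧ s.rreg 10 = 2 * q + P) ∨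
    (0 < s.ireg 11 ∧ s.ireg 11 < k ∧ s.heap.Rep w (s.ireg 12) (f (s.ireg 11)) ∧
      s.ireg 12 < s.ireg 50 ∧ s.rreg 10 =
        spanVal q P (w 0) (w (s.ireg 11)) (w (s.ireg 11) + ∑ i ∈ f (s.ireg 11), w i))

/-- Search for the best job and the best node. -/
def search : Prog :=
  .rset 10 (.add (.mul (.ofInt (.lit 2)) (.reg 1)) (.reg 2)) ;; .iset 11 (.lit 0) ;;
  .iset 10 (.lit 1) ;;
  .loop (.ilt (.reg 10) (.reg 1))
    (solveJob ;;
      .ite (.rlt (.reg 20) (.reg 10))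
        (.rset 10 (.reg 20) ;; .iset 11 (.reg 10) ;; .iset 12 (.reg 20)) .skip ;;
      .inc 10)

/-- A bound for the number of steps that are spent on one job. -/
def jobCost (l N K : ℕ) : ℕ :=
  l * 240 + (min l (K * (4 * N + 4) + (N + 1)) + 1) * (emitCost N + 40) + 800

/-- The value `0` of the register `11` can stand for `sched231`, since the first job is never a
candidate for `i`. The node of the best choice so far survives, because later runs write only at
positions that were free at their start. -/
theorem search_spec (hd : Data l w η N K) (hb : Base l w η q P s) (hl : 0 < l) (hε : 8 * η ≤ ε)
    (h : ∀ s' T' f, Frame 10 s s' → Best w l l q P ε f s' →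
      T' ≤ T + (l * jobCost l N K + 40) → Q s' T') : WP search s T Q := by
  simp only [search, wp_seq, wp_rset, wp_iset]
  apply WP.loop (Inv := fun s' T' => ∃ f k, Frame 10 s s' ∧ Base l w η q P s' ∧ s'.ireg 10 = k ∧
      0 < k ∧ k ≤ l ∧ Best w l k q P ε f s' ∧ T' ≤ T + ((k - 1) * jobCost l N K + 20))
    (m := fun s' => l - s'.ireg 10)
  · rintro s₁ T₁ ⟨f, k, hf, hB, hk, hk0, hkl, hbest, hT₁⟩ hb₁
    simp [hk, hB.i1] at hb₁
    simp only [wp_seq]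
    refine solveJob_spec hd hB hk hb₁ hε ?_
    intro s₂ T₂ X g g2 hlt hrep hv hX hg hg' hT₂
    have hB₂ := hB.grows g2
    have e10 : s₂.ireg 10 = k := (g2.frame.ireg 10 (by decide)).trans hk
    have e11 : s₂.ireg 11 = s₁.ireg 11 := g2.frame.ireg 11 (by decide)
    have e12 : s₂.ireg 12 = s₁.ireg 12 := g2.frame.ireg 12 (by decide)
    have f10 : s₂.rreg 10 = s₁.rreg 10 := g2.frame.rreg 10 (by decide)
    have hfr : Frame 10 s s₂ := hf.trans (g2.frame.mono (by decide))
    have hupd : ∀ j, j < k → Function.update f k X j = f j := fun j hj =>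
      Function.update_of_ne (by omega) _ _
    have hT : T₂ + 36 ≤ T + (k * jobCost l N K + 20) := by
      have h1 : (g + 1) * (emitCost N + 40) ≤
          (min l (K * (4 * N + 4) + (N + 1)) + 1) * (emitCost N + 40) :=
        Nat.mul_le_mul_right _ (by omega)
      have h2 : k * jobCost l N K = (k - 1) * jobCost l N K + jobCost l N K := by
        rw [← Nat.succ_mul, Nat.succ_eq_add_one, Nat.sub_add_cancel hk0]
      have h3 : jobCost l N K = l * 240 +
        (min l (K * (4 * N + 4) + (N + 1)) + 1) * (emitCost N + 40) + 800 := rfl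
      rw [h2]
      simp only [BExp.ilt, BExp.cost, IExp.cost] at hT₂
      linarith
    have hchosen : ∀ j, 0 < j → j < k + 1 → Chosen w l j q P ε (Function.update f k X j) := by
      intro j hj hj'
      rcases Nat.lt_succ_iff_lt_or_eq.1 hj' with h4 | rfl
      · rw [hupd j h4]; exact hbest.chosen j hj h4
      · simpa using hX
    simp only [wp_ite, wp_seq, wp_rset, wp_iset, wp_skip, Prog.inc]
    refine ⟨fun hc => ?_, fun hc => ?_⟩
    · simp [f10] at hc
      refine ⟨⟨Function.update f k X, k + 1, ?_, ?_, ?_, by omega, by omega,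
        ⟨hchosen, fun j hj hj' => ?_, ?_, Or.inr ⟨?_, ?_, ?_, ?_, ?_⟩⟩, ?_⟩, ?_⟩
      · exact (((hfr.setR (by decide)).setI (by decide)).setI (by decide)).setI (by decide)
      · exact ⟨by simpa using hB₂.i1, by simpa using hB₂.r1, by simpa using hB₂.r2,
          by simpa using hB₂.r3, by simpa using hB₂.arr, by simpa using hB₂.hp,
          by simpa using hB₂.root⟩
      · simp [e10]
      · simp
        rcases Nat.lt_succ_iff_lt_or_eq.1 hj' with h4 | rfl
        · rw [hupd j h4]; exact hc.le.trans (hbest.le j hj h4)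
        · simpa using hv.le
      · simpa using hc.le.trans hbest.le_start
      · simp [e10, hk0]
      · simp [e10]
      · simpa [e10] using hrep
      · simpa using hlt
      · simpa [e10] using hv
      · simp; omega
      · simp [e10, hk]; omega
    · simp [f10] at hc
      refine ⟨⟨Function.update f k X, k + 1, hfr.setI (by decide), ?_, ?_, by omega, by omega,
        ⟨hchosen, fun j hj hj' => ?_, ?_, ?_⟩, ?_⟩, ?_⟩
      · exact ⟨by simpa using hB₂.i1, by simpa using hB₂.r1, by simpa using hB₂.r2,
          by simpa using hB₂.r3, by simpa using hB₂.arr, by simpa using hB₂.hp,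
          by simpa using hB₂.root⟩
      · simp [e10]
      · simp [f10]
        rcases Nat.lt_succ_iff_lt_or_eq.1 hj' with h4 | rfl
        · rw [hupd j h4]; exact hbest.le j hj h4
        · rw [hv] at hc; simpa using hc
      · simpa [f10] using hbest.le_start
      · rcases hbest.attained with ⟨h1, h2⟩ | ⟨h1, h2, h3, h4, h5⟩
        · exact Or.inl ⟨by simp [e11, h1], by simp [f10, h2]⟩
        · refine Or.inr ⟨by simpa [e11], by simp [e11]; omega, ?_, ?_, ?_⟩
          · simp [e11, e12, hupd _ h2]
            exact h3.of_below g2.below h4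
          · simp [e12]
            exact h4.trans_le g2.le
          · simp [e11, f10, hupd _ h2]
            exact h5
      · simp; omega
      · simp [e10, hk]; omega
  · rintro s₁ T₁ ⟨f, k, hf, hB, hk, hk0, hkl, hbest, hT₁⟩ hb₁
    simp [hk, hB.i1] at hb₁
    obtain rfl : k = l := by omega
    refine h s₁ _ f hf hbest ?_
    have := Nat.mul_le_mul_right (jobCost k N K) (Nat.sub_le k 1)
    simp; omega
  · refine ⟨fun _ => ∅, 1, ?_, ?_, by simp, by omega, by omega, ⟨fun j _ _ => by omega,
      fun j _ _ => by omega, ?_, Or.inl ⟨?_, ?_⟩⟩, ?_⟩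
    · exact ((((Frame.refl 10 s).setR (by decide)).setI (by decide)).setI (by decide))
    · exact ⟨by simpa using hb.i1, by simpa using hb.r1, by simpa using hb.r2,
          by simpa using hb.r3, by simpa using hb.arr, by simpa using hb.hp,
          by simpa using hb.root⟩
    · simp [hb.r1, hb.r2]
    · simp
    · simp [hb.r1, hb.r2]
    · simp

end Search

/-! ### Reading the input, sorting, and setting the parameters. -/

section Preparation

open Finset

variable {l : ℕ} {ε : ℝ} {s : State} {T : ℕ} {Q : State → ℕ → Prop}

/-- The processing times of the flow-shop jobs as a sequence. -/
noncomputable def Inst.seq (I : Inst l 1) (k : ℕ) : ℝ := if h : k < l then I.p ⟨k, h⟩ else 0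

theorem Inst.seq_val (I : Inst l 1) (j : Fin l) : I.seq j = I.p j := by simp [Inst.seq]

/-- The input has been read, the integer array `0` holds the permutation `e`, and the arrays
for the heap and the marks are empty. -/
structure Loaded (I : Inst l 1) (ε : ℝ) (e : Equiv.Perm (Fin l)) (s : State) : Prop where
  i1 : s.ireg 1 = l
  r0 : s.rreg 0 = ε
  r1 : s.rreg 1 = I.qn
  arr : ∀ j : Fin l, s.rarr 0 j = I.p j
  perm : ∀ j : Fin l, s.iarr 0 j = e j
  arr4 : s.rarr 4 = fun _ => 0
  heap : s.heap = ⟨fun _ => 0, fun _ => 0, fun _ => 0, fun _ => 0⟩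
  marks : s.iarr 4 = fun _ => 0

theorem Loaded.setI {I : Inst l 1} {e : Equiv.Perm (Fin l)} (h : Loaded I ε e s) {x v : ℕ}
    (hx : 1 ≠ x) : Loaded I ε e (s.setI x v) :=
  ⟨by simpa [hx] using h.i1, h.r0, h.r1, h.arr, h.perm, h.arr4, h.heap, h.marks⟩

/-- Read the input. -/
def load : Prog :=
  .iset 1 (.sub (.reg 0) (.lit 1)) ;; .rset 1 (.get 0 (.reg 1)) ;; .iset 2 (.lit 0) ;;
  .loop (.ilt (.reg 2) (.reg 1)) (.iput 0 (.reg 2) (.reg 2) ;; .inc 2)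

theorem load_spec (I : Inst l 1)
    (h : ∀ s' T', Loaded I ε (Equiv.refl _) s' → T' ≤ T + (20 * l + 30) → Q s' T') :
    WP load (inputState ε I) T Q := by
  simp only [load, wp_seq, wp_iset, wp_rset]
  apply WP.loop (Inv := fun s' T' => ∃ k, k ≤ l ∧ s'.ireg 1 = l ∧ s'.ireg 2 = k ∧ s'.rreg 0 = ε ∧
    s'.rreg 1 = I.qn ∧ s'.rarr = (inputState ε I).rarr ∧ (∀ j < k, s'.iarr 0 j = j) ∧
    (∀ a, a ≠ 0 → s'.iarr a = fun _ => 0) ∧ T' ≤ T + (20 * k + 15)) (m := fun s' => l - s'.ireg 2)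
  · rintro s₁ T₁ ⟨k, hk, h1, h2, h3, h4, h5, h6, h7, hT⟩ hb
    simp [h1, h2] at hb
    simp only [wp_seq, wp_iput, Prog.inc, wp_iset]
    refine ⟨⟨k + 1, by omega, by simpa using h1, by simp [h2], h3, h4, h5, fun j hj => ?_,
      fun a ha => by simp [ha, h7 a ha], ?_⟩, ?_⟩
    · simp [h2, Function.update_apply]
      rcases Nat.lt_succ_iff_lt_or_eq.1 hj with h8 | rfl
      · rw [h6 j h8]; simp; omega
      · simp
    · simp; omega
    · simp [h2]; omega
  · rintro s₁ T₁ ⟨k, hk, h1, h2, h3, h4, h5, h6, h7, hT⟩ hb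
    simp [h1, h2] at hb
    obtain rfl : k = l := by omega
    refine h _ _ ⟨h1, h3, h4, fun j => by simp [h5, inputState], fun j => by simp [h6], ?_, ?_,
      h7 4 (by decide)⟩ (by simp; omega)
    · rw [h5]; simp [inputState]
    · rw [State.heap, h5, h7 1 (by decide), h7 2 (by decide), h7 3 (by decide)]
      simp [inputState]
  · refine ⟨0, by omega, ?_⟩
    simp [inputState]

/-- Sort the jobs by decreasing processing times. -/
def sort : Prog :=
  .iset 2 (.lit 0) ;;
  .loop (.ilt (.reg 2) (.reg 1))
    (.iset 3 (.add (.reg 2) (.lit 1)) ;;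
      .loop (.ilt (.reg 3) (.reg 1))
        (.ite (.rlt (.get 0 (.get 0 (.reg 2))) (.get 0 (.get 0 (.reg 3))))
          (.iset 4 (.get 0 (.reg 2)) ;; .iput 0 (.reg 2) (.get 0 (.reg 3)) ;;
            .iput 0 (.reg 3) (.reg 4)) .skip ;;
          .inc 3) ;;
      .inc 2)

/-- An exchange sort is fast enough: its quadratic cost is absorbed by the term `n²` of the time
bound. -/
theorem sort_spec {I : Inst l 1} {e : Equiv.Perm (Fin l)} (hs : Loaded I ε e s)
    (h : ∀ s' T' e', Loaded I ε e' s' → Antitone (I.p ∘ e') → T' ≤ T + (l * (50 * l + 50) + 20) →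
      Q s' T') : WP sort s T Q := by
  simp only [sort, wp_seq, wp_iset]
  apply WP.loop (Inv := fun s' T' => ∃ k e', k ≤ l ∧ s'.ireg 2 = k ∧ Loaded I ε e' s' ∧
    (∀ a b : Fin l, a < b → a.val < k → I.p (e' b) ≤ I.p (e' a)) ∧
    T' ≤ T + (k * (50 * l + 50) + 10)) (m := fun s' => l - s'.ireg 2)
  · rintro s₁ T₁ ⟨k, e₁, hk, h2, hL, hord, hT⟩ hb
    simp [hL.i1, h2] at hb
    simp only [wp_seq, wp_iset]
    apply WP.loop (Inv := fun s' T' => ∃ m e', k < m ∧ m ≤ l ∧ s'.ireg 2 = k ∧ s'.ireg 3 = m ∧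
      Loaded I ε e' s' ∧ (∀ a b : Fin l, a < b → a.val < k → I.p (e' b) ≤ I.p (e' a)) ∧
      (∀ b : Fin l, k < b.val → b.val < m → I.p (e' b) ≤ I.p (e' ⟨k, hb⟩)) ∧
      T' ≤ T + (k * (50 * l + 50) + 50 * m + 30)) (m := fun s' => l - s'.ireg 3)
    · rintro s₂ T₂ ⟨m, e₂, hkm, hml, h2, h3, hL, hord, hk', hT⟩ hb₂
      simp [hL.i1, h3] at hb₂
      have pk := hL.perm ⟨k, hb⟩
      have pm := hL.perm ⟨m, hb₂⟩
      have ak := hL.arr (e₂ ⟨k, hb⟩)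
      have am := hL.arr (e₂ ⟨m, hb₂⟩)
      simp only at pk pm
      have hne : (⟨k, hb⟩ : Fin l) ≠ ⟨m, hb₂⟩ := by simp; omega
      simp only [wp_seq, wp_ite, wp_iset, wp_iput, wp_skip, Prog.inc]
      refine ⟨fun hc => ?_, fun hc => ?_⟩
      · simp [h2, h3, pk, pm, ak, am] at hc
        refine ⟨⟨m + 1, (Equiv.swap ⟨k, hb⟩ ⟨m, hb₂⟩).trans e₂, by omega, by omega, by simp [h2],
          by simp [h3], ⟨by simpa using hL.i1, hL.r0, hL.r1, hL.arr, fun j => ?_, hL.arr4, ?_, ?_⟩,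
          fun a b hab ha => ?_, fun b hb1 hb2 => ?_, ?_⟩, ?_⟩
        · simp [h2, h3, Function.update_apply, Equiv.swap_apply_def, Fin.ext_iff]
          by_cases hjm : j.val = m
          · have : j.val ≠ k := by omega
            simp [hjm, pk, show m ≠ k by omega]
          · by_cases hjk : j.val = k
            · simp [hjk, pm, show k ≠ m by omega]
            · simp [hjm, hjk, hL.perm]
        · rw [← hL.heap]; simp [State.heap]
        · simpa using hL.marks
        · have ha1 : a ≠ ⟨k, hb⟩ := by rw [Ne, Fin.ext_iff]; simp; omega
          have ha2 : a ≠ ⟨m, hb₂⟩ := by rw [Ne, Fin.ext_iff]; simp; omega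
          have hab' := hab
          rw [Fin.lt_def] at hab'
          simp only [Equiv.trans_apply]
          rw [Equiv.swap_apply_of_ne_of_ne ha1 ha2]
          by_cases hb1 : b = ⟨k, hb⟩
          · rw [hb1, Equiv.swap_apply_left]
            exact hord a _ (by rw [Fin.lt_def]; simp; omega) ha
          by_cases hb2 : b = ⟨m, hb₂⟩
          · rw [hb2, Equiv.swap_apply_right]
            exact hord a _ (by rw [Fin.lt_def]; simp; omega) ha
          rw [Equiv.swap_apply_of_ne_of_ne hb1 hb2]
          exact hord a b hab ha
        · simp only [Equiv.trans_apply]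
          rw [Equiv.swap_apply_left]
          have hbk : b ≠ ⟨k, hb⟩ := by rw [Ne, Fin.ext_iff]; simp; omega
          by_cases hbm : b = ⟨m, hb₂⟩
          · rw [hbm, Equiv.swap_apply_right]; exact hc.le
          rw [Equiv.swap_apply_of_ne_of_ne hbk hbm]
          have : b.val ≠ m := fun h' => hbm (Fin.ext h')
          exact (hk' b hb1 (by omega)).trans hc.le
        · simp; omega
        · simp [h3]; omega
      · simp [h2, h3, pk, pm, ak, am] at hc
        refine ⟨⟨m + 1, e₂, by omega, by omega, by simp [h2], by simp [h3], hL.setI (by decide),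
          hord, fun b hb1 hb2 => ?_, ?_⟩, ?_⟩
        · rcases Nat.lt_succ_iff_lt_or_eq.1 hb2 with h4 | h4
          · exact hk' b hb1 h4
          · obtain rfl : b = ⟨m, hb₂⟩ := Fin.ext h4
            exact hc
        · simp; omega
        · simp [h3]; omega
    · rintro s₂ T₂ ⟨m, e₂, hkm, hml, h2, h3, hL, hord, hk', hT⟩ hb₂
      simp [hL.i1, h3] at hb₂
      obtain rfl : m = l := by omega
      simp only [Prog.inc, wp_iset]
      refine ⟨⟨k + 1, e₂, by omega, by simp [h2], hL.setI (by decide), fun a b hab ha => ?_, ?_⟩, ?_⟩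
      · rcases Nat.lt_succ_iff_lt_or_eq.1 ha with h4 | h4
        · exact hord a b hab h4
        · obtain rfl : a = ⟨k, hb⟩ := Fin.ext h4
          exact hk' b hab b.isLt
      · simp; nlinarith
      · simp [h2]; omega
    · refine ⟨k + 1, e₁, by omega, by omega, by simp [h2], by simp [h2], hL.setI (by decide), hord,
        fun b _ _ => by omega, ?_⟩
      simp; omega
  · rintro s₁ T₁ ⟨k, e₁, hk, h2, hL, hord, hT⟩ hb
    simp [hL.i1, h2] at hb
    obtain rfl : k = l := by omega
    refine h s₁ _ e₁ hL (fun a b hab => ?_) (by simp; omega)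
    rcases hab.lt_or_eq with h4 | rfl
    · exact hord a b h4 a.isLt
    · exact le_rfl
  · exact ⟨0, e, by omega, by simp, hs.setI (by decide), fun a b _ ha => by omega, by simp⟩

/-- All data are prepared; `e` is the sorting permutation. -/
structure Prepared (I : Inst l 1) (ε : ℝ) (e : Equiv.Perm (Fin l)) (s : State) : Prop where
  base : Base l (I.relabel e).seq (min ε 1 / 8) I.qn (I.P univ) s
  perm : ∀ j : Fin l, s.iarr 0 j = e j
  anti : Antitone (I.p ∘ e)
  marks : s.iarr 4 = fun _ => 0

/-- Copy the sorted processing times and compute the parameters. -/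
def prepare : Prog :=
  .iset 2 (.lit 0) ;; .rset 2 (.ofInt (.lit 0)) ;;
  .loop (.ilt (.reg 2) (.reg 1))
    (.rput 4 (.reg 2) (.get 0 (.get 0 (.reg 2))) ;; .rset 2 (.add (.reg 2) (.get 4 (.reg 2))) ;;
      .inc 2) ;;
  .rset 3 (.ofInt (.lit 1)) ;; .ite (.rle (.reg 0) (.ofInt (.lit 1))) (.rset 3 (.reg 0)) .skip ;;
  .rset 3 (.div (.reg 3) (.ofInt (.lit 8))) ;; .iset 50 (.lit 1)

/-- The precision `min ε 1 / 8` satisfies `8 η ≤ ε` as well as `η ≤ 1 / 8` when `ε` is large. -/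
theorem prepare_spec {I : Inst l 1} {e : Equiv.Perm (Fin l)} (hs : Loaded I ε e s)
    (ha : Antitone (I.p ∘ e))
    (h : ∀ s' T', Prepared I ε e s' → T' ≤ T + (40 * l + 60) → Q s' T') :
    WP prepare s T Q := by
  rw [prepare, wp_seq, wp_iset, wp_seq, wp_rset, wp_seq]
  apply WP.loop (Inv := fun s' T' => ∃ k, k ≤ l ∧ s'.ireg 2 = k ∧ s'.ireg 1 = l ∧ s'.rreg 0 = ε ∧
    s'.rreg 1 = I.qn ∧ s'.rarr 0 = s.rarr 0 ∧ s'.iarr = s.iarr ∧ s'.heap = s.heap ∧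
    (s'.rarr 4 = fun j => if j < k then (I.relabel e).seq j else 0) ∧
    s'.rreg 2 = ∑ j ∈ range k, (I.relabel e).seq j ∧ T' ≤ T + (40 * k + 20))
    (m := fun s' => l - s'.ireg 2)
  · rintro s₁ T₁ ⟨k, hk, h1, h2, h3, h4, h5, h6, h7, h8, h9, hT⟩ hb
    simp [h1, h2] at hb
    have hval : s₁.rarr 0 (s₁.iarr 0 k) = (I.relabel e).seq k := by
      rw [h5, h6, hs.perm ⟨k, hb⟩, hs.arr, Inst.seq, dif_pos hb]
      rfl
    simp only [wp_seq, wp_rput, wp_rset, wp_iset, Prog.inc]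
    refine ⟨⟨k + 1, by omega, by simp [h1], by simpa using h2, by simpa using h3, by simpa using h4,
      by simpa using h5, h6, ?_, ?_, ?_, ?_⟩, ?_⟩
    · rw [← h7]; simp [State.heap]
    · funext j
      simp [h1, hval, h8, Function.update_apply]
      by_cases hj : j = k
      · simp [hj]
      · simp [hj, show j ≤ k ↔ j < k by omega]
    · simp [h1, hval, h9, sum_range_succ]
    · simp; omega
    · simp [h1]; omega
  · rintro s₁ T₁ ⟨k, hk, h1, h2, h3, h4, h5, h6, h7, h8, h9, hT⟩ hb
    simp [h1, h2] at hb
    obtain rfl : k = l := by omega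
    have hsum : ∑ j ∈ range k, (I.relabel e).seq j = I.P univ := by
      rw [← Fin.sum_univ_eq_sum_range, Inst.P, ← Equiv.sum_comp e I.p]
      exact sum_congr rfl fun j _ => by rw [Inst.seq_val]; rfl
    have harr : s₁.rarr 4 = (I.relabel e).seq := by
      rw [h8]
      funext j
      split_ifs with hj
      · rfl
      · simp [Inst.seq, hj]
    have fin : ∀ s₂ T₂, s₂.rarr = s₁.rarr → s₂.iarr = s₁.iarr → s₂.ireg 1 = k → s₂.rreg 1 = I.qn →
        s₂.rreg 2 = I.P univ → s₂.rreg 3 = min ε 1 → T₂ ≤ T + (40 * k + 50) →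
        WP (.rset 3 (.div (.reg 3) (.ofInt (.lit 8))) ;; .iset 50 (.lit 1)) s₂ T₂ Q := by
      intro s₂ T₂ g1 g2 g3 g4 g5 g6 g7
      have hheap : s₂.heap = s.heap := by rw [← h7, State.heap, g1, g2]; rfl
      simp only [wp_seq, wp_rset, wp_iset]
      refine h _ _ ⟨⟨by simpa using g3, by simpa using g4, by simpa using g5, by simp [g6],
        by simp [g1, harr], by simp, ?_⟩, fun j => by simp [g2, h6, hs.perm], ha,
        by simp [g2, h6, hs.marks]⟩ (by simp; omega)
      refine .nil 0 ?_ ?_ <;> simp [hheap, hs.heap]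
    rw [wp_seq, wp_rset, wp_seq, wp_ite]
    refine ⟨fun hc => ?_, fun hc => ?_⟩
    · simp [h3] at hc
      rw [wp_rset]
      refine fin _ _ ?_ ?_ ?_ ?_ ?_ ?_ ?_
      · rfl
      · rfl
      · simpa using h2
      · simpa using h4
      · simp [h9, hsum]
      · simp [h3, hc]
      · simp; omega
    · simp [h3] at hc
      rw [wp_skip]
      refine fin _ _ ?_ ?_ ?_ ?_ ?_ ?_ ?_
      · rfl
      · rfl
      · simpa using h2
      · simpa using h4
      · simp [h9, hsum]
      · simp [hc.le]
      · simp; omega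
  · refine ⟨0, by omega, by simp, by simpa using hs.i1, by simpa using hs.r0, by simpa using hs.r1,
      rfl, rfl, rfl, by simp [hs.arr4], by simp, by simp⟩

end Preparation

/-! ### Expanding a node into a set and writing the start times. -/

section Output

open Finset

variable {l : ℕ} {s : State} {T : ℕ} {Q : State → ℕ → Prop} {w : ℕ → ℝ}

/-- Mark the job `ireg 11` and the jobs of the node `ireg 12`. -/
def mark : Prog :=
  .iput 4 (.reg 11) (.lit 1) ;; .iset 2 (.reg 12) ;;
  .loop (.ilt (.get 1 (.reg 2)) (.get 2 (.reg 2)))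
    (.iset 3 (.get 1 (.reg 2)) ;;
      .loop (.ilt (.reg 3) (.get 2 (.reg 2))) (.iput 4 (.reg 3) (.lit 1) ;; .inc 3) ;;
      .iset 2 (.get 3 (.reg 2)))

/-- The states differ only in the marks and in the registers `2` and `3`. -/
structure Marking (s s' : State) : Prop where
  ireg : ∀ x, x ≠ 2 → x ≠ 3 → s'.ireg x = s.ireg x
  rreg : s'.rreg = s.rreg
  rarr : s'.rarr = s.rarr
  iarr : ∀ a, a ≠ 4 → s'.iarr a = s.iarr a

theorem Marking.setI {s' : State} (h : Marking s s') {x v : ℕ} (hx : x = 2 ∨ x = 3) :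
    Marking s (s'.setI x v) :=
  ⟨fun y h2 h3 => by simp [show y ≠ x by omega, h.ireg y h2 h3], h.rreg, h.rarr, h.iarr⟩

theorem Marking.putI {s' : State} (h : Marking s s') {i v : ℕ} : Marking s (s'.putI 4 i v) :=
  ⟨h.ireg, h.rreg, h.rarr, fun a ha => by simp [ha, h.iarr a ha]⟩

/-- The intervals on the way to the root are disjoint and nonempty, so the work is proportional to
the size of the set. Parents have smaller numbers, which gives termination. -/
theorem mark_spec {X₀ : Finset ℕ} (hm : s.iarr 4 = fun _ => 0)
    (hr : s.heap.Rep w (s.ireg 12) X₀)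
    (h : ∀ s' T', Marking s s' →
      (s'.iarr 4 = fun j => if j ∈ insert (s.ireg 11) X₀ then 1 else 0) →
      T' ≤ T + (60 * X₀.card + 30) → Q s' T') : WP mark s T Q := by
  have hM : Marking s s := ⟨fun _ _ _ => rfl, rfl, rfl, fun _ _ => rfl⟩
  simp only [mark, wp_seq, wp_iput, wp_iset]
  apply WP.loop (Inv := fun s' T' => Marking s s' ∧ ∃ k X, s'.ireg 2 = k ∧ s.heap.Rep w k X ∧
    X ⊆ X₀ ∧ (s'.iarr 4 = fun j => if j = s.ireg 11 ∨ j ∈ X₀ \ X then 1 else 0) ∧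
    T' + 60 * X.card ≤ T + 60 * X₀.card + 10) (m := fun s' => s'.ireg 2)
  · rintro s₁ T₁ ⟨hM₁, k, X, hk, hX, hsub, hmarks, hT⟩ hb
    have hfst : ∀ s₂ : State, Marking s s₂ → s₂.iarr 1 = s.heap.fst := fun s₂ h₂ =>
      h₂.iarr 1 (by decide)
    have hlst : ∀ s₂ : State, Marking s s₂ → s₂.iarr 2 = s.heap.lst := fun s₂ h₂ =>
      h₂.iarr 2 (by decide)
    have hpar : ∀ s₂ : State, Marking s s₂ → s₂.iarr 3 = s.heap.par := fun s₂ h₂ =>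
      h₂.iarr 3 (by decide)
    simp [hk, hfst s₁ hM₁, hlst s₁ hM₁] at hb
    cases hX with
    | nil _ h1 => omega
    | cons _ Y hlt hp hY hd hv =>
    have hcard : (Y ∪ Ico (s.heap.fst k) (s.heap.lst k)).card =
        Y.card + (s.heap.lst k - s.heap.fst k) := by
      rw [card_union_of_disjoint hd, Nat.card_Ico]
    rw [hcard] at hT
    simp only [wp_seq, wp_iset]
    apply WP.loop (Inv := fun s' T' => Marking s s' ∧ ∃ m, s'.ireg 2 = k ∧ s'.ireg 3 = m ∧
      s.heap.fst k ≤ m ∧ m ≤ s.heap.lst k ∧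
      (s'.iarr 4 = fun j => if j = s.ireg 11 ∨ j ∈ X₀ \ (Y ∪ Ico (s.heap.fst k) (s.heap.lst k)) ∨
        j ∈ Ico (s.heap.fst k) m then 1 else 0) ∧
      T' + 60 * Y.card + 30 * (s.heap.lst k - s.heap.fst k) + 30 * (s.heap.lst k - m) ≤
        T + 60 * X₀.card + 20)
      (m := fun s' => s.heap.lst k - s'.ireg 3)
    · rintro s₂ T₂ ⟨hM₂, m, h2, h3, hm1, hm2, h4, hT₂⟩ hb₂
      simp [h2, h3, hlst s₂ hM₂] at hb₂
      simp only [wp_seq, wp_iput, Prog.inc, wp_iset]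
      refine ⟨⟨hM₂.putI.setI (by decide), m + 1, by simp [h2], by simp [h3], by omega, by omega,
        ?_, ?_⟩, ?_⟩
      · funext j
        simp [h3, h4, Function.update_apply]
        by_cases hj : j = m
        · subst hj
          rw [if_pos rfl, if_pos]
          exact Or.inr (Or.inr ⟨hm1, le_rfl⟩)
        · rw [if_neg hj]
          simp only [show j ≤ m ↔ j < m by omega]
      · simp; omega
      · simp [h3]; omega
    · rintro s₂ T₂ ⟨hM₂, m, h2, h3, hm1, hm2, h4, hT₂⟩ hb₂
      simp [h2, h3, hlst s₂ hM₂] at hb₂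
      obtain rfl : m = s.heap.lst k := by omega
      refine ⟨⟨hM₂.setI (by decide), s.heap.par k, Y, by simp [h2, hpar s₂ hM₂], hY,
        subset_union_left.trans hsub, ?_, ?_⟩, ?_⟩
      · simp only [State.setI_iarr]
        rw [h4]
        funext j
        refine if_congr (or_congr_right ?_) rfl rfl
        rw [mem_sdiff, mem_sdiff, mem_union, not_or]
        constructor
        · rintro (h5 | h5)
          · exact ⟨h5.1, h5.2.1⟩
          · exact ⟨hsub (mem_union_right _ h5), fun h6 => disjoint_left.1 hd h6 h5⟩
        · intro h5
          by_cases h6 : j ∈ Ico (s.heap.fst k) (s.heap.lst k)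
          · exact Or.inr h6
          · exact Or.inl ⟨h5.1, h5.2, h6⟩
      · simp; omega
      · simp [h2, hpar s₂ hM₂, hk, hp]
    · refine ⟨hM₁.setI (by decide), s.heap.fst k, by simp [hk], by simp [hk, hfst s₁ hM₁], le_rfl,
        hlt.le, ?_, ?_⟩
      · simp [hmarks]
      · simp; omega
  · rintro s₁ T₁ ⟨hM₁, k, X, hk, hX, hsub, hmarks, hT⟩ hb
    have h1 : s₁.iarr 1 = s.heap.fst := hM₁.iarr 1 (by decide)
    have h2 : s₁.iarr 2 = s.heap.lst := hM₁.iarr 2 (by decide)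
    simp [hk, h1, h2] at hb
    cases hX with
    | cons _ Y hlt => omega
    | nil _ =>
    refine h s₁ _ hM₁ ?_ ?_
    · rw [hmarks]; funext j; simp
    · simp at hT ⊢; omega
  · refine ⟨hM.putI.setI (by decide), s.ireg 12, X₀, by simp, hr, subset_rfl, ?_, ?_⟩
    · funext j
      simp [hm, Function.update_apply]
    · simp; omega

/-- Write the start times of the job number `ireg 2`, given the start times of its block. -/
def writeJob (acc : ℕ) (r₁ r₂ r₃ : RExp) : Prog :=
  .rput 1 (.get 0 (.reg 2)) (.add r₁ (.reg acc)) ;;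
  .rput 2 (.get 0 (.reg 2)) (.add r₂ (.reg acc)) ;;
  .rput 3 (.get 0 (.reg 2)) (.add r₃ (.reg acc)) ;;
  .rset acc (.add (.reg acc) (.get 4 (.reg 2)))

/-- Write the schedule: the blocks of marked and of unmarked jobs start at the times
`0, rreg 4, rreg 5` and `rreg 6, rreg 7, rreg 8`, the last job at `rreg 10, rreg 11, rreg 12`. -/
def write : Prog :=
  .iset 2 (.lit 0) ;; .rset 13 (.ofInt (.lit 0)) ;; .rset 14 (.ofInt (.lit 0)) ;;
  .loop (.ilt (.reg 2) (.reg 1))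
    (.ite (.ile (.lit 1) (.get 4 (.reg 2))) (writeJob 13 (.ofInt (.lit 0)) (.reg 4) (.reg 5))
      (writeJob 14 (.reg 6) (.reg 7) (.reg 8)) ;; .inc 2) ;;
  .rput 1 (.reg 1) (.reg 10) ;; .rput 2 (.reg 1) (.reg 11) ;; .rput 3 (.reg 1) (.reg 12)

/-- The start times of the job number `j`. -/
noncomputable def startTimes (s : State) (w : ℕ → ℝ) (M : Finset ℕ) (j : ℕ) : Fin 3 → ℝ :=
  if j ∈ M then
    ![∑ i ∈ range j with i ∈ M, w i, s.rreg 4 + ∑ i ∈ range j with i ∈ M, w i,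
      s.rreg 5 + ∑ i ∈ range j with i ∈ M, w i]
  else
    ![s.rreg 6 + ∑ i ∈ range j with i ∉ M, w i, s.rreg 7 + ∑ i ∈ range j with i ∉ M, w i,
      s.rreg 8 + ∑ i ∈ range j with i ∉ M, w i]

theorem write_spec {M : Finset ℕ} {e : Equiv.Perm (Fin l)} (hl : s.ireg 1 = l)
    (hw : s.rarr 4 = w) (he : ∀ j : Fin l, s.iarr 0 j = e j)
    (hM : s.iarr 4 = fun j => if j ∈ M then 1 else 0)
    (h : ∀ s' T', (∀ (j : Fin l) (i : Fin 3), s'.rarr (i.val + 1) (e j) = startTimes s w M j i) →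
      (∀ i : Fin 3, s'.rarr (i.val + 1) l = ![s.rreg 10, s.rreg 11, s.rreg 12] i) →
      T' ≤ T + (60 * l + 60) → Q s' T') : WP write s T Q := by
  simp only [write, wp_seq, wp_iset, wp_rset, wp_rput]
  apply WP.loop (Inv := fun s' T' => ∃ k, k ≤ l ∧ s'.ireg 2 = k ∧ s'.ireg 1 = l ∧
    s'.iarr = s.iarr ∧ s'.rarr 4 = w ∧ (∀ x, x ≠ 13 → x ≠ 14 → s'.rreg x = s.rreg x) ∧
    s'.rreg 13 = ∑ i ∈ range k with i ∈ M, w i ∧ s'.rreg 14 = ∑ i ∈ range k with i ∉ M, w i ∧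
    (∀ (j : Fin l) (i : Fin 3), j.val < k → s'.rarr (i.val + 1) (e j) = startTimes s w M j i) ∧
    T' ≤ T + (60 * k + 20)) (m := fun s' => l - s'.ireg 2)
  · rintro s₁ T₁ ⟨k, hk, h2, h1, hi, h4, hr, h13, h14, hout, hT⟩ hb
    simp [h1, h2] at hb
    have hek := he ⟨k, hb⟩
    have hne : ∀ j : Fin l, j.val ≠ k → (e j).val ≠ e ⟨k, hb⟩ := fun j hj h' =>
      hj (congrArg Fin.val (e.injective (Fin.ext h')))
    have hlast : ∀ (s' : State) (v : Fin 3 → ℝ), v = startTimes s w M k →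
        (∀ i : Fin 3, s'.rarr (i.val + 1) =
          Function.update (s₁.rarr (i.val + 1)) (e ⟨k, hb⟩) (v i)) →
        ∀ (j : Fin l) (i : Fin 3), j.val < k + 1 →
          s'.rarr (i.val + 1) (e j) = startTimes s w M j i := by
      intro s' v hv hs' j i hj
      rw [hs' i, Function.update_apply]
      rcases Nat.lt_succ_iff_lt_or_eq.1 hj with h5 | h5
      · rw [if_neg (hne j (by omega)), hout j i h5]
      · obtain rfl : j = ⟨k, hb⟩ := Fin.ext h5
        rw [if_pos rfl, hv]
    simp only [wp_ite, wp_seq, writeJob, wp_rput, wp_rset, Prog.inc, wp_iset]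
    refine ⟨fun hc => ?_, fun hc => ?_⟩
    · have hkM : k ∈ M := by by_contra hkM; simp [h2, hi, hM, hkM] at hc
      refine ⟨⟨k + 1, by omega, by simp [h2], by simp [h1], by simp [hi], by simp [h4],
        fun x hx hx' => by simp [hx, hr x hx hx'], ?_, ?_, ?_, ?_⟩, ?_⟩
      · simp [h13, h2, h4, range_add_one, filter_insert, hkM, add_comm]
      · simp [h14, range_add_one, filter_insert, hkM]
      · apply hlast _ _ rfl
        intro i
        fin_cases i <;> simp [h2, hi, hek, startTimes, hkM, h13, hr]
      · simp; omega
      · simp [h2]; omega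
    · have hkM : k ∉ M := by intro hkM; simp [h2, hi, hM, hkM] at hc
      refine ⟨⟨k + 1, by omega, by simp [h2], by simp [h1], by simp [hi], by simp [h4],
        fun x hx hx' => by simp [hx', hr x hx hx'], ?_, ?_, ?_, ?_⟩, ?_⟩
      · simp [h13, range_add_one, filter_insert, hkM]
      · simp [h14, h2, h4, range_add_one, filter_insert, hkM, add_comm]
      · apply hlast _ _ rfl
        intro i
        fin_cases i <;> simp [h2, hi, hek, startTimes, hkM, h14, hr]
      · simp; omega
      · simp [h2]; omega
  · rintro s₁ T₁ ⟨k, hk, h2, h1, hi, h4, hr, h13, h14, hout, hT⟩ hb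
    simp [h1, h2] at hb
    obtain rfl : k = l := by omega
    refine h _ _ (fun j i => ?_) (fun i => ?_) (by simp; omega)
    · rw [← hout j i j.isLt]
      have : (e j).val ≠ k := (e j).isLt.ne
      fin_cases i <;> simp [h1, this]
    · fin_cases i <;> simp [h1, hr]
  · refine ⟨0, by omega, by simp, by simpa using hl, rfl, by simpa using hw,
      fun x hx hx' => by simp [hx, hx'], by simp, by simp, fun j i hj => by omega, by simp⟩

end Output

/-! ### From sets of positions to sets of jobs and to the schedules of the algorithm. -/

section Translation

open Finset

variable {l : ℕ}

/-- The set of flow-shop jobs whose numbers are in `X`. -/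
def jobs (l : ℕ) (X : Finset ℕ) : Finset (Fin l) := univ.filter fun j => j.val ∈ X

@[simp] theorem mem_jobs {X : Finset ℕ} {j : Fin l} : j ∈ jobs l X ↔ j.val ∈ X := by simp [jobs]

theorem jobs_insert (i : Fin l) (X : Finset ℕ) : jobs l (insert i.val X) = insert i (jobs l X) := by
  ext j; simp [Fin.ext_iff]

theorem Inst.sum_seq_map (I : Inst l 1) (X : Finset (Fin l)) :
    ∑ j ∈ X.map Fin.valEmbedding, I.seq j = I.P X := by
  simp [Inst.P, Inst.seq_val]

theorem Inst.P_jobs (I : Inst l 1) {X : Finset ℕ} (hX : X ⊆ range l) :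
    I.P (jobs l X) = ∑ j ∈ X, I.seq j := by
  rw [← I.sum_seq_map]
  congr 1
  ext j
  simp only [mem_map, mem_jobs, Fin.valEmbedding_apply]
  constructor
  · rintro ⟨a, ha, rfl⟩; exact ha
  · exact fun hj => ⟨⟨j, mem_range.1 (hX hj)⟩, hj, rfl⟩

theorem Inst.before_jobs (I : Inst l 1) (M : Finset ℕ) (j : Fin l) :
    I.before (jobs l M) j = ∑ i ∈ range j with i ∈ M, I.seq i := by
  rw [← I.P_jobs, Inst.before]
  · congr 1
    ext i
    simp [and_comm]
  · intro i hi
    have := j.isLt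
    simp at hi ⊢; omega

theorem Inst.before_jobs_compl (I : Inst l 1) (M : Finset ℕ) (j : Fin l) :
    I.before (jobs l M)ᶜ j = ∑ i ∈ range j with i ∉ M, I.seq i := by
  rw [← I.P_jobs, Inst.before]
  · congr 1
    ext i
    simp [and_comm]
  · intro i hi
    have := j.isLt
    simp at hi ⊢; omega

theorem jobs_subset {i : Fin l} {X : Finset ℕ} (hX : X ⊆ Ico (i.val + 1) l) :
    jobs l X ⊆ Ioi i := by
  intro j hj
  have := mem_Ico.1 (hX (mem_jobs.1 hj))
  rw [mem_Ioi, Fin.lt_def]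
  omega

theorem map_subset {i : Fin l} {X : Finset (Fin l)} (hX : X ⊆ Ioi i) :
    X.map Fin.valEmbedding ⊆ Ico (i.val + 1) l := by
  intro j hj
  simp only [mem_map, Fin.valEmbedding_apply] at hj
  obtain ⟨a, ha, rfl⟩ := hj
  have := mem_Ioi.1 (hX ha)
  rw [Fin.lt_def] at this
  exact mem_Ico.2 ⟨this, a.isLt⟩

theorem Ico_subset_range {i : ℕ} {X : Finset ℕ} (hX : X ⊆ Ico (i + 1) l) : X ⊆ range l :=
  fun _ hj => mem_range.2 (mem_Ico.1 (hX hj)).2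

theorem KMax.maxKnapApprox {I : Inst l 1} {i : Fin l} {c ε : ℝ} {D : Finset ℕ}
    (h : KMax I.seq l i c ε D) : I.MaxKnapApprox ε (Ioi i) c (jobs l D) := by
  obtain ⟨h1, h2, h3⟩ := h
  rw [Inst.MaxKnapApprox, Inst.MaxKnapFeasible, I.P_jobs (Ico_subset_range h1)]
  refine ⟨⟨jobs_subset h1, h2⟩, fun D' hD' => ?_⟩
  have := h3 _ (map_subset hD'.1)
  rw [I.sum_seq_map] at this
  exact this hD'.2

theorem KMin.minKnapApprox {I : Inst l 1} {i : Fin l} {c ε : ℝ} {C : Finset ℕ}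
    (h : KMin I.seq l i c ε C) : I.MinKnapApprox ε (Ioi i) c (jobs l C) := by
  obtain ⟨h1, h2, h3⟩ := h
  rw [Inst.MinKnapApprox, Inst.MinKnapFeasible, I.P_jobs (Ico_subset_range h1)]
  refine ⟨⟨jobs_subset h1, h2⟩, fun C' hC' => ?_⟩
  have := h3 _ (map_subset hC'.1)
  rw [I.sum_seq_map] at this
  exact this hC'.2

theorem Inst.schedI_jobs_makespan {I : Inst l 1} (hI : Antitone I.p) (h : I.p1 ≤ I.qn) {i : Fin l}
    (hi : 0 < i.val) {X : Finset ℕ} (hX : X ⊆ Ico (i.val + 1) l) :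
    I.makespan (I.schedI i (jobs l X)) =
      spanVal I.qn (I.P univ) (I.seq 0) (I.seq i) (I.seq i + ∑ j ∈ X, I.seq j) := by
  rw [I.schedI_makespan hI h i hi _ (jobs_subset hX), I.P_jobs (Ico_subset_range hX), I.seq_val]
  rfl

theorem Chosen.resultI {I : Inst l 1} (hI : Antitone I.p) (h : I.p1 ≤ I.qn) {i : Fin l}
    (hi : 0 < i.val) {ε : ℝ} {X : Finset ℕ} (hX : Chosen I.seq l i I.qn (I.P univ) ε X) :
    I.ResultI ε i (I.schedI i (jobs l X)) := by
  have hsub := hX.subset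
  rcases hX with ⟨h1, h2⟩ | ⟨h1, D, C, hD, hC, hXDC, h3, h4⟩
  · rw [I.seq_val] at h1
    exact Or.inl ⟨h1, _, jobs_subset h2, rfl⟩
  · rw [I.seq_val] at h1
    have hc : I.qn - 2 * I.seq i = I.qn - 2 * I.p i := by rw [I.seq_val]
    rw [hc] at hD hC
    refine Or.inr ⟨h1, jobs l D, hD.maxKnapApprox, ?_⟩
    rcases hC with hC | ⟨rfl, hC⟩
    · refine Or.inl ⟨jobs l C, hC.minKnapApprox, ?_, ?_⟩
      · rcases hXDC with rfl | rfl <;> simp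
      · rintro S' (rfl | rfl)
        · rw [I.schedI_jobs_makespan hI h hi hsub, I.schedI_jobs_makespan hI h hi hC.1]
          exact h4
        · rw [I.schedI_jobs_makespan hI h hi hsub, I.schedI_jobs_makespan hI h hi hD.1]
          exact h3
    · refine Or.inr ⟨?_, by rcases hXDC with rfl | rfl <;> rfl⟩
      rintro ⟨C', h5, h6⟩
      have := hC _ (map_subset h5)
      rw [I.sum_seq_map] at this
      linarith

/-- The best choices yield a best schedule. -/
theorem Best.isBest {I : Inst l 1} (hI : Antitone I.p) (h : I.p1 ≤ I.qn)
    (hP : I.qn ≤ I.P univ) {ε : ℝ} {f : ℕ → Finset ℕ} {s : State}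
    (hb : Best I.seq l l I.qn (I.P univ) ε f s) {S : Schedule l 1}
    (hS : (s.ireg 11 = 0 ∧ S = I.sched231) ∨
      ∃ i : Fin l, 0 < i.val ∧ s.ireg 11 = i ∧ S = I.schedI i (jobs l (f i))) :
    ∃ F : Fin l → Schedule l 1, (∀ i, 0 < i.val → I.ResultI ε i (F i)) ∧
      I.IsBest ({I.sched231, I.sched312} ∪ F '' {i | 0 < i.val}) S := by
  have hspan : ∀ i : Fin l, 0 < i.val → I.makespan (I.schedI i (jobs l (f i))) =
      spanVal I.qn (I.P univ) (I.seq 0) (I.seq i) (I.seq i + ∑ j ∈ f i, I.seq j) := fun i hi =>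
    I.schedI_jobs_makespan hI h hi (hb.chosen i hi i.isLt).subset
  have hval : I.makespan S = s.rreg 10 := by
    rcases hS with ⟨h0, rfl⟩ | ⟨i, hi, h11, rfl⟩
    · rw [I.sched231_makespan hP]
      rcases hb.attained with h1 | h1
      · exact h1.2.symm
      · omega
    · rw [hspan i hi]
      rcases hb.attained with h1 | h1
      · omega
      · rw [h1.2.2.2.2, h11]
  refine ⟨fun i => I.schedI i (jobs l (f i)), fun i hi => (hb.chosen i hi i.isLt).resultI hI h hi,
    ?_, ?_⟩
  · rcases hS with ⟨-, rfl⟩ | ⟨i, hi, -, rfl⟩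
    · exact Or.inl (Or.inl rfl)
    · exact Or.inr ⟨i, hi, rfl⟩
  · rw [hval]
    rintro S' ((rfl | rfl) | ⟨i, hi, rfl⟩)
    · rw [I.sched231_makespan hP]; exact hb.le_start
    -- `sched312` has the same makespan as `sched231`, so leaving it out of the search loses
    -- nothing.
    · rw [I.sched312_makespan hP]; exact hb.le_start
    · exact (hb.le i hi i.isLt).trans (hspan i hi).ge

/-- The output is a schedule with the machine order `M₃, M₂, M₁` of the last job. -/
theorem relabel_output_eq_sched321 {I : Inst l 1} {e : Equiv.Perm (Fin l)} {s s' : State}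
    {M : Finset ℕ} {a b : ℝ}
    (hflow : ∀ (j : Fin l) (i : Fin 3),
      s'.rarr (i.val + 1) (e j) = startTimes s I.seq M j i)
    (hopen : ∀ i : Fin 3, s'.rarr (i.val + 1) l = ![s.rreg 10, s.rreg 11, s.rreg 12] i)
    (h4 : s.rreg 4 = a) (h5 : s.rreg 5 = max (2 * a) I.qn) (h6 : s.rreg 6 = I.P (jobs l M))
    (h7 : s.rreg 7 = max (a + I.P (jobs l M)) I.qn + I.qn) (h8 : s.rreg 8 = s.rreg 7 + b)
    (h10 : s.rreg 10 = max (I.P univ) (s.rreg 7))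
    (h11 : s.rreg 11 = max (a + I.P (jobs l M)) I.qn) (h12 : s.rreg 12 = 0) :
    (outputSchedule l s').relabel e = I.sched321 (jobs l M) a b := by
  funext j i
  rcases j with j | j
  · change s'.rarr (i.val + 1) (e j) = _
    rw [hflow, startTimes, Inst.sched321]
    simp only [I.before_jobs, I.before_jobs_compl, mem_jobs, h4, h5, h6, h8, h7]
  · change s'.rarr (i.val + 1) l = _
    rw [hopen, h10, h11, h12, h7]
    rfl

/-- The output is a schedule with one block of flow-shop jobs. -/
theorem relabel_output_eq_blocks {I : Inst l 1} {e : Equiv.Perm (Fin l)} {s s' : State} {a b : ℝ}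
    (hflow : ∀ (j : Fin l) (i : Fin 3), s'.rarr (i.val + 1) (e j) = startTimes s I.seq ∅ j i)
    (hopen : ∀ i : Fin 3, s'.rarr (i.val + 1) l = ![s.rreg 10, s.rreg 11, s.rreg 12] i)
    (h6 : s.rreg 6 = 0) (h7 : s.rreg 7 = a) (h8 : s.rreg 8 = b) :
    (outputSchedule l s').relabel e = I.blocks a b ![s.rreg 10, s.rreg 11, s.rreg 12] := by
  have huniv : (jobs l ∅)ᶜ = univ := by ext; simp
  funext j i
  rcases j with j | j
  · change s'.rarr (i.val + 1) (e j) = _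
    rw [hflow, startTimes, Inst.blocks, if_neg (notMem_empty _), ← huniv, I.before_jobs_compl, h6,
      h7, h8, zero_add]
  · change s'.rarr (i.val + 1) l = _
    rw [hopen]
    rfl

end Translation

/-! ### The complete program and its correctness. -/

section Main

open Finset

variable {l : ℕ} {s : State} {T : ℕ} {Q : State → ℕ → Prop} {I : Inst l 1} {ε : ℝ}
  {e : Equiv.Perm (Fin l)}

theorem wp_setMax {x : ℕ} {r : RExp}
    (h : ∀ T', T' ≤ T + (2 * r.cost + 4) → Q (s.setR x (max (s.rreg x) (r.eval s))) T') :
    WP (.ite (.rle (.reg x) r) (.rset x r) .skip) s T Q := by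
  refine wp_max fun s' T' hs' hT' => ?_
  rcases hs' with rfl | ⟨rfl, hs'⟩
  · exact h T' hT'
  · have := h T' hT'
    rwa [← hs', State.setR, Function.update_eq_self] at this

/-- Write a schedule with one block of flow-shop jobs. -/
def writeBlocks (a b r₁ r₂ r₃ : RExp) : Prog :=
  .rset 6 (.ofInt (.lit 0)) ;; .rset 7 a ;; .rset 8 b ;; .rset 10 r₁ ;; .rset 11 r₂ ;;
  .rset 12 r₃ ;; write

/-- The expression depends only on the registers below `6` and the arrays. -/
def RExp.Stable (s : State) (r : RExp) (v : ℝ) : Prop :=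
  ∀ s' : State, s'.ireg = s.ireg → (∀ x, x < 6 → s'.rreg x = s.rreg x) → s'.rarr = s.rarr →
    s'.iarr = s.iarr → r.eval s' = v

theorem writeBlocks_spec {a b r₁ r₂ r₃ : RExp} {va vb v₁ v₂ v₃ : ℝ} (hl : s.ireg 1 = l)
    (hw : s.rarr 4 = I.seq) (he : ∀ j : Fin l, s.iarr 0 j = e j) (hM : s.iarr 4 = fun _ => 0)
    (ha : a.Stable s va) (hb : b.Stable s vb) (h₁ : r₁.Stable s v₁) (h₂ : r₂.Stable s v₂)
    (h₃ : r₃.Stable s v₃)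
    (h : ∀ s' T', (outputSchedule l s').relabel e = I.blocks va vb ![v₁, v₂, v₃] →
      T' ≤ T + (60 * l + (a.cost + b.cost + r₁.cost + r₂.cost + r₃.cost) + 80) → Q s' T') :
    WP (writeBlocks a b r₁ r₂ r₃) s T Q := by
  simp only [writeBlocks, wp_seq, wp_rset]
  rw [ha (s.setR 6 _) rfl (fun x hx => by simp [hx.ne]) rfl rfl,
    hb ((s.setR 6 _).setR 7 _) rfl
      (fun x hx => by simp [hx.ne, show x ≠ 7 by omega]) rfl rfl,
    h₁ (((s.setR 6 _).setR 7 _).setR 8 _) rfl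
      (fun x hx => by simp [hx.ne, show x ≠ 7 by omega, show x ≠ 8 by omega]) rfl rfl,
    h₂ ((((s.setR 6 _).setR 7 _).setR 8 _).setR 10 _) rfl
      (fun x hx => by simp [hx.ne, show x ≠ 7 by omega, show x ≠ 8 by omega,
        show x ≠ 10 by omega]) rfl rfl,
    h₃ (((((s.setR 6 _).setR 7 _).setR 8 _).setR 10 _).setR 11 _) rfl
      (fun x hx => by simp [hx.ne, show x ≠ 7 by omega, show x ≠ 8 by omega,
        show x ≠ 10 by omega, show x ≠ 11 by omega]) rfl rfl]
  refine write_spec (w := I.seq) (M := ∅) (e := e) hl hw he (by simpa using hM) ?_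
  intro s' T' hf ho hT'
  have := relabel_output_eq_blocks (a := va) (b := vb) hf ho (by simp) (by simp) (by simp)
  refine h s' T' (by simpa using this) ?_
  simp at hT'
  omega

/-- Write the schedule for the job `ireg 11` and the node `ireg 12`. -/
def writeBest : Prog :=
  .rset 4 (.get 4 (.reg 11)) ;;
  .rset 5 (.mul (.ofInt (.lit 2)) (.reg 4)) ;;
  .ite (.rle (.reg 5) (.reg 1)) (.rset 5 (.reg 1)) .skip ;;
  .rset 6 (.add (.reg 4) (.get 5 (.reg 12))) ;;
  .rset 11 (.add (.reg 4) (.reg 6)) ;;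
  .ite (.rle (.reg 11) (.reg 1)) (.rset 11 (.reg 1)) .skip ;;
  .rset 7 (.add (.reg 11) (.reg 1)) ;;
  .rset 8 (.add (.reg 7) (.get 4 (.lit 0))) ;;
  .rset 10 (.reg 2) ;;
  .ite (.rle (.reg 10) (.reg 7)) (.rset 10 (.reg 7)) .skip ;;
  .rset 12 (.ofInt (.lit 0)) ;;
  mark ;; write

theorem writeBest_spec {i : Fin l} {X : Finset ℕ} (hl : s.ireg 1 = l) (h1 : s.rreg 1 = I.qn)
    (h2 : s.rreg 2 = I.P univ) (hw : s.rarr 4 = I.seq) (he : ∀ j : Fin l, s.iarr 0 j = e j)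
    (hM : s.iarr 4 = fun _ => 0) (hi : s.ireg 11 = i) (hX : X ⊆ Ico (i.val + 1) l)
    (hr : s.heap.Rep I.seq (s.ireg 12) X)
    (h : ∀ s' T', (outputSchedule l s').relabel e = I.schedI i (jobs l X) →
      T' ≤ T + (120 * l + 200) → Q s' T') : WP writeBest s T Q := by
  simp only [writeBest, wp_seq, wp_rset]
  refine wp_setMax fun T₁ hT₁ => wp_setMax fun T₂ hT₂ => wp_setMax fun T₃ hT₃ => ?_
  refine mark_spec (by simpa using hM) (by simpa using hr) ?_
  intro s₁ T₄ hmk hm hT₄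
  refine write_spec (w := I.seq) (M := insert i.val X) (e := e) ?_ ?_ ?_ ?_ ?_
  · rw [hmk.ireg 1 (by decide) (by decide)]; simpa using hl
  · rw [hmk.rarr]; simpa using hw
  · intro j; rw [hmk.iarr 0 (by decide)]; simpa using he j
  · rw [hm]; simp [hi]
  intro s₂ T₅ hf ho hT₅
  have hval : s.rarr 5 (s.ireg 12) = I.P (jobs l X) := by
    rw [I.P_jobs (Ico_subset_range hX), ← hr.val_eq]; rfl
  have hiX : i ∉ jobs l X := by
    rw [mem_jobs]
    intro hmem
    have := mem_Ico.1 (hX hmem)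
    omega
  have hP : I.P (jobs l (insert i.val X)) = I.p i + I.P (jobs l X) := by
    rw [jobs_insert, I.P_insert hiX]
  have hreg := hmk.rreg
  refine h s₂ T₅ ?_ ?_
  · rw [Inst.schedI, ← jobs_insert]
    refine relabel_output_eq_sched321 hf ho ?_ ?_ ?_ ?_ ?_ ?_ ?_ ?_ <;> rw [hreg] <;>
      simp [hw, hi, h1, h2, hval, hP, I.seq_val]
    rfl
  · have hcard : X.card ≤ l := by
      have := card_le_card hX
      rw [Nat.card_Ico] at this
      omega
    simp at hT₁ hT₂ hT₃ hT₄ hT₅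
    omega

/-- The last phase: choose one of the cases of the algorithm and write the schedule. -/
def solve : Prog :=
  .rset 4 (.mul (.ofInt (.lit 2)) (.reg 1)) ;;
  .rset 5 (.reg 4) ;; .ite (.rle (.reg 5) (.reg 2)) (.rset 5 (.reg 2)) .skip ;;
  .ite (.rle (.reg 1) (.get 4 (.lit 0)))
    (writeBlocks (.get 4 (.lit 0)) (.mul (.ofInt (.lit 2)) (.get 4 (.lit 0))) (.reg 5)
      (.ofInt (.lit 0)) (.reg 1))
    (.ite (.rle (.reg 2) (.reg 1))
      (writeBlocks (.reg 1) (.reg 4) (.reg 1) (.reg 4) (.ofInt (.lit 0)))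
      (search ;;
        .ite (.ile (.reg 11) (.lit 0))
          (writeBlocks (.reg 1) (.reg 4) (.reg 5) (.ofInt (.lit 0)) (.reg 1)) writeBest))

theorem solve_spec {N K : ℕ} (hp : Prepared I ε e s) (hε : 0 < ε)
    (hN : 3 < (N + 1) * (min ε 1 / 8)) (hK : 1 ≤ (1 + min ε 1 / 8) ^ K * (min ε 1 / 8))
    (h : ∀ s' T', I.ResultC ε (outputSchedule l s') →
      T' ≤ T + (l * jobCost l N K + 120 * l + 400) → Q s' T') : WP solve s T Q := by
  obtain ⟨hb, he, ha, hM⟩ := hp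
  set J := I.relabel e with hJ
  have hanti : Antitone J.p := ha
  have hPJ : J.P univ = I.P univ := Equiv.sum_comp e I.p
  rw [← hPJ] at hb
  change Base l J.seq (min ε 1 / 8) J.qn (J.P univ) s at hb
  have hmin : 0 < min ε 1 := lt_min hε one_pos
  have hd : Data l J.seq (min ε 1 / 8) N K := by
    refine ⟨fun k hk => ?_, fun i j hij hj => ?_, by positivity,
      by have := min_le_right ε 1; linarith, hN, hK⟩
    · rw [Inst.seq, dif_pos hk]; exact J.p_pos _
    · rw [Inst.seq, dif_pos hj, Inst.seq, dif_pos (hij.trans_lt hj)]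
      exact hanti (by rwa [Fin.le_def])
  -- This covers `l = 0` too: both sides are then `0`, so the test `q_n ≤ p_1` fails as it should.
  have hp1 : J.seq 0 = J.p1 := rfl
  have hres : ∀ s', J.SortedResultC ε ((outputSchedule l s').relabel e) →
      I.ResultC ε (outputSchedule l s') := fun s' hs' => ⟨e, ha, hs'⟩
  simp only [solve, wp_seq, wp_rset]
  refine wp_setMax fun T₁ hT₁ => ?_
  generalize hs₁ : State.setR _ 5 _ = s₁
  have e1 : s₁.ireg = s.ireg := by rw [← hs₁]; rfl
  have e2 : s₁.iarr = s.iarr := by rw [← hs₁]; rfl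
  have e3 : s₁.rarr = s.rarr := by rw [← hs₁]; rfl
  have f1 : s₁.rreg 1 = J.qn := by rw [← hs₁]; simp [hb.r1]
  have f2 : s₁.rreg 2 = J.P univ := by rw [← hs₁]; simp [hb.r2]
  have f3 : s₁.rreg 3 = min ε 1 / 8 := by rw [← hs₁]; simp [hb.r3]
  have f4 : s₁.rreg 4 = 2 * J.qn := by rw [← hs₁]; simp [hb.r1]
  have f5 : s₁.rreg 5 = max (J.P univ) (2 * J.qn) := by
    rw [← hs₁]; simp [hb.r1, hb.r2, max_comm]
  have hb₁ : Base l J.seq (min ε 1 / 8) J.qn (J.P univ) s₁ :=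
    ⟨by rw [e1]; exact hb.i1, f1, f2, f3, by rw [e3]; exact hb.arr, by rw [e1]; exact hb.hp, by
      have : s₁.heap = s.heap := by rw [State.heap, e3, e2]; rfl
      rw [this]; exact hb.root⟩
  have he₁ : ∀ j : Fin l, s₁.iarr 0 j = e j := by rw [e2]; exact he
  have hM₁ : s₁.iarr 4 = fun _ => 0 := by rw [e2]; exact hM
  simp only [RExp.cost, IExp.cost] at hT₁
  clear hs₁
  rw [wp_ite]
  refine ⟨fun hc => ?_, fun hc => ?_⟩
  · have hc1 : J.qn ≤ J.p1 := by simpa [f1, hb₁.arr, hp1] using hc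
    refine writeBlocks_spec (I := J) (e := e) (va := J.p1) (vb := 2 * J.p1)
      (v₁ := max (J.P univ) (2 * J.qn)) (v₂ := 0) (v₃ := J.qn) hb₁.i1 hb₁.arr he₁ hM₁
      ?_ ?_ ?_ ?_ ?_ ?_
    · intro s' g1 g2 g3 g4; simp [g3, hb₁.arr, hp1]
    · intro s' g1 g2 g3 g4; simp [g3, hb₁.arr, hp1]
    · intro s' g1 g2 g3 g4; simp [g2, f5]
    · intro s' g1 g2 g3 g4; simp
    · intro s' g1 g2 g3 g4; simp [g2, f1]
    · intro s₂ T₂ hout hT₂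
      refine h s₂ T₂ (hres s₂ ?_) (by simp at hT₂; omega)
      rw [Inst.SortedResultC, if_pos hc1, hout]
      rfl
  have hc1 : ¬ J.qn ≤ J.p1 := by simpa [f1, hb₁.arr, hp1] using hc
  rw [wp_ite]
  refine ⟨fun hc' => ?_, fun hc' => ?_⟩
  · have hc2 : J.P univ ≤ J.qn := by simpa [f1, f2] using hc'
    refine writeBlocks_spec (I := J) (e := e) (va := J.qn) (vb := 2 * J.qn)
      (v₁ := J.qn) (v₂ := 2 * J.qn) (v₃ := 0) hb₁.i1 hb₁.arr he₁ hM₁ ?_ ?_ ?_ ?_ ?_ ?_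
    · intro s' g1 g2 g3 g4; simp [g2, f1]
    · intro s' g1 g2 g3 g4; simp [g2, f4]
    · intro s' g1 g2 g3 g4; simp [g2, f1]
    · intro s' g1 g2 g3 g4; simp [g2, f4]
    · intro s' g1 g2 g3 g4; simp
    · intro s₂ T₂ hout hT₂
      refine h s₂ T₂ (hres s₂ ?_) (by simp at hT₂; omega)
      rw [Inst.SortedResultC, if_neg hc1, if_pos hc2, hout]
      rfl
  have hc2 : ¬ J.P univ ≤ J.qn := by simpa [f1, f2] using hc'
  have hl : 0 < l := by
    by_contra h0
    obtain rfl : l = 0 := by omega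
    exact hc2 (by simpa [Inst.P] using J.qn_pos.le)
  rw [wp_seq]
  refine search_spec hd hb₁ hl (by have := min_le_left ε 1; linarith : 8 * (min ε 1 / 8) ≤ ε) ?_
  intro s₂ T₂ f hf hbest hT₂
  have hfin : ∀ S, (s₂.ireg 11 = 0 ∧ S = J.sched231) ∨
      (∃ i : Fin l, 0 < i.val ∧ s₂.ireg 11 = i ∧ S = J.schedI i (jobs l (f i))) →
      J.SortedResultC ε S := by
    intro S hS
    rw [Inst.SortedResultC, if_neg hc1, if_neg hc2]
    exact hbest.isBest hanti (not_le.1 hc1).le (not_le.1 hc2).le hS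
  have g1 : s₂.ireg 1 = l := (hf.ireg 1 (by decide)).trans hb₁.i1
  have k1 : s₂.rreg 1 = J.qn := (hf.rreg 1 (by decide)).trans f1
  have k2 : s₂.rreg 2 = J.P univ := (hf.rreg 2 (by decide)).trans f2
  have k4 : s₂.rreg 4 = 2 * J.qn := (hf.rreg 4 (by decide)).trans f4
  have k5 : s₂.rreg 5 = max (J.P univ) (2 * J.qn) := (hf.rreg 5 (by decide)).trans f5
  have ka : s₂.rarr 4 = J.seq := (hf.rarr 4 (by decide)).trans hb₁.arr
  have he₂ : ∀ j : Fin l, s₂.iarr 0 j = e j := by rw [hf.iarr0]; exact he₁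
  have hM₂ : s₂.iarr 4 = fun _ => 0 := by rw [hf.iarr4]; exact hM₁
  rw [wp_ite]
  simp only [BExp.cost, RExp.cost, IExp.cost] at hT₂
  refine ⟨fun h0 => ?_, fun h0 => ?_⟩
  · have h0' : s₂.ireg 11 = 0 := by simpa using h0
    refine writeBlocks_spec (I := J) (e := e) (va := J.qn) (vb := 2 * J.qn)
      (v₁ := max (J.P univ) (2 * J.qn)) (v₂ := 0) (v₃ := J.qn) g1 ka he₂ hM₂ ?_ ?_ ?_ ?_ ?_ ?_
    · intro s' g1 g2 g3 g4; simp [g2, k1]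
    · intro s' g1 g2 g3 g4; simp [g2, k4]
    · intro s' g1 g2 g3 g4; simp [g2, k5]
    · intro s' g1 g2 g3 g4; simp
    · intro s' g1 g2 g3 g4; simp [g2, k1]
    · intro s₃ T₃ hout hT₃
      refine h s₃ T₃ (hres s₃ (hfin _ (Or.inl ⟨h0', ?_⟩))) ?_
      · rw [hout]; rfl
      · simp only [BExp.cost, RExp.cost, IExp.cost] at hT₃
        linarith
  · have h0' : s₂.ireg 11 ≠ 0 := by simpa using h0
    obtain ⟨h5, -⟩ | ⟨h5, h6, h7, -⟩ := hbest.attained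
    · exact absurd h5 h0'
    refine writeBest_spec (I := J) (e := e) (i := ⟨s₂.ireg 11, h6⟩) g1 k1 k2 ka he₂ hM₂ rfl
      (hbest.chosen _ h5 h6).subset h7 ?_
    intro s₃ T₃ hout hT₃
    refine h s₃ T₃ (hres s₃ (hfin _ (Or.inr ⟨⟨s₂.ireg 11, h6⟩, h5, rfl, hout⟩))) ?_
    simp only [BExp.cost, IExp.cost] at hT₃
    linarith

/-- The program for the algorithm. -/
def program : Prog := load ;; sort ;; prepare ;; solve

theorem program_spec {N K : ℕ} (hε : 0 < ε) (hN : 3 < (N + 1) * (min ε 1 / 8))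
    (hK : 1 ≤ (1 + min ε 1 / 8) ^ K * (min ε 1 / 8)) :
    WP program (inputState ε I) 0 fun s T => I.ResultC ε (outputSchedule l s) ∧
      T ≤ l * (jobCost l N K + 50 * l + 230) + 510 := by
  simp only [program, wp_seq]
  refine load_spec I fun s₁ T₁ h₁ hT₁ => sort_spec h₁ fun s₂ T₂ e h₂ ha hT₂ =>
    prepare_spec h₂ ha fun s₃ T₃ h₃ hT₃ => solve_spec h₃ hε hN hK fun s₄ T₄ h₄ hT₄ => ⟨h₄, ?_⟩
  linarith

end Main

/-! ### Estimating the number of steps. -/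

section RunningTime

variable {ε : ℝ}

theorem one_le_lg (x : ℝ) : 1 ≤ lg x := le_max_left _ _

/-- The parameters of the knapsack algorithm can be chosen small. -/
theorem exists_params (hε : 0 < ε) : ∃ N K : ℕ, 3 < (N + 1) * (min ε 1 / 8) ∧
    1 ≤ (1 + min ε 1 / 8) ^ K * (min ε 1 / 8) ∧ (N : ℝ) ≤ 24 * max 1 (1 / ε) ∧
    (K : ℝ) ≤ 129 * (max 1 (1 / ε) * lg (1 / ε)) := by
  set x := max 1 (1 / ε) with hx
  have hx1 : 1 ≤ x := le_max_left _ _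
  have hη : min ε 1 / 8 = 1 / (8 * x) := by
    rcases le_total ε 1 with h | h
    · have : 1 ≤ 1 / ε := by rw [le_div_iff₀ hε]; linarith
      rw [hx, min_eq_left h, max_eq_right this]
      field_simp
    · have : 1 / ε ≤ 1 := by rw [div_le_iff₀ hε]; linarith
      rw [hx, min_eq_right h, max_eq_left this]
      norm_num
  have hlog : Real.log (8 * x) ≤ 8 * lg (1 / ε) := by
    -- A crude bound is enough: `log (8 x) ≤ 7 + lg (1 / ε) ≤ 8 lg (1 / ε)`.
    have h8 : Real.log 8 ≤ 7 := (Real.log_le_sub_one_of_pos (by norm_num)).trans (by norm_num)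
    have hlx : Real.log x ≤ lg (1 / ε) := by
      rw [hx]
      rcases max_choice 1 (1 / ε) with h | h
      · rw [h, Real.log_one]; linarith [one_le_lg (1 / ε)]
      · rw [h]; exact le_max_right _ _
    rw [Real.log_mul (by norm_num) (by positivity)]
    linarith [one_le_lg (1 / ε)]
  have hlg := one_le_lg (1 / ε)
  have hlog0 : 0 ≤ Real.log (8 * x) := Real.log_nonneg (by linarith)
  rw [hη]
  -- With `η = 1 / (8 x)` the conditions read `N + 1 > 24 x` and `(1 + η) ^ K ≥ 8 x`. As `exp (η /
  -- 2) ≤ 1 + η`, any `K ≥ 2 log (8 x) / η` satisfies the second.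
  refine ⟨⌊24 * x⌋₊, ⌈16 * x * Real.log (8 * x)⌉₊, ?_, ?_, Nat.floor_le (by positivity), ?_⟩
  · have := Nat.lt_floor_add_one (24 * x)
    rw [mul_one_div, lt_div_iff₀ (by positivity)]
    linarith
  · have hK := Nat.le_ceil (16 * x * Real.log (8 * x))
    set K := ⌈16 * x * Real.log (8 * x)⌉₊
    -- This follows from `1 - y ≤ exp (-y)` and `(1 - y) (1 + 2 y) ≥ 1` for `0 ≤ y ≤ 1 / 2`.
    have h1 : Real.exp (1 / (16 * x)) ≤ 1 + 1 / (8 * x) := by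
      have h2 := Real.add_one_le_exp (-(1 / (16 * x)))
      have h3 : 0 < 1 / (16 * x) := by positivity
      have h4 : 1 / (16 * x) ≤ 1 / 16 := by
        rw [div_le_div_iff₀ (by positivity) (by norm_num)]; linarith
      have h5 : 1 / (8 * x) = 2 * (1 / (16 * x)) := by field_simp; norm_num
      rw [Real.exp_neg] at h2
      rw [h5]
      set y := 1 / (16 * x)
      have h6 : Real.exp y * (-y + 1) ≤ 1 := by
        have := mul_le_mul_of_nonneg_left h2 (Real.exp_pos y).le
        rwa [mul_inv_cancel₀ (Real.exp_pos y).ne'] at this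
      nlinarith [Real.exp_pos y]
    have h2 : 8 * x ≤ (1 + 1 / (8 * x)) ^ K := by
      calc 8 * x = Real.exp (Real.log (8 * x)) := (Real.exp_log (by positivity)).symm
        _ ≤ Real.exp (K * (1 / (16 * x))) := by
            apply Real.exp_le_exp.2
            rw [mul_one_div, le_div_iff₀ (by positivity)]
            linarith
        _ = Real.exp (1 / (16 * x)) ^ K := Real.exp_nat_mul _ _
        _ ≤ _ := pow_le_pow_left₀ (Real.exp_pos _).le h1 _
    rw [mul_one_div, le_div_iff₀ (by positivity)]
    linarith
  · have h1 := (Nat.ceil_lt_add_one (show 0 ≤ 16 * x * Real.log (8 * x) by positivity)).le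
    have h2 : 16 * x * Real.log (8 * x) ≤ 16 * x * (8 * lg (1 / ε)) :=
      mul_le_mul_of_nonneg_left hlog (by positivity)
    have h3 : 1 ≤ x * lg (1 / ε) := by nlinarith
    linarith

/-- The dominating terms of the number of steps. -/
theorem mul_min_le_timeBound (hε : 0 < ε) {n : ℕ} (hn : 1 ≤ n) :
    (n : ℝ) * max 1 (1 / ε) * min (n : ℝ) (max 1 (1 / ε) ^ 2 * lg (1 / ε)) ≤ timeBound n ε ∧
      (n : ℝ) ^ 2 ≤ timeBound n ε := by
  have hn' : (1 : ℝ) ≤ n := by exact_mod_cast hn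
  have hlg := one_le_lg (1 / ε)
  have h1 : (n : ℝ) ^ 2 ≤ (n : ℝ) ^ 2 * min (lg n) (lg (1 / ε)) :=
    le_mul_of_one_le_right (by positivity) (le_min (one_le_lg _) hlg)
  have h2 : 0 ≤ (n : ℝ) / ε ^ 2 * lg (1 / ε) * min (n : ℝ) (1 / ε * lg (1 / ε)) := by
    have : 0 ≤ min (n : ℝ) (1 / ε * lg (1 / ε)) := le_min (by positivity) (by positivity)
    positivity
  refine ⟨?_, by rw [timeBound]; linarith⟩
  rw [timeBound]
  rcases le_total ε 1 with h | h
  · have hx : 1 ≤ 1 / ε := by rw [le_div_iff₀ hε]; linarith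
    rw [max_eq_right hx]
    set x := 1 / ε
    have e1 : (n : ℝ) / ε ^ 2 = n * x ^ 2 := by simp only [x]; field_simp
    rw [e1]
    -- The two arguments of the minimum are compared separately, using `1 ≤ x lg x` and `x² lg x ≤
    -- (x lg x)²`.
    have hkey : min (n : ℝ) (x ^ 2 * lg x) ≤ x * lg x * min (n : ℝ) (x * lg x) := by
      rw [mul_min_of_nonneg _ _ (by positivity)]
      have hxl : 1 ≤ x * lg x := by nlinarith
      refine min_le_min (le_mul_of_one_le_left (by positivity) hxl) ?_
      nlinarith [sq_nonneg x, mul_nonneg (sq_nonneg x) (show 0 ≤ lg x * (lg x - 1) by nlinarith)]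
    have := mul_le_mul_of_nonneg_left hkey (show (0 : ℝ) ≤ n * x by positivity)
    have h3 : (n : ℝ) * x ^ 2 * lg x * min (n : ℝ) (x * lg x) =
      n * x * (x * lg x * min (n : ℝ) (x * lg x)) := by ring
    nlinarith [sq_nonneg (n : ℝ)]
  · have hx : 1 / ε ≤ 1 := by rw [div_le_iff₀ hε]; linarith
    rw [max_eq_left hx]
    have := min_le_left (n : ℝ) (1 ^ 2 * lg (1 / ε))
    nlinarith

/-- Per job the dynamic program handles `O(m)` items with lists of length `O(x)`, besides `O(l)`
further steps. Over all jobs this gives `O(n² + n x m)`, and both terms are dominated by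
`mul_min_le_timeBound`. -/
theorem steps_le_timeBound (hε : 0 < ε) {l N K : ℕ} (hN : (N : ℝ) ≤ 24 * max 1 (1 / ε))
    (hK : (K : ℝ) ≤ 129 * (max 1 (1 / ε) * lg (1 / ε))) :
    ((l * (jobCost l N K + 50 * l + 230) + 510 : ℕ) : ℝ) ≤
      300000000 * timeBound (l + 1) ε := by
  obtain ⟨h1, h2⟩ := mul_min_le_timeBound hε (Nat.le_add_left 1 l)
  set x := max 1 (1 / ε)
  set a := lg (1 / ε)
  have hx : 1 ≤ x := le_max_left _ _
  have ha : 1 ≤ a := one_le_lg _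
  push_cast at h1 h2 ⊢
  have hl : (0 : ℝ) ≤ l := Nat.cast_nonneg l
  set m := min ((l : ℝ) + 1) (x ^ 2 * a) with hm
  have hxa : 1 ≤ x ^ 2 * a := one_le_mul_of_one_le_of_one_le (one_le_pow₀ hx) ha
  have hm1 : 1 ≤ m := le_min (by linarith) hxa
  -- From `4 N + 4 ≤ 100 x` and `N + 1 ≤ 25 x` the second count is at most `(129 · 100 + 25) x² lg
  -- (1 / ε)`.
  have hcount : ((min l (K * (4 * N + 4) + (N + 1)) : ℕ) : ℝ) ≤ 13000 * m := by
    rw [hm, mul_min_of_nonneg _ _ (by norm_num)]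
    refine le_min ?_ ?_
    · have : ((min l (K * (4 * N + 4) + (N + 1)) : ℕ) : ℝ) ≤ l := by exact_mod_cast min_le_left _ _
      linarith
    · have h3 : ((min l (K * (4 * N + 4) + (N + 1)) : ℕ) : ℝ) ≤ K * (4 * N + 4) + (N + 1) := by
        exact_mod_cast min_le_right _ _
      have h4 : (K : ℝ) * (4 * N + 4) ≤ 129 * (x * a) * (100 * x) := by
        refine mul_le_mul hK (by linarith) (by positivity) (by positivity)
      have h5 : x ≤ x ^ 2 * a := by nlinarith [mul_nonneg (sub_nonneg.2 hx) (sub_nonneg.2 ha)]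
      nlinarith
  have hcost : ((emitCost N + 40 : ℕ) : ℝ) ≤ 10100 * x := by
    rw [emitCost]; push_cast; linarith
  have hjob : (jobCost l N K : ℝ) ≤ l * 240 + 262600000 * (m * x) + 800 := by
    have h6 : (((min l (K * (4 * N + 4) + (N + 1)) + 1) * (emitCost N + 40) : ℕ) : ℝ) ≤
        (26000 * m) * (10100 * x) := by
      rw [Nat.cast_mul]
      refine mul_le_mul ?_ hcost (Nat.cast_nonneg _) (by positivity)
      rw [Nat.cast_add, Nat.cast_one]
      linarith
    rw [jobCost, Nat.cast_add, Nat.cast_add, Nat.cast_mul l]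
    push_cast at h6 ⊢
    linarith
  have h7 := mul_le_mul_of_nonneg_left hjob hl
  have h8 : (l : ℝ) * (m * x) ≤ (l + 1) * x * m := by
    have : 0 ≤ m * x := by positivity
    nlinarith
  nlinarith

end RunningTime
end MixedShop

theorem theorem6p7 :
    -- every schedule that `C(ε)` can return is feasible and within `1 + ε` of the optimum
    (∀ (ε : ℝ), 0 < ε → ∀ (l : ℕ) (I : MixedShop.Inst l 1) (S : MixedShop.Schedule l 1),
      I.ResultC ε S → I.IsApprox ε S) ∧
    -- `C(ε)` can be carried out by one program (with `ε` as part of the input) in the stated time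
    (∃ (c : MixedShop.Prog) (K : ℝ), ∀ (ε : ℝ), 0 < ε → ∀ (l : ℕ) (I : MixedShop.Inst l 1),
      ∃ (s : MixedShop.State) (t : ℕ),
        MixedShop.Exec c (MixedShop.inputState ε I) s t ∧
        I.ResultC ε (MixedShop.outputSchedule l s) ∧
        (t : ℝ) ≤ K * MixedShop.timeBound (l + 1) ε) := by
  refine ⟨fun ε hε l I S hS => hS.isApprox hε,
    MixedShop.program, 300000000, fun ε hε l I => ?_⟩
  obtain ⟨N, K, h1, h2, h3, h4⟩ := MixedShop.exists_params hε
  obtain ⟨s, t, hexec, hres, ht⟩ := MixedShop.program_spec (I := I) hε h1 h2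
  refine ⟨s, t, hexec, hres, le_trans ?_ (MixedShop.steps_le_timeBound hε h3 h4)⟩
  rw [zero_add] at ht
  exact_mod_cast ht
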